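/- Let $p$ be an odd prime, $n\ge 0$ an integer, $F$ a finite extension of $\mathbb{Q}_p$ with ring of integers $\mathcal{O}_F$, and $K$ a complete discretely valued field extension of $F$ (its valuation extending that of $F$) with valuation ring $R$ and uniformiser $\pi$. Let $\mathfrak g$ be a Lie algebra over $\mathcal{O}_F$, free of finite rank as a module, such that $\mathfrak g_F=F\otimes_{\mathcal{O}_F}\mathfrak g$ is split semisimple with root system $\Phi$. Fix simple roots $\Delta$ with positive roots $\Phi^+$, and assume that $p$ does not divide the determinant of the Cartan matrix of $\Phi$. Assume that $\mathfrak g$ has a Chevalley basis, i.e. an $\mathcal{O}_F$-basis $\{h_\alpha\mid\alpha\in\Delta\}\cup\{e_\beta\mid\beta\in\Phi\}$ such that: $e_\beta$ lies in the $\beta$-root space of $\mathfrak g_F$ for all $\beta\in\Phi$; $[h_\alpha,h_{\beta}]=0$ for $\alpha,\beta\in\Delta$; $[h_\alpha,e_\beta]=\langle\beta,\alpha^\vee\rangle e_\beta$ for $\alpha\in\Delta$, $\beta\in\Phi$; $[e_\alpha,e_{-\alpha}]=h_\alpha$ for $\alpha\in\Delta$; and there are $C_{\alpha,\beta}\in\mathcal{O}_F$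 with $C_{\alpha,\beta}=C_{-\beta,-\alpha}$ such that, for $\alpha,\beta\in\Phi$ with $\alpha+\beta\neq 0$, one has $[e_\alpha,e_\beta]=C_{\alpha,\beta}e_{\alpha+\beta}$ with $C_{\alpha,\beta}\ne 0$ if $\alpha+\beta\in\Phi$, and $[e_\alpha,e_\beta]=0$ with $C_{\alpha,\beta}=0$ otherwise. Let $\mathfrak h$ be the $\mathcal{O}_F$-span of the $h_\alpha$, $\alpha\in\Delta$. Write $\mathfrak g_K=K\otimes_{\mathcal{O}_F}\mathfrak g$, $\mathfrak g_R=R\otimes_{\mathcal{O}_F}\mathfrak g$, and similarly $\mathfrak h_K,\mathfrak h_R$. Let $\widehat{U(\mathfrak g)_{n,K}}$ be the completion of $U(\mathfrak g_K)$ with respect to the filtration $\Gamma_i=\pi^iU(p^n\mathfrak g_R)$, $i\in\mathbb Z$, and for a finitely generated $U(\mathfrak g_K)$-module $M$ put $\widehat M=\widehat{U(\mathfrak g)_{n,K}}\otimes_{U(\mathfrak g_K)}M$. For a weight (that is, a $K$-linear map) $\mu:\mathfrak h_K\to K$, let $L(\mu)$ be the irreducible highest-weight $U(\mathfrak g_K)$-module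 of highest weight $\mu$, and write $\langle\mu,\alpha^\vee\rangle=\mu(h_\alpha)$ for $\alpha\in\Delta$. Put $\rho=\frac12\sum_{\beta\in\Phi^+}\beta$, $s_\alpha(\mu)=\mu-\langle\mu,\alpha^\vee\rangle\alpha$ and $s_\alpha\cdot\mu=s_\alpha(\mu+\rho)-\rho$. Let $\lambda:\mathfrak h_K\to K$ be a weight with $\lambda(p^n\mathfrak h_R)\subseteq R$, and let $\alpha\in\Delta$ be such that $\langle\lambda+\rho,\alpha^\vee\rangle\notin\mathbb N_0=\{0,1,2,\dots\}$. Then $$\operatorname{Ann}_{\widehat{U(\mathfrak g)_{n,K}}}\widehat{L(\lambda)}\ \subseteq\ \operatorname{Ann}_{\widehat{U(\mathfrak g)_{n,K}}}\widehat{L(s_\alpha\cdot\lambda)}.$$ -/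

import Mathlib

open scoped TensorProduct

noncomputable section

namespace AffinoidEnveloping

section Completion

variable {A : Type*} [CommRing A] {K : Type*} [Field K] [Algebra A K]
variable (R : ValuationSubring K) (g : Type*) [LieRing g] [LieAlgebra A g]

/-- For an `A`-module `V` and a valuation ring `R` of `K`, this is `V_R` inside `V_K = K ⊗ V`:
the set of all finite sums of tensors `c ⊗ x` with `c ∈ R` and `x ∈ V`. -/
def integralLattice (V : Type*) [AddCommGroup V] [Module A V] : AddSubgroup (K ⊗[A] V) :=
  AddSubgroup.closure {y | ∃ c ∈ R, ∃ x : V, y = c ⊗ₜ[A] x}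

variable (A K) in
/-- The enveloping algebra `U(g_K)`, where `g_K = K ⊗ g`. -/
abbrev UK : Type _ := UniversalEnvelopingAlgebra K (K ⊗[A] g)

/-- `Γ₀ U(g_K)`: the image of `U(p^n g_R)` in `U(g_K)`, that is, the `R`-subalgebra generated by
`p^n g_R`. -/
def gammaZero (p n : ℕ) : Subring (UK A K g) :=
  Subring.closure
    ({u | ∃ c ∈ R, u = algebraMap K (UK A K g) c} ∪
      {u | ∃ y ∈ integralLattice (A := A) R g,
        u = UniversalEnvelopingAlgebra.ι K (((p : K) ^ n) • y)})

/-- The filtration `Γ_i U(g_K) = π^i Γ₀ U(g_K)`, for `i ∈ ℤ`. -/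
def gamma (p n : ℕ) (π : R) (i : ℤ) : AddSubgroup (UK A K g) :=
  (gammaZero (A := A) R g p n).toAddSubgroup.map
    (AddMonoidHom.mulLeft (algebraMap K (UK A K g) ((π : K) ^ i)))

variable {R g}

lemma mem_gamma {p n : ℕ} {π : R} {i : ℤ} {x : UK A K g} :
    x ∈ gamma R g p n π i ↔
      ∃ u ∈ gammaZero (A := A) R g p n, algebraMap K (UK A K g) ((π : K) ^ i) * u = x :=
  Iff.rfl

lemma algebraMap_mem_gammaZero {p n : ℕ} {c : K} (hc : c ∈ R) :
    algebraMap K (UK A K g) c ∈ gammaZero (A := A) R g p n :=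
  Subring.subset_closure (Or.inl ⟨c, hc, rfl⟩)

lemma coe_ne_zero {π : R} (hπ : Irreducible π) : (π : K) ≠ 0 := by
  have := hπ.ne_zero
  simpa using this

lemma gamma_anti {p n : ℕ} {π : R} (hπ : Irreducible π) {i j : ℤ} (hij : i ≤ j) :
    gamma (A := A) R g p n π j ≤ gamma R g p n π i := by
  intro x hx
  obtain ⟨u, hu, rfl⟩ := mem_gamma.1 hx
  obtain ⟨k, rfl⟩ := Int.le.dest hij
  refine mem_gamma.2 ⟨algebraMap K _ ((π : K) ^ k) * u,
    mul_mem (algebraMap_mem_gammaZero (pow_mem π.2 k)) hu, ?_⟩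
  rw [← mul_assoc, ← map_mul, zpow_add₀ (coe_ne_zero hπ), zpow_natCast]

lemma mul_mem_gamma {p n : ℕ} {π : R} (hπ : Irreducible π) {i j : ℤ} {x y : UK A K g}
    (hx : x ∈ gamma R g p n π i) (hy : y ∈ gamma R g p n π j) :
    x * y ∈ gamma R g p n π (i + j) := by
  obtain ⟨u, hu, rfl⟩ := mem_gamma.1 hx
  obtain ⟨v, hv, rfl⟩ := mem_gamma.1 hy
  refine mem_gamma.2 ⟨u * v, mul_mem hu hv, ?_⟩
  rw [zpow_add₀ (coe_ne_zero hπ), map_mul, mul_assoc, mul_assoc, ← mul_assoc u,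
    ← Algebra.commutes ((π : K) ^ j) u, mul_assoc]

lemma exists_pow_mul_mem [IsDiscreteValuationRing R] {π : R} (hπ : Irreducible π) (c : K) :
    ∃ m : ℕ, (π : K) ^ m * c ∈ R := by
  obtain ⟨a, b, hb, rfl⟩ := IsFractionRing.div_surjective (A := R) c
  have hb0 : b ≠ 0 := nonZeroDivisors.ne_zero hb
  obtain ⟨m, u, rfl⟩ := IsDiscreteValuationRing.eq_unit_mul_pow_irreducible hb0 hπ
  refine ⟨m, ?_⟩
  have h1 : ((u : R) : K) ≠ 0 := by simp
  have h2 := coe_ne_zero hπ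
  have : (π : K) ^ m * (algebraMap R K a / algebraMap R K (u * π ^ m))
      = (((↑u⁻¹ : R) * a : R) : K) := by
    have h3 : ((u : R) : K) * ((↑u⁻¹ : R) : K) = 1 := by
      exact_mod_cast congrArg (Subtype.val) (Units.mul_inv u)
    change (π : K) ^ m * ((a : K) / (((u : R) * π ^ m : R) : K)) = _
    push_cast
    field_simp
    linear_combination (-(a : K)) * h3
  rw [this]
  exact Subtype.property _

attribute [local instance] LieRing.ofAssociativeRing in
lemma exists_mem_gamma [IsDiscreteValuationRing R] [CharZero K] {p : ℕ} [NeZero p] {n : ℕ} {π : R}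
    (hπ : Irreducible π) (x : UK A K g) :
    ∃ m : ℕ, algebraMap K (UK A K g) ((π : K) ^ m) * x ∈ gammaZero (A := A) R g p n := by
  have key : ∀ (m k : ℕ) (y : UK A K g),
      algebraMap K (UK A K g) ((π : K) ^ m) * y ∈ gammaZero (A := A) R g p n →
      algebraMap K (UK A K g) ((π : K) ^ (m + k)) * y ∈ gammaZero (A := A) R g p n := by
    intro m k y hy
    rw [add_comm, pow_add, map_mul, mul_assoc]
    exact mul_mem (algebraMap_mem_gammaZero (pow_mem π.2 k)) hy
  let S : Subalgebra K (UK A K g) :=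
    { carrier := {x | ∃ m : ℕ,
        algebraMap K (UK A K g) ((π : K) ^ m) * x ∈ gammaZero (A := A) R g p n}
      mul_mem' := by
        rintro x y ⟨m, hm⟩ ⟨k, hk⟩
        refine ⟨m + k, ?_⟩
        have := mul_mem hm hk
        rwa [mul_assoc, ← mul_assoc x, ← Algebra.commutes _ x, mul_assoc, ← mul_assoc,
          ← map_mul, ← pow_add] at this
      add_mem' := by
        rintro x y ⟨m, hm⟩ ⟨k, hk⟩
        refine ⟨m + k, ?_⟩
        rw [mul_add]
        refine add_mem (key m k x hm) ?_
        rw [add_comm]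
        exact key k m y hk
      algebraMap_mem' := by
        intro c
        obtain ⟨m, hm⟩ := exists_pow_mul_mem hπ c
        refine ⟨m, ?_⟩
        rw [← map_mul]
        exact algebraMap_mem_gammaZero hm }
  have hι : ∀ y : K ⊗[A] g, UniversalEnvelopingAlgebra.ι K y ∈ S := by
    intro y
    induction y using TensorProduct.induction_on with
    | zero => rw [map_zero]; exact zero_mem S
    | add a b ha hb => rw [map_add]; exact add_mem ha hb
    | tmul c z =>
      obtain ⟨m, hm⟩ := exists_pow_mul_mem hπ (((p : K) ^ n)⁻¹ * c)
      refine ⟨m, Subring.subset_closure (Or.inr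
        ⟨((π : K) ^ m * (((p : K) ^ n)⁻¹ * c)) ⊗ₜ z,
          AddSubgroup.subset_closure ⟨_, hm, z, rfl⟩, ?_⟩)⟩
      have hp : ((p : K) ^ n) ≠ 0 := pow_ne_zero _ (Nat.cast_ne_zero.2 (NeZero.ne p))
      rw [← Algebra.smul_def, ← map_smul, TensorProduct.smul_tmul', TensorProduct.smul_tmul']
      congr 2
      simp only [smul_eq_mul]
      field_simp
  let f : K ⊗[A] g →ₗ⁅K⁆ S :=
    { toFun := fun y => ⟨UniversalEnvelopingAlgebra.ι K y, hι y⟩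
      map_add' := fun a b => Subtype.ext (map_add _ a b)
      map_smul' := fun c a => Subtype.ext (map_smul _ c a)
      map_lie' := fun {a b} => Subtype.ext (LieHom.map_lie _ a b) }
  have h : S.val.comp (UniversalEnvelopingAlgebra.lift K f) = AlgHom.id K _ := by
    apply UniversalEnvelopingAlgebra.hom_ext
    ext y
    change S.val (UniversalEnvelopingAlgebra.lift K f (UniversalEnvelopingAlgebra.ι K y)) = _
    rw [UniversalEnvelopingAlgebra.lift_ι_apply]
    rfl
  have hx := congrArg (fun φ => φ x) h
  change S.val (UniversalEnvelopingAlgebra.lift K f x) = x at hx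
  have := (UniversalEnvelopingAlgebra.lift K f x).2
  rw [← hx]
  exact this

lemma ringSubgroupsBasis_gamma [IsDiscreteValuationRing R] [CharZero K] (p : ℕ) [NeZero p]
    (n : ℕ) {π : R} (hπ : Irreducible π) :
    RingSubgroupsBasis (gamma (A := A) R g p n π) := by
  have hex : ∀ x : UK A K g, ∃ m : ℕ, x ∈ gamma R g p n π (-(m : ℤ)) := by
    intro x
    obtain ⟨m, hm⟩ := exists_mem_gamma (p := p) (n := n) hπ x
    refine ⟨m, mem_gamma.2 ⟨_, hm, ?_⟩⟩
    rw [← mul_assoc, ← map_mul, zpow_neg, zpow_natCast,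
      inv_mul_cancel₀ (pow_ne_zero _ (coe_ne_zero hπ)), map_one, one_mul]
  refine ⟨fun i j => ⟨max i j, le_inf (gamma_anti hπ (le_max_left _ _))
    (gamma_anti hπ (le_max_right _ _))⟩, fun i => ⟨max i 0, ?_⟩, fun x i => ?_, fun x i => ?_⟩
  · rintro _ ⟨a, ha, b, hb, rfl⟩
    have := mul_mem_gamma hπ ha hb
    exact gamma_anti hπ (by omega) this
  · obtain ⟨m, hm⟩ := hex x
    refine ⟨i + m, fun y hy => ?_⟩
    have := mul_mem_gamma hπ hm hy
    exact gamma_anti hπ (by omega) this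
  · obtain ⟨m, hm⟩ := hex x
    refine ⟨i + m, fun y hy => ?_⟩
    have := mul_mem_gamma hπ hy hm
    exact gamma_anti hπ (by omega) this

variable (R g)

/-- A copy of `U(g_K)`, to be equipped with the topology of the filtration `Γ`. -/
def FilteredUK [IsDiscreteValuationRing R] [CharZero K] (p : ℕ) [NeZero p] (n : ℕ) {π : R}
    (_ : Irreducible π) : Type _ :=
  UK A K g

section

variable [IsDiscreteValuationRing R] [CharZero K] (p : ℕ) [NeZero p] (n : ℕ) {π : R}
  (hπ : Irreducible π)

instance : Ring (FilteredUK (A := A) R g p n hπ) :=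
  inferInstanceAs (Ring (UK A K g))

/-- The topology on `U(g_K)` in which the `Γ_i` form a basis of neighbourhoods of zero. -/
instance : TopologicalSpace (FilteredUK (A := A) R g p n hπ) :=
  (ringSubgroupsBasis_gamma (A := A) (g := g) p n hπ).topology

instance : IsTopologicalRing (FilteredUK (A := A) R g p n hπ) :=
  (ringSubgroupsBasis_gamma (A := A) (g := g) p n hπ).toRingFilterBasis.isTopologicalRing

instance : UniformSpace (FilteredUK (A := A) R g p n hπ) :=
  IsTopologicalAddGroup.rightUniformSpace _

instance : IsUniformAddGroup (FilteredUK (A := A) R g p n hπ) :=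
  isUniformAddGroup_of_addCommGroup

/-- The completed enveloping algebra: the completion of `U(g_K)` with respect to the
filtration `Γ`. -/
abbrev CompletedUK : Type _ :=
  UniformSpace.Completion (FilteredUK (A := A) R g p n hπ)

/-- The canonical map from `U(g_K)` to its completion. -/
def toCompletedUK : UK A K g →+* CompletedUK (A := A) R g p n hπ :=
  UniformSpace.Completion.coeRingHom (α := FilteredUK (A := A) R g p n hπ)

end

end Completion

section Extension

variable {S T : Type*} [Ring S] [Ring T] (φ : S →+* T) (M : Type*) [AddCommGroup M] [Module S M]

/-- The submodule of relations `(t φ(s)) ⊗ m = t ⊗ (s m)` in `T ⊗_ℤ M`. -/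
def extensionRelations : Submodule T (T ⊗[ℤ] M) :=
  Submodule.span T {z | ∃ (t : T) (s : S) (m : M), z = (t * φ s) ⊗ₜ[ℤ] m - t ⊗ₜ[ℤ] (s • m)}

/-- The left `T`-module `T ⊗_S M`, for a homomorphism `S → T` of not necessarily commutative
rings and a left `S`-module `M`. -/
abbrev ExtensionOfScalars : Type _ :=
  (T ⊗[ℤ] M) ⧸ extensionRelations φ M

end Extension

section Chevalley

variable {ι k X Y : Type*} [Field k] [CharZero k] [AddCommGroup X] [Module k X]
  [AddCommGroup Y] [Module k Y] {P : RootPairing ι k X Y} [P.IsCrystallographic]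

/-- A Chevalley basis of an `A`-Lie algebra `g`, for a root system `P` with base `b`: an `A`-basis
consisting of `h α` for `α` simple and `e β` for all roots `β` (so that `e (-β)` is what is
usually written `f β`, for `β` positive), satisfying the relations below. Roots are handled
through their indices; `P.reflectionPerm α α` is the index of the root `-α`. -/
structure ChevalleyBasis (b : P.Base) (A g : Type*) [CommRing A] [LieRing g] [LieAlgebra A g] where
  basis : Module.Basis (b.support ⊕ ι) A g
  /-- The structure constants. -/
  C : ι → ι → A
  lie_h_h : ∀ α β : b.support, ⁅basis (.inl α), basis (.inl β)⁆ = 0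
  lie_h_e : ∀ (α : b.support) (β : ι),
    ⁅basis (.inl α), basis (.inr β)⁆ = P.pairingIn ℤ β α • basis (.inr β)
  lie_e_f : ∀ α : b.support,
    ⁅basis (.inr α), basis (.inr (P.reflectionPerm α α))⁆ = basis (.inl α)
  lie_e_e : ∀ α β γ : ι, P.root α + P.root β = P.root γ →
    ⁅basis (.inr α), basis (.inr β)⁆ = C α β • basis (.inr γ)
  lie_e_e_eq_zero : ∀ α β : ι, P.root α + P.root β ≠ 0 →
    P.root α + P.root β ∉ Set.range P.root → ⁅basis (.inr α), basis (.inr β)⁆ = 0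
  C_ne_zero_iff : ∀ α β : ι, P.root α + P.root β ≠ 0 →
    (C α β ≠ 0 ↔ P.root α + P.root β ∈ Set.range P.root)
  C_neg : ∀ α β : ι, C α β = C (P.reflectionPerm β β) (P.reflectionPerm α α)

namespace ChevalleyBasis

variable {b : P.Base} {A g : Type*} [CommRing A] [LieRing g] [LieAlgebra A g]
  (B : ChevalleyBasis b A g)

/-- The element `h_α`, for `α` simple. -/
def h (α : b.support) : g := B.basis (.inl α)

/-- The root vector `e_β`, for any root `β`. -/
def e (β : ι) : g := B.basis (.inr β)

/-- The subalgebra `h` of `g`, as an `A`-module: the span of all `h_α` with `α` simple. -/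
def cartan : Submodule A g := Submodule.span A (Set.range B.h)

/-- The element `h_α` of `h`, for `α` simple. -/
def hCartan (α : b.support) : B.cartan :=
  ⟨B.h α, Submodule.subset_span (Set.mem_range_self α)⟩

variable (K : Type*) [Field K] [Algebra A K]

/-- The dual space of `h_K = K ⊗ h`, whose elements are the weights. -/
abbrev Weight : Type _ := Module.Dual K (K ⊗[A] B.cartan)

variable {K}

/-- `⟨μ, α^∨⟩ = μ(h_α)`, for a weight `μ` and a simple root `α`. -/
def pairingCoroot (μ : B.Weight K) (α : b.support) : K := μ (1 ⊗ₜ B.hCartan α)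

variable (K)

/-- The root `β` as a weight: the functional on `h_K` with `h_α ↦ ⟨β, α^∨⟩` for `α` simple. -/
def rootWeight (β : ι) : B.Weight K :=
  LinearMap.liftBaseChange K
    ((B.basis.constr A (Sum.elim (fun α : b.support => ((P.pairingIn ℤ β α : ℤ) : K))
      (fun _ => 0))).comp B.cartan.subtype)

/-- The half sum `ρ` of the positive roots. -/
def rho [Fintype ι] : B.Weight K :=
  open Classical in
  (2 : K)⁻¹ • ∑ β : ι with b.IsPos β, B.rootWeight K β

variable {K}

/-- The simple reflection `s_α` acting on weights, `s_α μ = μ - ⟨μ, α^∨⟩ α`. -/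
def reflect (α : b.support) (μ : B.Weight K) : B.Weight K :=
  μ - B.pairingCoroot μ α • B.rootWeight K α

/-- The dot action of a simple reflection, `s_α · μ = s_α (μ + ρ) - ρ`. -/
def dotReflect [Fintype ι] (α : b.support) (μ : B.Weight K) : B.Weight K :=
  B.reflect α (μ + B.rho K) - B.rho K

/-- The left ideal of `U(g_K)` generated by all `e_β` with `β` positive and all `x - μ(x)` with
`x ∈ h_K`. -/
def vermaIdeal (μ : B.Weight K) : Submodule (UK A K g) (UK A K g) :=
  Submodule.span (UK A K g)
    ({u | ∃ β : ι, b.IsPos β ∧ u = UniversalEnvelopingAlgebra.ι K ((1 : K) ⊗ₜ[A] B.e β)} ∪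
      {u | ∃ x : K ⊗[A] B.cartan,
        u = UniversalEnvelopingAlgebra.ι K (B.cartan.subtype.baseChange K x) -
          algebraMap K (UK A K g) (μ x)})

/-- The Verma module `M(μ)` of highest weight `μ`. -/
abbrev Verma (μ : B.Weight K) : Type _ := UK A K g ⧸ B.vermaIdeal μ

/-- The sum of all proper submodules of the Verma module, which is its largest proper submodule. -/
def vermaRadical (μ : B.Weight K) : Submodule (UK A K g) (B.Verma μ) :=
  sSup {N | N ≠ ⊤}

/-- The irreducible highest-weight module `L(μ)`: the irreducible quotient of the Verma module. -/
abbrev Irred (μ : B.Weight K) : Type _ := B.Verma μ ⧸ B.vermaRadical μ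

/-- The annihilator in the completed enveloping algebra of the completion
of `L(μ)`, that is, of the module induced from `L(μ)`. -/
def annCompletedIrred (R : ValuationSubring K) [IsDiscreteValuationRing R] [CharZero K] (p : ℕ)
    [NeZero p] (n : ℕ) {π : R} (hπ : Irreducible π) (μ : B.Weight K) :
    Ideal (CompletedUK (A := A) R g p n hπ) :=
  Module.annihilator (CompletedUK (A := A) R g p n hπ)
    (ExtensionOfScalars (toCompletedUK (A := A) R g p n hπ) (B.Irred μ))

end ChevalleyBasis

end Chevalley

end AffinoidEnveloping

end

/-! Put c = p^n, F = c e_{-α}, a = ⟨λ, α^∨⟩, and let v be the highest-weight vector of L(λ). Since a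
is not a natural number, no F^m v vanishes, and the coefficient ξ_m of F^m v is a well-defined
functional on L(λ). For u in U(g_K), ξ_m(u F^m v) is for large m a polynomial Q_u in cm, and u ∈ Γ_i
forces Q_u ∈ π^i R[X] (`StringDatum.exists_polynomial_ξ`, `poly_mem`). Formally, F^(a+1) v would be
a singular vector of weight λ - (a+1)α = s_α · λ. Accordingly Ψ(u) = Q_u(c(a+1)) factors through the
Verma module of highest weight s_α · λ (`StringDatum.IsIntegral.isVermaFunctional`), and it is
bounded because c(a+1) ∈ R.

The main step is `poly_mem_of_memClosure`: if x kills the completion of L(λ) and u agrees with x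
modulo the closure of Γ_i, then Q_u ∈ π^i R[X]. A better approximation u' changes Q_u only by an
element of π^i R[X]. Its polynomial is tiny at all points cm: for large m because x F^m v = 0, and
for the other m by p-adic continuity (`eval_mem_of_eventually`). The degree of Q_{u'} is not
controlled, but Q_u is fixed, and dividing successively by X - cm bounds its coefficients
(`mem_polyLattice_of_small_values`).

The annihilator is a two-sided ideal, so for all y and t the value Ψ(y u) is small once u
approximates x t well. The largest left ideal in the kernel of Ψ (`leftRadical`) annihilates the
highest-weight vector of L(s_α · λ). The quotient of U(g_K) by it has finite-dimensional graded
pieces, and this smallness puts x t in its closure (`memClosure_leftRadical`).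

Closures do no harm: Γ₀ is noetherian (`isNoetherianRing_gammaZero`), so a left ideal of U(g_K)
generates a closed left ideal of the completion (`mem_span_of_memClosure`). The existence of ξ_m
requires v ≠ 0, hence non-zero Verma modules. In place of a PBW basis, these come from an action of
g_K on rational functions twisted by a cocycle (`vermaIdeal_ne_top`), and spanning statements come
from rewriting words (`smul_mem_descendants`). -/

set_option linter.unusedSectionVars false

/-! ### Noetherianity of almost commutative rings -/

section AlmostCommutative

variable {R S I : Type*} [CommRing R] [Ring S] [Algebra R S] (x : I → S)

/-- The span of all words of length less than `m` in the elements `x i`. -/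
def wordSpan (R : Type*) {S I : Type*} [CommRing R] [Ring S] [Algebra R S] (x : I → S) (m : ℕ) :
    Submodule R S :=
  Submodule.span R {w | ∃ l : List I, l.length < m ∧ w = (l.map x).prod}

/-- The linear map sending each monomial to a word with the same letters. -/
noncomputable def monomialWord (R : Type*) {S I : Type*} [CommRing R] [Ring S] [Algebra R S]
    (x : I → S) : MvPolynomial I R →ₗ[R] S :=
  (MvPolynomial.basisMonomials I R).constr R
    fun d => ((Finsupp.toMultiset d).toList.map x).prod

variable {x}

lemma wordSpan_mono {m m' : ℕ} (h : m ≤ m') : wordSpan R x m ≤ wordSpan R x m' :=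
  Submodule.span_mono fun _ ⟨l, hl, hw⟩ => ⟨l, hl.trans_le h, hw⟩

lemma word_mem_wordSpan {m : ℕ} {l : List I} (h : l.length < m) :
    (l.map x).prod ∈ wordSpan R x m :=
  Submodule.subset_span ⟨l, h, rfl⟩

lemma wordSpan_zero : wordSpan R x 0 = ⊥ := by
  simp [wordSpan]

/-- The bound on lengths in `wordSpan` is strict, so filtration degree `m` is `wordSpan (m + 1)`;
hence the shift in one factor only. -/
lemma mul_mem_wordSpan {a c : S} {m m' : ℕ} (ha : a ∈ wordSpan R x (m + 1))
    (hc : c ∈ wordSpan R x m') : a * c ∈ wordSpan R x (m + m') := by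
  induction ha using Submodule.span_induction with
  | zero => simp
  | add a a' _ _ h h' => rw [add_mul]; exact add_mem h h'
  | smul r a _ h => rw [smul_mul_assoc]; exact Submodule.smul_mem _ _ h
  | mem a ha =>
    obtain ⟨l, hl, rfl⟩ := ha
    induction hc using Submodule.span_induction with
    | zero => simp
    | add a a' _ _ h h' => rw [mul_add]; exact add_mem h h'
    | smul r a _ h => rw [mul_smul_comm]; exact Submodule.smul_mem _ _ h
    | mem c hc =>
      obtain ⟨l', hl', rfl⟩ := hc
      rw [← List.prod_append, ← List.map_append]
      exact word_mem_wordSpan (by rw [List.length_append]; omega)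

/-- Swapping two adjacent letters costs a commutator, which is linear in the letters and so makes
the word shorter by one. -/
lemma word_sub_word_mem_of_perm
    (hx : ∀ i j, x i * x j - x j * x i ∈ Submodule.span R (Set.range x)) {l l' : List I}
    (h : l.Perm l') : (l.map x).prod - (l'.map x).prod ∈ wordSpan R x l.length := by
  induction h with
  | nil => simp
  | @cons i l l' _ ih =>
    simp only [List.map_cons, List.prod_cons, List.length_cons, ← mul_sub]
    rw [add_comm]
    refine mul_mem_wordSpan ?_ ih
    simpa using word_mem_wordSpan (R := R) (x := x) (l := [i]) (m := 2) (by simp)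
  | swap i j l =>
    simp only [List.map_cons, List.prod_cons, List.length_cons, ← mul_assoc, ← sub_mul]
    have h1 : x j * x i - x i * x j ∈ wordSpan R x (1 + 1) := by
      refine (Submodule.span_le.2 ?_) (hx j i)
      rintro _ ⟨k, rfl⟩
      simpa using word_mem_wordSpan (R := R) (x := x) (l := [k]) (m := 2) (by simp)
    have := mul_mem_wordSpan h1 (word_mem_wordSpan (R := R) (x := x) (Nat.lt_succ_self l.length))
    rwa [add_comm] at this
  | @trans l l' l'' h _ ih ih' =>
    rw [← sub_add_sub_cancel]
    rw [← h.length_eq] at ih'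
    exact add_mem ih ih'

lemma monomialWord_monomial (d : I →₀ ℕ) :
    monomialWord R x (MvPolynomial.monomial d 1) =
      ((Finsupp.toMultiset d).toList.map x).prod := by
  have := (MvPolynomial.basisMonomials I R).constr_basis R
    (fun d => ((Finsupp.toMultiset d).toList.map x).prod) d
  rwa [MvPolynomial.coe_basisMonomials] at this

lemma length_toList_toMultiset (d : I →₀ ℕ) : (Finsupp.toMultiset d).toList.length = d.degree := by
  rw [Multiset.length_toList, Finsupp.card_toMultiset]; rfl

lemma homogeneous_induction {m : ℕ} {f : MvPolynomial I R} (hf : f.IsHomogeneous m)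
    {p : MvPolynomial I R → Prop} (h0 : p 0) (ha : ∀ f g, p f → p g → p (f + g))
    (hs : ∀ (r : R) f, p f → p (r • f))
    (hm : ∀ d : I →₀ ℕ, d.degree = m → p (MvPolynomial.monomial d 1)) : p f := by
  have : f ∈ Submodule.span R
      ((fun d => MvPolynomial.monomial d (1 : R)) '' {d : I →₀ ℕ | d.degree = m}) := by
    rw [f.as_sum]
    refine Submodule.sum_mem _ fun d hd => ?_
    have h1 : MvPolynomial.monomial d (f.coeff d) = f.coeff d • MvPolynomial.monomial d (1 : R) := by
      rw [MvPolynomial.smul_monomial, smul_eq_mul, mul_one]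
    rw [h1]
    refine Submodule.smul_mem _ _ (Submodule.subset_span ⟨d, ?_, rfl⟩)
    exact (hf.degree_eq_sum_deg_support hd).symm
  clear hf
  induction this using Submodule.span_induction with
  | zero => exact h0
  | add a b _ _ h h' => exact ha _ _ h h'
  | smul r a _ h => exact hs _ _ h
  | mem a h => obtain ⟨d, hd, rfl⟩ := h; exact hm d hd

lemma monomialWord_mem_wordSpan {m : ℕ} {f : MvPolynomial I R} (hf : f.IsHomogeneous m) :
    monomialWord R x f ∈ wordSpan R x (m + 1) := by
  refine homogeneous_induction (p := fun f => monomialWord R x f ∈ wordSpan R x (m + 1)) hf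
    (by simp) (fun f g h h' => ?_) (fun r f h => ?_) fun d hd => ?_
  · rw [map_add]; exact add_mem h h'
  · rw [map_smul]; exact Submodule.smul_mem _ _ h
  · rw [monomialWord_monomial]
    exact word_mem_wordSpan (by rw [length_toList_toMultiset, hd]; omega)

/-- The arbitrary order of letters chosen by `monomialWord` matters only modulo shorter words, so
the map is multiplicative on leading terms. -/
lemma monomialWord_mul_sub_mem
    (hx : ∀ i j, x i * x j - x j * x i ∈ Submodule.span R (Set.range x)) {m m' : ℕ}
    {f f' : MvPolynomial I R} (hf : f.IsHomogeneous m) (hf' : f'.IsHomogeneous m') :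
    monomialWord R x f * monomialWord R x f' - monomialWord R x (f * f') ∈
      wordSpan R x (m + m') := by
  refine homogeneous_induction (p := fun f => monomialWord R x f * monomialWord R x f' -
    monomialWord R x (f * f') ∈ wordSpan R x (m + m')) hf (by simp) (fun f g h h' => ?_) (fun r f h => ?_) fun d hd => ?_
  · rw [map_add, add_mul, add_mul, map_add, add_sub_add_comm]; exact add_mem h h'
  · rw [map_smul, smul_mul_assoc, smul_mul_assoc, map_smul, ← smul_sub]
    exact Submodule.smul_mem _ _ h
  · refine homogeneous_induction (p := fun f' => monomialWord R x (MvPolynomial.monomial d 1) *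
      monomialWord R x f' - monomialWord R x (MvPolynomial.monomial d 1 * f') ∈
        wordSpan R x (m + m')) hf' (by simp) (fun f g h h' => ?_) (fun r f h => ?_)
      fun d' hd' => ?_
    · rw [map_add, mul_add, mul_add, map_add, add_sub_add_comm]; exact add_mem h h'
    · rw [map_smul, mul_smul_comm, mul_smul_comm, map_smul, ← smul_sub]
      exact Submodule.smul_mem _ _ h
    · rw [MvPolynomial.monomial_mul, one_mul, monomialWord_monomial, monomialWord_monomial,
        monomialWord_monomial, ← List.prod_append, ← List.map_append]
      have := word_sub_word_mem_of_perm hx (l := (Finsupp.toMultiset d).toList ++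
        (Finsupp.toMultiset d').toList) (l' := (Finsupp.toMultiset (d + d')).toList)
        (by rw [← Multiset.coe_eq_coe]; simp [← Multiset.coe_add])
      rwa [List.length_append, length_toList_toMultiset, length_toList_toMultiset, hd, hd'] at this

/-- Existence of a leading symbol. It need not be unique, as the words may be linearly dependent;
existence is enough for the basis theorem below. -/
lemma exists_homogeneous_sub_mem
    (hx : ∀ i j, x i * x j - x j * x i ∈ Submodule.span R (Set.range x)) {m : ℕ} {y : S}
    (hy : y ∈ wordSpan R x (m + 1)) :
    ∃ f : MvPolynomial I R, f.IsHomogeneous m ∧ y - monomialWord R x f ∈ wordSpan R x m := by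
  classical
  induction hy using Submodule.span_induction with
  | zero => exact ⟨0, MvPolynomial.isHomogeneous_zero _ _ _, by simp⟩
  | add a a' _ _ h h' =>
    obtain ⟨f, hf, h⟩ := h
    obtain ⟨f', hf', h'⟩ := h'
    refine ⟨f + f', hf.add hf', ?_⟩
    rw [map_add, add_sub_add_comm]; exact add_mem h h'
  | smul r a _ h =>
    obtain ⟨f, hf, h⟩ := h
    refine ⟨r • f, (MvPolynomial.homogeneousSubmodule I R m).smul_mem r hf, ?_⟩
    rw [map_smul, ← smul_sub]; exact Submodule.smul_mem _ _ h
  | mem a h =>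
    obtain ⟨l, hl, rfl⟩ := h
    rcases (Nat.lt_succ_iff_lt_or_eq.1 hl) with hl | hl
    · exact ⟨0, MvPolynomial.isHomogeneous_zero _ _ _, by simpa using word_mem_wordSpan hl⟩
    · have hp : (Finsupp.toMultiset (Multiset.toFinsupp (l : Multiset I))).toList.Perm l := by
        rw [← Multiset.coe_eq_coe]; simp
      refine ⟨MvPolynomial.monomial (Multiset.toFinsupp (l : Multiset I)) 1,
        MvPolynomial.isHomogeneous_monomial _ ?_, ?_⟩
      · rw [← length_toList_toMultiset, hp.length_eq, hl]
      · rw [monomialWord_monomial, ← hl]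
        exact word_sub_word_mem_of_perm hx hp.symm

lemma exists_homogeneousComponent_mul {m k : ℕ} (c : MvPolynomial I R) {f : MvPolynomial I R}
    (hf : f.IsHomogeneous k) :
    (∃ c' : MvPolynomial I R, ∃ m', m' + k = m ∧ c'.IsHomogeneous m' ∧
      MvPolynomial.homogeneousComponent m (c * f) = c' * f) ∨
      MvPolynomial.homogeneousComponent m (c * f) = 0 := by
  classical
  have h : MvPolynomial.homogeneousComponent m (c * f) =
      ∑ i ∈ Finset.range (c.totalDegree + 1),
        if i + k = m then MvPolynomial.homogeneousComponent i c * f else 0 := by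
    conv_lhs => rw [← MvPolynomial.sum_homogeneousComponent c, Finset.sum_mul, map_sum]
    refine Finset.sum_congr rfl fun i _ => ?_
    rw [MvPolynomial.homogeneousComponent_of_mem
      ((MvPolynomial.homogeneousComponent_isHomogeneous i c).mul hf)]
    simp only [eq_comm]
  rw [h]
  by_cases hk : k ≤ m
  · left
    by_cases hm : m - k ∈ Finset.range (c.totalDegree + 1)
    · refine ⟨MvPolynomial.homogeneousComponent (m - k) c, m - k, by omega,
        MvPolynomial.homogeneousComponent_isHomogeneous _ c, ?_⟩
      rw [Finset.sum_eq_single_of_mem _ hm fun i _ hi => if_neg (by omega), if_pos (by omega)]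
    · refine ⟨0, m - k, by omega, MvPolynomial.isHomogeneous_zero _ _ _, ?_⟩
      rw [zero_mul]
      refine Finset.sum_eq_zero fun i hi => if_neg ?_
      rintro rfl
      exact hm (by simpa using hi)
  · right
    exact Finset.sum_eq_zero fun i _ => if_neg (by omega)

/-- Hilbert's basis theorem for the ideal generated by the leading symbols of a left ideal `J`:
finitely many elements of `J` whose symbols generate that ideal generate `J`, by induction on the
degree. -/
theorem isNoetherianRing_of_adjoin_eq_top [IsNoetherianRing R] [Finite I]
    (hx : ∀ i j, x i * x j - x j * x i ∈ Submodule.span R (Set.range x))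
    (htop : Algebra.adjoin R (Set.range x) = ⊤) : IsNoetherianRing S := by
  classical
  refine isNoetherianRing_iff.2 ⟨fun J => ?_⟩
  let T : Set (MvPolynomial I R) :=
    {f | ∃ m, f.IsHomogeneous m ∧ ∃ y ∈ J, y - monomialWord R x f ∈ wordSpan R x m}
  obtain ⟨T', hT', hspan⟩ := (Submodule.fg_span_iff_fg_span_finset_subset T).1
    (IsNoetherian.noetherian (Ideal.span T))
  have hT'' : ∀ f : T', ∃ m, f.1.IsHomogeneous m ∧
      ∃ y ∈ J, y - monomialWord R x f.1 ∈ wordSpan R x m := fun f => hT' f.2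
  choose deg hdeg y hyJ hy using hT''
  have key : ∀ m, ∀ z ∈ J, z ∈ wordSpan R x m → z ∈ Submodule.span S (Set.range y) := by
    intro m
    induction m with
    | zero =>
      intro z _ hz
      rw [wordSpan_zero, Submodule.mem_bot] at hz
      rw [hz]; exact zero_mem _
    | succ m ih =>
      intro z hzJ hz
      obtain ⟨f, hf, hzf⟩ := exists_homogeneous_sub_mem hx hz
      have hfT : f ∈ Submodule.span (MvPolynomial I R) (T' : Set (MvPolynomial I R)) := by
        rw [← hspan]
        exact Submodule.subset_span ⟨m, hf, z, hzJ, hzf⟩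
      rw [Submodule.mem_span_finset'] at hfT
      obtain ⟨c, hc⟩ := hfT
      -- The coefficients `c k` need not be homogeneous; taking the parts of degree `m` replaces
      -- them by homogeneous ones.
      have hf' : f = ∑ k : T', MvPolynomial.homogeneousComponent m (c k * k.1) := by
        rw [← map_sum]
        simp only [smul_eq_mul] at hc
        rw [hc, MvPolynomial.homogeneousComponent_of_mem hf, if_pos rfl]
      have hk : ∀ k : T', ∃ s : S,
          monomialWord R x (MvPolynomial.homogeneousComponent m (c k * k.1)) - s * y k ∈
            wordSpan R x m := by
        intro k
        rcases exists_homogeneousComponent_mul (m := m) (c k) (hdeg k) with ⟨c', m', hm', hc', h⟩ | h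
        · refine ⟨monomialWord R x c', ?_⟩
          rw [h]
          have h1 := monomialWord_mul_sub_mem hx hc' (hdeg k)
          have h2 := mul_mem_wordSpan (monomialWord_mem_wordSpan (x := x) hc') (hy k)
          rw [hm'] at h1 h2
          rw [mul_sub] at h2
          have := neg_mem (add_mem h1 h2)
          convert this using 1
          abel
        · exact ⟨0, by rw [h]; simp⟩
      choose s hs using hk
      have h1 : ∑ k, s k * y k ∈ Submodule.span S (Set.range y) :=
        Submodule.sum_mem _ fun k _ =>
          Submodule.smul_mem _ (s k) (Submodule.subset_span (Set.mem_range_self k))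
      have h2 : ∑ k, s k * y k ∈ J := Submodule.sum_mem _ fun k _ => J.smul_mem (s k) (hyJ k)
      have h3 : z - ∑ k, s k * y k ∈ wordSpan R x m := by
        have h4 : monomialWord R x f - ∑ k, s k * y k ∈ wordSpan R x m := by
          have h5 := congrArg (monomialWord R x) hf'
          rw [map_sum] at h5
          rw [h5, ← Finset.sum_sub_distrib]
          exact Submodule.sum_mem _ fun k _ => hs k
        have := add_mem hzf h4
        rwa [sub_add_sub_cancel] at this
      have := add_mem (ih _ (sub_mem hzJ h2) h3) h1
      rwa [sub_add_cancel] at this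
  have hmem : ∀ z : S, ∃ m, z ∈ wordSpan R x m := by
    intro z
    have hz : z ∈ Algebra.adjoin R (Set.range x) := by rw [htop]; trivial
    induction hz using Algebra.adjoin_induction with
    | mem z hz =>
      obtain ⟨i, rfl⟩ := hz
      exact ⟨2, by simpa using word_mem_wordSpan (R := R) (x := x) (l := [i]) (m := 2) (by simp)⟩
    | algebraMap r =>
      refine ⟨1, ?_⟩
      rw [Algebra.algebraMap_eq_smul_one]
      exact Submodule.smul_mem _ _
        (by simpa using word_mem_wordSpan (R := R) (x := x) (l := []) (m := 1) (by simp))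
    | add a c _ _ h h' =>
      obtain ⟨m, h⟩ := h
      obtain ⟨m', h'⟩ := h'
      exact ⟨max m m', add_mem (wordSpan_mono (le_max_left _ _) h)
        (wordSpan_mono (le_max_right _ _) h')⟩
    | mul a c _ _ h h' =>
      obtain ⟨m, h⟩ := h
      obtain ⟨m', h'⟩ := h'
      exact ⟨m + m', mul_mem_wordSpan (wordSpan_mono (Nat.le_succ m) h) h'⟩
  have hJ : J = Submodule.span S (Set.range y) := by
    refine le_antisymm (fun z hz => ?_) (Submodule.span_le.2 ?_)
    · obtain ⟨m, hm⟩ := hmem z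
      exact key m z hz hm
    · rintro _ ⟨k, rfl⟩
      exact hyJ k
  rw [hJ]
  exact Submodule.fg_span (Set.finite_range y)

end AlmostCommutative

noncomputable section

namespace AffinoidEnveloping

/-! ### The filtration of the completion, and closed left ideals -/

section CompletionFiltration

variable {A : Type*} [CommRing A] {K : Type*} [Field K] [Algebra A K]
variable (R : ValuationSubring K) (g : Type*) [LieRing g] [LieAlgebra A g]
variable [IsDiscreteValuationRing R] [CharZero K] (p : ℕ) [NeZero p] (n : ℕ) {π : R}
  (hπ : Irreducible π)

/-- The closure of `Γ_i U(g_K)` in the completed enveloping algebra. -/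
def gammaHat (i : ℤ) : AddSubgroup (CompletedUK (A := A) R g p n hπ) :=
  ((gamma (A := A) R g p n π i).map
    (toCompletedUK (A := A) R g p n hπ).toAddMonoidHom).topologicalClosure

variable {R g p n}

lemma hasBasis_gammaHat :
    (nhds (0 : CompletedUK (A := A) R g p n hπ)).HasBasis (fun _ : ℤ => True)
      fun i => (gammaHat (A := A) R g p n hπ i : Set (CompletedUK (A := A) R g p n hπ)) := by
  have h1 := (ringSubgroupsBasis_gamma (A := A) (R := R) (g := g) p n hπ).hasBasis_nhds_zero
  have h2 := Filter.HasBasis.hasBasis_of_isDenseInducing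
    (α := FilteredUK (A := A) R g p n hπ) h1
    (UniformSpace.Completion.isDenseInducing_coe (α := FilteredUK (A := A) R g p n hπ))
  exact h2

lemma gammaHat_mem_nhds (i : ℤ) :
    (gammaHat (A := A) R g p n hπ i : Set (CompletedUK (A := A) R g p n hπ)) ∈
      nhds (0 : CompletedUK (A := A) R g p n hπ) :=
  (hasBasis_gammaHat hπ).mem_of_mem trivial

lemma gammaHat_anti {i j : ℤ} (hij : i ≤ j) :
    gammaHat (A := A) R g p n hπ j ≤ gammaHat R g p n hπ i :=
  AddSubgroup.topologicalClosure_mono (AddSubgroup.map_mono (gamma_anti hπ hij))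

lemma coe_mem_gammaHat {i : ℤ} {u : UK A K g} (hu : u ∈ gamma R g p n π i) :
    toCompletedUK R g p n hπ u ∈ gammaHat R g p n hπ i :=
  AddSubgroup.le_topologicalClosure _ ⟨u, hu, rfl⟩

/-- `Γ_i` is an open subgroup, hence closed, so its closure in the completion contains no further
element of `U(g_K)`. -/
lemma mem_gamma_of_coe_mem {i : ℤ} {u : UK A K g}
    (hu : toCompletedUK R g p n hπ u ∈ gammaHat R g p n hπ i) : u ∈ gamma R g p n π i := by
  let S : AddSubgroup (FilteredUK (A := A) R g p n hπ) := gamma (A := A) R g p n π i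
  have hopen : IsOpen (S : Set (FilteredUK (A := A) R g p n hπ)) := by
    refine AddSubgroup.isOpen_of_mem_nhds S (g := 0) ?_
    exact (ringSubgroupsBasis_gamma (A := A) (R := R) (g := g) p n hπ).hasBasis_nhds_zero.mem_of_mem
      trivial
  have hclosed : IsClosed (S : Set (FilteredUK (A := A) R g p n hπ)) :=
    AddSubgroup.isClosed_of_isOpen S hopen
  have h := (UniformSpace.Completion.isDenseInducing_coe
    (α := FilteredUK (A := A) R g p n hπ)).isInducing.closure_eq_preimage_closure_image
      (S : Set (FilteredUK (A := A) R g p n hπ))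
  rw [hclosed.closure_eq] at h
  have : (u : FilteredUK (A := A) R g p n hπ) ∈ (S : Set (FilteredUK (A := A) R g p n hπ)) := by
    rw [h]; exact hu
  exact this

lemma exists_sub_coe_mem_gammaHat (x : CompletedUK (A := A) R g p n hπ) (i : ℤ) :
    ∃ u : UK A K g, x - toCompletedUK R g p n hπ u ∈ gammaHat R g p n hπ i := by
  have hd := (UniformSpace.Completion.isDenseInducing_coe
    (α := FilteredUK (A := A) R g p n hπ)).dense x
  have hn : {y | x - y ∈ gammaHat (A := A) R g p n hπ i} ∈ nhds x := by
    have hc : ContinuousAt (fun y => x - y) x := by fun_prop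
    refine hc ?_
    change _ ∈ nhds (x - x)
    rw [sub_self]
    exact gammaHat_mem_nhds hπ i
  obtain ⟨_, hy, u, rfl⟩ := mem_closure_iff_nhds.1 hd _ hn
  exact ⟨u, hy⟩

lemma mul_mem_gammaHat {i j : ℤ} {x y : CompletedUK (A := A) R g p n hπ}
    (hx : x ∈ gammaHat R g p n hπ i) (hy : y ∈ gammaHat R g p n hπ j) :
    x * y ∈ gammaHat R g p n hπ (i + j) := by
  refine map_mem_closure₂ (f := fun x y : CompletedUK (A := A) R g p n hπ => x * y)
    (by fun_prop) hx hy ?_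
  rintro _ ⟨a, ha, rfl⟩ _ ⟨c, hc, rfl⟩
  exact ⟨a * c, mul_mem_gamma hπ ha hc, map_mul (toCompletedUK R g p n hπ) a c⟩

lemma eq_zero_of_forall_mem_gammaHat {x : CompletedUK (A := A) R g p n hπ}
    (hx : ∀ i : ℕ, x ∈ gammaHat R g p n hπ i) : x = 0 := by
  by_contra h
  have h1 : {x}ᶜ ∈ nhds (0 : CompletedUK (A := A) R g p n hπ) :=
    isOpen_compl_singleton.mem_nhds fun h' => h h'.symm
  obtain ⟨i, -, hi⟩ := (hasBasis_gammaHat hπ).mem_iff.1 h1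
  exact hi (gammaHat_anti hπ (Int.self_le_toNat i) (hx i.toNat)) rfl

lemma exists_limit (s : ℕ → UK A K g) (hs : ∀ N : ℕ, s (N + 1) - s N ∈ gamma R g p n π N) :
    ∃ x : CompletedUK (A := A) R g p n hπ,
      ∀ N : ℕ, x - toCompletedUK R g p n hπ (s N) ∈ gammaHat R g p n hπ N := by
  have hle : ∀ N d : ℕ, s (N + d) - s N ∈ gamma R g p n π N := by
    intro N d
    induction d with
    | zero => simp
    | succ d ih =>
      rw [← sub_add_sub_cancel (s (N + (d + 1))) (s (N + d)) (s N)]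
      exact add_mem (gamma_anti hπ (by push_cast; omega) (hs (N + d))) ih
  have hle' : ∀ N m : ℕ, N ≤ m → toCompletedUK R g p n hπ (s m) - toCompletedUK R g p n hπ (s N) ∈
      gammaHat R g p n hπ N := by
    intro N m hm
    obtain ⟨d, rfl⟩ := Nat.exists_eq_add_of_le hm
    rw [← map_sub]
    exact coe_mem_gammaHat hπ (hle N d)
  have hc : CauchySeq fun N => toCompletedUK R g p n hπ (s N) := by
    refine cauchySeq_iff_tendsto.2 ?_
    rw [uniformity_eq_comap_nhds_zero, Filter.tendsto_comap_iff]
    refine (hasBasis_gammaHat hπ).tendsto_right_iff.2 fun i _ => ?_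
    filter_upwards [Filter.eventually_ge_atTop ((i.toNat, i.toNat) : ℕ × ℕ)] with q hq
    have h1 := gammaHat_anti hπ (Int.self_le_toNat i) (hle' i.toNat q.1 hq.1)
    have h2 := gammaHat_anti hπ (Int.self_le_toNat i) (hle' i.toNat q.2 hq.2)
    have := sub_mem h2 h1
    simpa using this
  obtain ⟨x, hx⟩ := cauchySeq_tendsto_of_complete hc
  refine ⟨x, fun N => ?_⟩
  have hcl : IsClosed (gammaHat (A := A) R g p n hπ N : Set (CompletedUK (A := A) R g p n hπ)) :=
    AddSubgroup.isClosed_topologicalClosure _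
  exact hcl.mem_of_tendsto (hx.sub_const _)
    ((Filter.eventually_ge_atTop N).mono fun m hm => hle' N m hm)

lemma exists_mem_gamma_neg (hπ : Irreducible π) (x : UK A K g) : ∃ m : ℕ, x ∈ gamma R g p n π (-(m : ℤ)) := by
  obtain ⟨m, hm⟩ := exists_mem_gamma (p := p) (n := n) hπ x
  refine ⟨m, mem_gamma.2 ⟨_, hm, ?_⟩⟩
  rw [← mul_assoc, ← map_mul, zpow_neg, zpow_natCast,
    inv_mul_cancel₀ (pow_ne_zero _ (coe_ne_zero hπ)), map_one, one_mul]

lemma exists_mem_gammaHat_neg (x : CompletedUK (A := A) R g p n hπ) :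
    ∃ m : ℕ, x ∈ gammaHat R g p n hπ (-(m : ℤ)) := by
  obtain ⟨u, hu⟩ := exists_sub_coe_mem_gammaHat hπ x 0
  obtain ⟨m, hm⟩ := exists_mem_gamma_neg (p := p) (n := n) hπ u
  refine ⟨m, ?_⟩
  rw [← sub_add_cancel x (toCompletedUK R g p n hπ u)]
  exact add_mem (gammaHat_anti hπ (by omega) hu) (coe_mem_gammaHat hπ hm)

/-- The closure of a left ideal of `U(g_K)` in the completion. -/
def MemClosure (J : Submodule (UK A K g) (UK A K g)) (x : CompletedUK (A := A) R g p n hπ) : Prop :=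
  ∀ i : ℕ, ∃ q ∈ J, x - toCompletedUK R g p n hπ q ∈ gammaHat R g p n hπ i

lemma MemClosure.exists {J : Submodule (UK A K g) (UK A K g)}
    {x : CompletedUK (A := A) R g p n hπ} (h : MemClosure hπ J x) (i : ℤ) :
    ∃ q ∈ J, x - toCompletedUK R g p n hπ q ∈ gammaHat R g p n hπ i := by
  obtain ⟨q, hq, h⟩ := h i.toNat
  exact ⟨q, hq, gammaHat_anti hπ (Int.self_le_toNat i) h⟩

lemma memClosure_of_mem_span {J : Submodule (UK A K g) (UK A K g)}
    {x : CompletedUK (A := A) R g p n hπ}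
    (hx : x ∈ Submodule.span (CompletedUK (A := A) R g p n hπ) (toCompletedUK R g p n hπ '' J)) :
    MemClosure hπ J x := by
  induction hx using Submodule.span_induction with
  | mem x hx =>
    obtain ⟨q, hq, rfl⟩ := hx
    exact fun i => ⟨q, hq, by simp⟩
  | zero => exact fun i => ⟨0, zero_mem _, by simp⟩
  | add x y _ _ hx hy =>
    intro i
    obtain ⟨q, hq, h⟩ := hx i
    obtain ⟨q', hq', h'⟩ := hy i
    exact ⟨q + q', add_mem hq hq', by rw [map_add, add_sub_add_comm]; exact add_mem h h'⟩
  | smul t x _ hx =>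
    intro i
    -- In `t x - u q = t (x - q) + (t - u) q`, the precision of `q` is dictated by the size of `t`,
    -- and then that of `u` by the size of `q`.
    obtain ⟨m, hm⟩ := exists_mem_gammaHat_neg hπ t
    obtain ⟨q, hq, h⟩ := hx.exists hπ (i + m)
    obtain ⟨l, hl⟩ := exists_mem_gamma_neg (p := p) (n := n) hπ q
    obtain ⟨u, hu⟩ := exists_sub_coe_mem_gammaHat hπ t (i + l)
    refine ⟨u * q, J.smul_mem u hq, ?_⟩
    have h1 := mul_mem_gammaHat hπ hm h
    have h2 := mul_mem_gammaHat hπ hu (coe_mem_gammaHat hπ hl)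
    rw [show -(m : ℤ) + (i + m) = i by ring] at h1
    rw [show (i : ℤ) + l + -l = i by ring] at h2
    have := add_mem h1 h2
    rw [mul_sub, sub_mul, ← map_mul, sub_add_sub_cancel] at this
    exact this

/-- `J ∩ Γ₀` is finitely generated over `Γ₀`. Consecutive approximations from `J` differ by an
element of `π^N (J ∩ Γ₀)`, so the differences have coefficients in `Γ_N` on fixed generators, and
the sums of these coefficients converge. -/
lemma mem_span_of_memClosure [IsNoetherianRing (gammaZero (A := A) R g p n)]
    {J : Submodule (UK A K g) (UK A K g)} {x : CompletedUK (A := A) R g p n hπ}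
    (hx : MemClosure hπ J x) :
    x ∈ Submodule.span (CompletedUK (A := A) R g p n hπ) (toCompletedUK R g p n hπ '' J) := by
  classical
  let J₀ : Submodule (gammaZero (A := A) R g p n) (gammaZero (A := A) R g p n) :=
    { carrier := {y | (y : UK A K g) ∈ J}
      add_mem' := fun ha hb => J.add_mem ha hb
      zero_mem' := J.zero_mem
      smul_mem' := fun c y hy => J.smul_mem (c : UK A K g) hy }
  obtain ⟨T, hT⟩ := IsNoetherian.noetherian J₀
  have hTJ : ∀ k : T, ((k : gammaZero (A := A) R g p n) : UK A K g) ∈ J := fun k => by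
    have : (k : gammaZero (A := A) R g p n) ∈ J₀ := hT ▸ Submodule.subset_span k.2
    exact this
  choose q hqJ hq using hx
  have hstep : ∀ N : ℕ, ∃ a : T → UK A K g, (∀ k, a k ∈ gamma R g p n π N) ∧
      q (N + 1) - q N = ∑ k : T, a k * ((k : gammaZero (A := A) R g p n) : UK A K g) := by
    intro N
    have h1 : q (N + 1) - q N ∈ gamma R g p n π N := by
      refine mem_gamma_of_coe_mem hπ ?_
      have := sub_mem (hq N) (gammaHat_anti hπ (by push_cast; omega) (hq (N + 1)))
      rwa [sub_sub_sub_cancel_left, ← map_sub] at this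
    obtain ⟨y, hy, hyq⟩ := mem_gamma.1 h1
    have hyJ : (⟨y, hy⟩ : gammaZero (A := A) R g p n) ∈ J₀ := by
      change y ∈ J
      have : y = algebraMap K (UK A K g) ((π : K) ^ (N : ℤ))⁻¹ * (q (N + 1) - q N) := by
        rw [← hyq, ← mul_assoc, ← map_mul,
          inv_mul_cancel₀ (zpow_ne_zero _ (coe_ne_zero hπ)), map_one, one_mul]
      rw [this]
      exact J.smul_mem _ (sub_mem (hqJ _) (hqJ _))
    rw [← hT, Submodule.mem_span_finset'] at hyJ
    obtain ⟨c, hc⟩ := hyJ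
    refine ⟨fun k => algebraMap K (UK A K g) ((π : K) ^ (N : ℤ)) * (c k : UK A K g),
      fun k => mem_gamma.2 ⟨_, (c k).2, rfl⟩, ?_⟩
    rw [← hyq]
    have h2 := congrArg (fun z : gammaZero (A := A) R g p n => (z : UK A K g)) hc
    simp only [smul_eq_mul, AddSubmonoidClass.coe_finsetSum, MulMemClass.coe_mul] at h2
    rw [← h2, Finset.mul_sum]
    exact Finset.sum_congr rfl fun k _ => (mul_assoc _ _ _).symm
  choose a ha hsum using hstep
  have hlim : ∀ k : T, ∃ x : CompletedUK (A := A) R g p n hπ, ∀ N : ℕ,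
      x - toCompletedUK R g p n hπ (∑ l ∈ Finset.range N, a l k) ∈ gammaHat R g p n hπ N := by
    intro k
    refine exists_limit hπ (fun N => ∑ l ∈ Finset.range N, a l k) fun N => ?_
    simpa [Finset.sum_range_succ] using ha N k
  choose y hy using hlim
  have hqN : ∀ N : ℕ, q N = q 0 + ∑ k : T, (∑ l ∈ Finset.range N, a l k) *
      ((k : gammaZero (A := A) R g p n) : UK A K g) := by
    intro N
    induction N with
    | zero => simp
    | succ N ih =>
      rw [← sub_add_cancel (q (N + 1)) (q N), hsum, ih]
      simp only [Finset.sum_range_succ, add_mul, Finset.sum_add_distrib]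
      abel
  have hfin : x = toCompletedUK R g p n hπ (q 0) + ∑ k : T, y k *
      toCompletedUK R g p n hπ ((k : gammaZero (A := A) R g p n) : UK A K g) := by
    rw [← sub_eq_zero]
    refine eq_zero_of_forall_mem_gammaHat hπ fun N => ?_
    have h1 : ∑ k : T, (y k - toCompletedUK R g p n hπ (∑ l ∈ Finset.range N, a l k)) *
        toCompletedUK R g p n hπ ((k : gammaZero (A := A) R g p n) : UK A K g) ∈
          gammaHat R g p n hπ N := by
      refine sum_mem fun k _ => ?_
      have h2 : toCompletedUK R g p n hπ ((k : gammaZero (A := A) R g p n) : UK A K g) ∈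
          gammaHat R g p n hπ 0 :=
        coe_mem_gammaHat hπ (mem_gamma.2 ⟨_, (k : gammaZero (A := A) R g p n).2, by simp⟩)
      simpa using mul_mem_gammaHat hπ (hy k N) h2
    have h3 := sub_mem (hq N) h1
    convert h3 using 1
    rw [hqN N]
    simp only [map_add, map_sum, map_mul, sub_mul, Finset.sum_sub_distrib]
    abel
  rw [hfin]
  refine add_mem (Submodule.subset_span ⟨_, hqJ 0, rfl⟩) (Submodule.sum_mem _ fun k _ => ?_)
  exact Submodule.smul_mem _ (y k) (Submodule.subset_span ⟨_, hTJ k, rfl⟩)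

end CompletionFiltration

/-! ### Annihilators of modules induced from cyclic modules -/

section Extension

variable {S T : Type*} [Ring S] [Ring T] (φ : S →+* T) {M : Type*} [AddCommGroup M] [Module S M]

/-- For `M = S v`, isomorphic to `S / J`, the induced module is the quotient of `T` by the left
ideal generated by `φ(J)`. -/
lemma mem_annihilator_extensionOfScalars_iff (v : M) (hv : ∀ m : M, ∃ s : S, s • v = m)
    (J : Submodule S S) (hJ : ∀ s : S, s ∈ J ↔ s • v = 0) (x : T) :
    x ∈ Module.annihilator T (ExtensionOfScalars φ M) ↔
      ∀ t : T, x * t ∈ Submodule.span T (φ '' J) := by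
  have hrel : ∀ (t : T) (s : S) (m : M), (extensionRelations φ M).mkQ ((t * φ s) ⊗ₜ[ℤ] m) =
      (extensionRelations φ M).mkQ (t ⊗ₜ[ℤ] (s • m)) := by
    intro t s m
    rw [← sub_eq_zero, ← map_sub, Submodule.mkQ_apply, Submodule.Quotient.mk_eq_zero]
    exact Submodule.subset_span ⟨t, s, m, rfl⟩
  constructor
  · intro hx t
    choose σ hσ using hv
    let N := Submodule.span T (φ '' (J : Set S))
    have hcong : ∀ s s' : S, s • v = s' • v → N.mkQ (φ s) = N.mkQ (φ s') := by
      intro s s' h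
      rw [← sub_eq_zero, ← map_sub, ← map_sub, Submodule.mkQ_apply, Submodule.Quotient.mk_eq_zero]
      exact Submodule.subset_span ⟨s - s', (hJ _).2 (by rw [sub_smul, h, sub_self]), rfl⟩
    -- `σ m` is an arbitrary element with `σ m • v = m`; modulo `N` the choice is irrelevant by
    -- `hcong`, whence additivity.
    let θ : M →+ T ⧸ N :=
      { toFun := fun m => N.mkQ (φ (σ m))
        map_zero' := by
          rw [hcong _ 0 (by rw [hσ, zero_smul]), map_zero, map_zero]
        map_add' := fun m m' => by
          rw [hcong _ (σ m + σ m') (by rw [hσ, add_smul, hσ, hσ]), map_add, map_add] }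
    let Θ : T ⊗[ℤ] M →ₗ[T] T ⧸ N :=
      TensorProduct.AlgebraTensorModule.lift
        (LinearMap.toSpanSingleton T (M →ₗ[ℤ] T ⧸ N) θ.toIntLinearMap)
    have hΘ : ∀ (t : T) (m : M), Θ (t ⊗ₜ m) = t • N.mkQ (φ (σ m)) := fun t m => rfl
    have hle : extensionRelations φ M ≤ LinearMap.ker Θ := by
      refine Submodule.span_le.2 ?_
      rintro _ ⟨t, s, m, rfl⟩
      rw [SetLike.mem_coe, LinearMap.mem_ker, map_sub, hΘ, hΘ,
        hcong (σ (s • m)) (s * σ m) (by rw [hσ, mul_smul, hσ]), map_mul, mul_smul, sub_eq_zero,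
        ← smul_eq_mul (φ s) (φ (σ m)), map_smul]
    have h1 := Module.mem_annihilator.1 hx ((extensionRelations φ M).mkQ (t ⊗ₜ v))
    rw [← map_smul, Submodule.mkQ_apply, Submodule.Quotient.mk_eq_zero] at h1
    have h2 := hle h1
    rw [LinearMap.mem_ker, TensorProduct.smul_tmul', hΘ, hcong (σ v) 1 (by rw [hσ, one_smul]),
      ← map_smul, map_one, Submodule.mkQ_apply, Submodule.Quotient.mk_eq_zero] at h2
    simpa using h2
  · intro hx
    refine Module.mem_annihilator.2 fun z => ?_
    obtain ⟨z, rfl⟩ := (extensionRelations φ M).mkQ_surjective z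
    have hN : ∀ y ∈ Submodule.span T (φ '' (J : Set S)),
        (extensionRelations φ M).mkQ (y ⊗ₜ[ℤ] v) = 0 := by
      intro y hy
      induction hy using Submodule.span_induction with
      | zero => rw [TensorProduct.zero_tmul, map_zero]
      | add a c _ _ h h' => rw [TensorProduct.add_tmul, map_add, h, h', add_zero]
      | smul t a _ h => rw [← TensorProduct.smul_tmul', map_smul, h, smul_zero]
      | mem a h =>
        obtain ⟨s, hs, rfl⟩ := h
        rw [← one_mul (φ s), hrel, (hJ s).1 hs, TensorProduct.tmul_zero, map_zero]
    rw [← map_smul]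
    induction z using TensorProduct.induction_on with
    | zero => rw [smul_zero, map_zero]
    | add a c h h' => rw [smul_add, map_add, h, h', add_zero]
    | tmul t m =>
      obtain ⟨s, rfl⟩ := hv m
      rw [TensorProduct.smul_tmul', ← hrel, smul_eq_mul, mul_assoc]
      exact hN _ (hx _)

end Extension

/-! ### Lattices of polynomials and p-adic interpolation -/

section Lattice

variable {K : Type*} [Field K] {R : ValuationSubring K}

/-- The fractional ideal `π ^ i R`. -/
def powLattice (R : ValuationSubring K) (π : R) (i : ℤ) : AddSubgroup K where
  carrier := {c | ∃ r ∈ R, (π : K) ^ i * r = c}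
  zero_mem' := ⟨0, R.zero_mem, mul_zero _⟩
  add_mem' := by
    rintro _ _ ⟨r, hr, rfl⟩ ⟨s, hs, rfl⟩
    exact ⟨r + s, R.add_mem _ _ hr hs, mul_add _ _ _⟩
  neg_mem' := by
    rintro _ ⟨r, hr, rfl⟩
    exact ⟨-r, R.neg_mem _ hr, mul_neg _ _⟩

lemma mem_powLattice {π : R} {i : ℤ} {c : K} :
    c ∈ powLattice R π i ↔ ∃ r ∈ R, (π : K) ^ i * r = c := Iff.rfl

lemma mem_powLattice_zero {π : R} {c : K} : c ∈ powLattice R π 0 ↔ c ∈ R := by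
  simp [mem_powLattice]

variable {π : R} (hπ : Irreducible π)
include hπ

lemma mul_mem_powLattice {i j : ℤ} {c d : K} (hc : c ∈ powLattice R π i)
    (hd : d ∈ powLattice R π j) : c * d ∈ powLattice R π (i + j) := by
  obtain ⟨r, hr, rfl⟩ := hc
  obtain ⟨s, hs, rfl⟩ := hd
  exact ⟨r * s, R.mul_mem _ _ hr hs, by rw [zpow_add₀ (coe_ne_zero hπ)]; ring⟩

lemma mul_mem_powLattice_of_mem {i : ℤ} {c d : K} (hc : c ∈ R)
    (hd : d ∈ powLattice R π i) : c * d ∈ powLattice R π i := by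
  simpa using mul_mem_powLattice hπ (mem_powLattice_zero.2 hc) hd

lemma powLattice_anti {i j : ℤ} (hij : i ≤ j) : powLattice R π j ≤ powLattice R π i := by
  rintro _ ⟨r, hr, rfl⟩
  obtain ⟨k, rfl⟩ := Int.le.dest hij
  refine ⟨(π : K) ^ k * r, R.mul_mem _ _ (pow_mem π.2 k) hr, ?_⟩
  rw [zpow_add₀ (coe_ne_zero hπ), zpow_natCast, mul_assoc]

lemma exists_mem_powLattice_neg [IsDiscreteValuationRing R] (c : K) :
    ∃ m : ℕ, c ∈ powLattice R π (-(m : ℤ)) := by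
  obtain ⟨m, hm⟩ := exists_pow_mul_mem hπ c
  refine ⟨m, _, hm, ?_⟩
  rw [zpow_neg, zpow_natCast, inv_mul_cancel_left₀ (pow_ne_zero _ (coe_ne_zero hπ))]

lemma exists_forall_mem_powLattice_neg [IsDiscreteValuationRing R] {I : Type*} (s : Finset I)
    (c : I → K) : ∃ m : ℕ, ∀ k ∈ s, c k ∈ powLattice R π (-(m : ℤ)) := by
  choose m hm using fun k => exists_mem_powLattice_neg hπ (c k)
  refine ⟨s.sup m, fun k hk => powLattice_anti hπ ?_ (hm k)⟩
  have := Finset.le_sup (f := m) hk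
  omega

omit hπ in
/-- The polynomials with coefficients in `π ^ i R`. -/
def polyLattice (R : ValuationSubring K) (π : R) (i : ℤ) : AddSubgroup (Polynomial K) where
  carrier := {P | ∀ k, P.coeff k ∈ powLattice R π i}
  zero_mem' := fun k => by simp [zero_mem]
  add_mem' := fun h h' k => by rw [Polynomial.coeff_add]; exact add_mem (h k) (h' k)
  neg_mem' := fun h k => by rw [Polynomial.coeff_neg]; exact neg_mem (h k)

lemma eval_mem_powLattice {i : ℤ} {P : Polynomial K} (hP : P ∈ polyLattice R π i) {x : K}
    (hx : x ∈ R) : P.eval x ∈ powLattice R π i := by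
  rw [Polynomial.eval_eq_sum]
  refine sum_mem fun k _ => ?_
  change P.coeff k * x ^ k ∈ _
  rw [mul_comm]
  exact mul_mem_powLattice_of_mem hπ (pow_mem hx k) (hP k)

lemma C_mul_mem_polyLattice {i j : ℤ} {c : K} (hc : c ∈ powLattice R π i) {P : Polynomial K}
    (hP : P ∈ polyLattice R π j) : Polynomial.C c * P ∈ polyLattice R π (i + j) := fun k => by
  rw [Polynomial.coeff_C_mul]
  exact mul_mem_powLattice hπ hc (hP k)

omit hπ in
lemma map_mem_polyLattice_zero (P : Polynomial R) :
    P.map (algebraMap R K) ∈ polyLattice R π 0 := fun k => by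
  rw [Polynomial.coeff_map, mem_powLattice_zero]
  exact (P.coeff k).2

lemma exists_mem_polyLattice_neg [IsDiscreteValuationRing R] (P : Polynomial K) :
    ∃ m : ℕ, P ∈ polyLattice R π (-(m : ℤ)) := by
  obtain ⟨m, hm⟩ := exists_forall_mem_powLattice_neg hπ P.support P.coeff
  refine ⟨m, fun k => ?_⟩
  by_cases hk : k ∈ P.support
  · exact hm k hk
  · rw [Polynomial.notMem_support_iff.1 hk]
    exact zero_mem _

lemma eval_sub_eval_mem {i j : ℤ} {P : Polynomial K} (hP : P ∈ polyLattice R π i) {x y : K}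
    (hx : x ∈ R) (hy : y ∈ R) (hxy : x - y ∈ powLattice R π j) :
    P.eval x - P.eval y ∈ powLattice R π (i + j) := by
  rw [Polynomial.eval_eq_sum, Polynomial.eval_eq_sum, Polynomial.sum, Polynomial.sum,
    ← Finset.sum_sub_distrib]
  refine sum_mem fun k _ => ?_
  obtain ⟨c, hc⟩ := sub_dvd_pow_sub_pow (⟨x, hx⟩ : R) ⟨y, hy⟩ k
  have h1 : x ^ k - y ^ k = (x - y) * c := congrArg (Subtype.val) hc
  rw [← mul_sub, h1, mul_comm (x - y)]
  exact mul_mem_powLattice hπ (hP k) (mul_mem_powLattice_of_mem hπ c.2 hxy)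

lemma pow_mem_powLattice {q : K} (hq : q ∈ powLattice R π 1) (N : ℕ) :
    q ^ N ∈ powLattice R π N := by
  induction N with
  | zero => simpa using mem_powLattice_zero.2 (one_mem R)
  | succ N ih => rw [pow_succ]; exact_mod_cast mul_mem_powLattice hπ ih hq

/-- `m` is p-adically close to `m + p^N M`, which is at least `M`, and a polynomial takes close
values at close points. This matters because the threshold `M` will depend on `P`, while the
sampling points must be fixed beforehand. -/
lemma eval_mem_of_eventually [IsDiscreteValuationRing R] {p : ℕ} [NeZero p]
    (hp : (p : K) ∈ powLattice R π 1) {s : K} (hs : s ∈ R) {i : ℤ} {P : Polynomial K} {M : ℕ}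
    (hP : ∀ m : ℕ, M ≤ m → P.eval (s * m) ∈ powLattice R π i)
    (m : ℕ) : P.eval (s * m) ∈ powLattice R π i := by
  obtain ⟨c, hc⟩ := exists_mem_polyLattice_neg hπ P
  -- The exponent `i + c` compensates for the denominator `π ^ c` of the coefficients of `P`.
  have h1 : s * ((m + p ^ (i + c).toNat * M : ℕ) : K) - s * (m : K) ∈
      powLattice R π (i + c).toNat := by
    have h2 := mul_mem_powLattice_of_mem hπ (mul_mem hs (natCast_mem R M))
      (pow_mem_powLattice hπ hp (i + c).toNat)
    convert h2 using 1
    push_cast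
    ring
  have h3 := eval_sub_eval_mem hπ hc (mul_mem hs (natCast_mem R _)) (mul_mem hs (natCast_mem R _)) h1
  have h4 := hP (m + p ^ (i + c).toNat * M) (by
    have : 1 ≤ p ^ (i + c).toNat := Nat.one_le_pow _ _ (NeZero.pos p)
    nlinarith)
  have h5 := sub_mem h4 (powLattice_anti hπ (by omega) h3)
  rwa [sub_sub_cancel] at h5

lemma divByMonic_mem_polyLattice {i : ℤ} {P : Polynomial K} (hP : P ∈ polyLattice R π i) {a : K}
    (ha : a ∈ R) : P /ₘ (Polynomial.X - Polynomial.C a) ∈ polyLattice R π i := fun k => by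
  rw [Polynomial.coeff_divByMonic_X_sub_C]
  exact sum_mem fun l _ => mul_mem_powLattice_of_mem hπ (pow_mem ha _) (hP l)

/-- A polynomial has coefficients in `π ^ i R` if it is congruent to polynomials with arbitrarily
small values at the points of a sequence. -/
lemma mem_polyLattice_of_small_values [IsDiscreteValuationRing R] (i : ℤ) (d : ℕ) :
    ∀ (a : ℕ → K) (_ : Function.Injective a) (_ : ∀ m, a m ∈ R) (P : Polynomial K)
      (_ : P.natDegree < d)
      (_ : ∀ (M : ℕ) (i' : ℤ), ∃ P' : Polynomial K, P - P' ∈ polyLattice R π i ∧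
        ∀ m < M, P'.eval (a m) ∈ powLattice R π i'), P ∈ polyLattice R π i := by
  induction d with
  | zero => intro _ _ _ P hd; omega
  | succ d ih =>
    intro a hinj ha P hd h
    -- The degrees of the approximations `P'` are not bounded, so the induction is on the degree of
    -- `P` alone: write `P = P(a 0) + (X - a 0) Q` and pass to `Q` and the shifted sequence.
    have h0 : P.eval (a 0) ∈ powLattice R π i := by
      obtain ⟨P', h1, h2⟩ := h 1 i
      have := add_mem (eval_mem_powLattice hπ h1 (ha 0)) (h2 0 Nat.one_pos)
      simpa using this
    have hdec : ∀ P : Polynomial K, Polynomial.C (P.eval (a 0)) +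
        (Polynomial.X - Polynomial.C (a 0)) * (P /ₘ (Polynomial.X - Polynomial.C (a 0))) = P := by
      intro P
      rw [← Polynomial.modByMonic_X_sub_C_eq_C_eval]
      exact Polynomial.modByMonic_add_div P (Polynomial.X - Polynomial.C (a 0))
    have hQ : P /ₘ (Polynomial.X - Polynomial.C (a 0)) ∈ polyLattice R π i := by
      by_cases hd0 : P.natDegree = 0
      · rw [Polynomial.divByMonic_eq_zero_iff (Polynomial.monic_X_sub_C _) |>.2]
        · exact zero_mem _
        · rw [Polynomial.degree_X_sub_C]
          exact (Polynomial.natDegree_le_iff_degree_le.1 hd0.le).trans_lt (by norm_num)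
      refine ih (fun m => a (m + 1)) (fun m m' hm => by simpa using hinj hm) (fun m => ha _) _ ?_ ?_
      · rw [Polynomial.natDegree_divByMonic _ (Polynomial.monic_X_sub_C _),
          Polynomial.natDegree_X_sub_C]
        omega
      · intro M i'
        -- Values of the quotient are difference quotients. The denominators `a (m + 1) - a 0` cost
        -- at most `π ^ c` with `c` depending only on `M`, so values of `P'` in `π ^ (i' + c) R`
        -- suffice.
        obtain ⟨c, hc⟩ := exists_forall_mem_powLattice_neg hπ (Finset.range M)
          (fun m => (a (m + 1) - a 0)⁻¹)
        obtain ⟨P', h1, h2⟩ := h (M + 1) (i' + c)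
        refine ⟨P' /ₘ (Polynomial.X - Polynomial.C (a 0)), ?_, fun m hm => ?_⟩
        · have h3 : P /ₘ (Polynomial.X - Polynomial.C (a 0)) -
              P' /ₘ (Polynomial.X - Polynomial.C (a 0)) =
                (P - P') /ₘ (Polynomial.X - Polynomial.C (a 0)) := by
            refine mul_left_cancel₀ (Polynomial.X_sub_C_ne_zero (a 0)) ?_
            have h4 := hdec (P - P')
            rw [Polynomial.eval_sub, map_sub] at h4
            linear_combination hdec P - hdec P' - h4
          rw [h3]
          exact divByMonic_mem_polyLattice hπ h1 (ha 0)
        · have h3 := congrArg (Polynomial.eval (a (m + 1))) (hdec P')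
          simp only [Polynomial.eval_add, Polynomial.eval_C, Polynomial.eval_mul,
            Polynomial.eval_sub, Polynomial.eval_X] at h3
          have hne : a (m + 1) - a 0 ≠ 0 := sub_ne_zero.2 fun h => by simpa using hinj h
          have h4 : (P' /ₘ (Polynomial.X - Polynomial.C (a 0))).eval (a (m + 1)) =
              (a (m + 1) - a 0)⁻¹ * (P'.eval (a (m + 1)) - P'.eval (a 0)) := by
            rw [← h3]; field_simp; ring
          rw [h4]
          have := mul_mem_powLattice hπ (hc m (Finset.mem_range.2 hm))
            (sub_mem (h2 (m + 1) (by omega)) (h2 0 (by omega)))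
          rwa [show -(c : ℤ) + (i' + c) = i' by ring] at this
    rw [← hdec P]
    refine add_mem (fun k => ?_) ?_
    · rw [Polynomial.coeff_C]
      split_ifs
      · exact h0
      · exact zero_mem _
    · intro k
      rw [sub_mul, Polynomial.coeff_sub, Polynomial.coeff_C_mul]
      refine sub_mem ?_ (mul_mem_powLattice_of_mem hπ (ha 0) (hQ k))
      cases k with
      | zero => simp [zero_mem]
      | succ k => rw [Polynomial.coeff_X_mul]; exact hQ k

end Lattice

/-! ### Coefficients of roots on the simple roots -/

section RootData

variable {ι k X Y : Type*} [Field k] [CharZero k] [AddCommGroup X] [Module k X]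
  [AddCommGroup Y] [Module k Y] {P : RootPairing ι k X Y} (b : P.Base)

/-- The coefficient of the simple root `j` in the root `i`. -/
def rootCoeff (i j : ι) : ℤ := (b.exists_root_eq_sum_int i).choose j

lemma root_eq_sum_rootCoeff (i : ι) :
    P.root i = ∑ j ∈ b.support, rootCoeff b i j • P.root j :=
  (b.exists_root_eq_sum_int i).choose_spec.2.2

lemma height_eq_sum_rootCoeff (i : ι) : b.height i = ∑ j ∈ b.support, rootCoeff b i j := rfl

lemma rootCoeff_nonneg {i : ι} (hi : b.IsPos i) (j : ι) : 0 ≤ rootCoeff b i j := by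
  rcases (b.exists_root_eq_sum_int i).choose_spec.2.1 with h | h
  · exact h.le j
  · exfalso
    have h1 : b.height i ≤ 0 := by
      rw [height_eq_sum_rootCoeff]
      exact Finset.sum_nonpos fun j _ => h.le j
    exact absurd hi (not_lt.2 h1)

lemma rootCoeff_nonpos {i : ι} (hi : ¬ b.IsPos i) (j : ι) : rootCoeff b i j ≤ 0 := by
  rcases (b.exists_root_eq_sum_int i).choose_spec.2.1 with h | h
  · exfalso
    have h1 : 0 ≤ b.height i := by
      rw [height_eq_sum_rootCoeff]
      exact Finset.sum_nonneg fun j _ => h.le j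
    exact hi ((b.isPos_iff').2 h1)
  · exact h.le j

/-- The sum of the coefficients of a root at all simple roots other than `α`. -/
def leviDegree (α i : ι) : ℤ := b.height i - rootCoeff b i α

lemma leviDegree_eq_sum [DecidableEq ι] {α : ι} (hα : α ∈ b.support) (i : ι) :
    leviDegree b α i = ∑ j ∈ b.support.erase α, rootCoeff b i j := by
  rw [leviDegree, height_eq_sum_rootCoeff, ← Finset.sum_erase_add _ _ hα, add_sub_cancel_right]

lemma leviDegree_nonneg {α : ι} (hα : α ∈ b.support) {i : ι} (hi : b.IsPos i) :
    0 ≤ leviDegree b α i := by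
  classical
  rw [leviDegree_eq_sum b hα]
  exact Finset.sum_nonneg fun j _ => rootCoeff_nonneg b hi j

lemma leviDegree_nonpos {α : ι} (hα : α ∈ b.support) {i : ι} (hi : ¬ b.IsPos i) :
    leviDegree b α i ≤ 0 := by
  classical
  rw [leviDegree_eq_sum b hα]
  exact Finset.sum_nonpos fun j _ => rootCoeff_nonpos b hi j

/-- The coefficients of a root all have the same sign, so if those away from `α` sum to zero they
all vanish and the root is a multiple of `α`. -/
lemma eq_or_eq_neg_of_leviDegree_eq_zero [Finite ι] {α : ι} (hα : α ∈ b.support) {i : ι}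
    (hi : leviDegree b α i = 0) : i = α ∨ i = P.reflectionPerm α α := by
  classical
  have htX : IsAddTorsionFree X := .of_isTorsionFree k X
  have htY : IsAddTorsionFree Y := .of_isTorsionFree k Y
  rw [leviDegree_eq_sum b hα] at hi
  have h0 : ∀ j ∈ b.support.erase α, rootCoeff b i j = 0 := by
    by_cases hp : b.IsPos i
    · exact (Finset.sum_eq_zero_iff_of_nonneg fun j _ => rootCoeff_nonneg b hp j).1 hi
    · exact (Finset.sum_eq_zero_iff_of_nonpos fun j _ => rootCoeff_nonpos b hp j).1 hi
  have h1 : P.root i = rootCoeff b i α • P.root α := by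
    rw [root_eq_sum_rootCoeff b i, ← Finset.sum_erase_add _ _ hα, Finset.sum_eq_zero, zero_add]
    intro j hj
    rw [h0 j hj, zero_smul]
  have h2 : ((rootCoeff b i α : ℤ) : k) • P.root α ∈ Set.range P.root :=
    ⟨i, by rw [h1, Int.cast_smul_eq_zsmul]⟩
  rcases b.eq_one_or_neg_one_of_mem_support_of_smul_mem α hα _ h2 with h3 | h3
  · left
    apply P.root.injective
    rw [h1, ← Int.cast_smul_eq_zsmul k, h3, one_smul]
  · right
    apply P.root.injective
    rw [h1, ← Int.cast_smul_eq_zsmul k, h3, P.root_reflectionPerm, P.reflection_apply_self, neg_smul, one_smul]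

end RootData

/-! ### Weights and commutation relations in U(g_K) -/

namespace ChevalleyBasis

variable {ι k X Y : Type*} [Field k] [CharZero k] [AddCommGroup X] [Module k X]
  [AddCommGroup Y] [Module k Y] {P : RootPairing ι k X Y} [P.IsCrystallographic]
  {b : P.Base} {A g : Type*} [CommRing A] [LieRing g] [LieAlgebra A g]
  (B : ChevalleyBasis b A g) (K : Type*) [Field K] [Algebra A K]

lemma lie_h_e' (α : b.support) (β : ι) : ⁅B.h α, B.e β⁆ = P.pairingIn ℤ β α • B.e β :=
  B.lie_h_e α β

lemma rootWeight_hCartan (β : ι) (δ : b.support) :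
    B.rootWeight K β (1 ⊗ₜ B.hCartan δ) = (P.pairingIn ℤ β δ : ℤ) := by
  have h : ((B.basis.constr A (Sum.elim (fun α : b.support => ((P.pairingIn ℤ β α : ℤ) : K))
      (fun _ => 0))).comp B.cartan.subtype) (B.hCartan δ) = (P.pairingIn ℤ β δ : ℤ) := by
    change (B.basis.constr A (Sum.elim (fun α : b.support => ((P.pairingIn ℤ β α : ℤ) : K))
      (fun _ => 0))) (B.basis (.inl δ)) = _
    rw [Module.Basis.constr_basis]
    rfl
  rw [rootWeight, LinearMap.liftBaseChange_tmul, one_smul, h]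

variable {K} in
lemma cartan_induction {p : K ⊗[A] B.cartan → Prop} (h0 : p 0) (hadd : ∀ x y, p x → p y → p (x + y))
    (hsmul : ∀ (c : K) x, p x → p (c • x)) (hh : ∀ δ, p (1 ⊗ₜ B.hCartan δ)) (x : K ⊗[A] B.cartan) :
    p x := by
  induction x using TensorProduct.induction_on with
  | zero => exact h0
  | add x y hx hy => exact hadd x y hx hy
  | tmul c y =>
    obtain ⟨y, hy⟩ := y
    suffices h : ∀ hy : y ∈ B.cartan, p (c ⊗ₜ (⟨y, hy⟩ : B.cartan)) from h hy
    induction hy using Submodule.span_induction generalizing c with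
    | mem y hy =>
      intro h
      obtain ⟨δ, rfl⟩ := hy
      have := hsmul c _ (hh δ)
      rw [TensorProduct.smul_tmul', smul_eq_mul, mul_one] at this
      exact this
    | zero =>
      intro h
      have : (⟨0, h⟩ : B.cartan) = 0 := rfl
      rw [this, TensorProduct.tmul_zero]
      exact h0
    | add y z hy hz ihy ihz =>
      intro h
      have : (⟨y + z, h⟩ : B.cartan) = ⟨y, hy⟩ + ⟨z, hz⟩ := rfl
      rw [this, TensorProduct.tmul_add]
      exact hadd _ _ (ihy c hy) (ihz c hz)
    | smul a y hy ihy =>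
      intro h
      have : (⟨a • y, h⟩ : B.cartan) = a • ⟨y, hy⟩ := rfl
      rw [this, ← TensorProduct.smul_tmul]
      exact ihy _ hy

variable {K} in
lemma weight_ext {μ ν : B.Weight K} (h : ∀ δ, B.pairingCoroot μ δ = B.pairingCoroot ν δ) :
    μ = ν := by
  ext x
  refine cartan_induction B (p := fun x => μ x = ν x) (by simp) ?_ ?_ h _
  · intro x y hx hy
    rw [map_add, map_add, hx, hy]
  · intro c x hx
    rw [map_smul, map_smul, hx]

lemma pairingCoroot_rootWeight (β : ι) (δ : b.support) :
    B.pairingCoroot (B.rootWeight K β) δ = (P.pairingIn ℤ β δ : ℤ) :=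
  B.rootWeight_hCartan K β δ

lemma rootWeight_eq_sum (β : ι) :
    B.rootWeight K β = ∑ j ∈ b.support, (rootCoeff b β j : K) • B.rootWeight K j := by
  refine weight_ext B fun δ => ?_
  have h : P.pairingIn ℤ β δ = ∑ j ∈ b.support, rootCoeff b β j * P.pairingIn ℤ j δ := by
    apply FaithfulSMul.algebraMap_injective ℤ k
    simp only [map_sum, map_mul, P.algebraMap_pairingIn, ← P.root_coroot_eq_pairing]
    conv_lhs => rw [root_eq_sum_rootCoeff b β]
    simp [LinearMap.sum_apply]
  rw [pairingCoroot_rootWeight, h]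
  simp only [pairingCoroot, LinearMap.sum_apply, LinearMap.smul_apply, rootWeight_hCartan]
  push_cast
  rfl

lemma rootWeight_add {β γ δ : ι} (h : P.root β + P.root γ = P.root δ) :
    B.rootWeight K δ = B.rootWeight K β + B.rootWeight K γ := by
  refine weight_ext B fun ε => ?_
  have h : P.pairingIn ℤ δ ε = P.pairingIn ℤ β ε + P.pairingIn ℤ γ ε := by
    apply FaithfulSMul.algebraMap_injective ℤ k
    simp only [map_add, P.algebraMap_pairingIn, ← P.root_coroot_eq_pairing, ← h,
      LinearMap.add_apply]
  rw [pairingCoroot_rootWeight, h]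
  simp only [pairingCoroot, LinearMap.add_apply, rootWeight_hCartan]
  push_cast
  rfl

lemma rootWeight_neg (β : ι) :
    B.rootWeight K (P.reflectionPerm β β) = - B.rootWeight K β := by
  refine weight_ext B fun ε => ?_
  have h : P.pairingIn ℤ (P.reflectionPerm β β) ε = - P.pairingIn ℤ β ε := by
    apply FaithfulSMul.algebraMap_injective ℤ k
    simp only [map_neg, P.algebraMap_pairingIn, ← P.root_coroot_eq_pairing,
      P.root_reflectionPerm, P.reflection_apply_self, map_neg, LinearMap.neg_apply]
  rw [pairingCoroot_rootWeight, h]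
  simp only [pairingCoroot, LinearMap.neg_apply, rootWeight_hCartan]
  push_cast
  rfl

/-- These are the fundamental coweights, given by the inverse of the Cartan matrix over `K`. -/
lemma exists_coweights [CharZero K] [DecidableEq b.support] (hdet : b.cartanMatrix.det ≠ 0) :
    ∃ ϖ : b.support → K ⊗[A] B.cartan, ∀ γ δ : b.support,
      B.rootWeight K δ (ϖ γ) = if δ = γ then 1 else 0 := by
  let M : Matrix b.support b.support K := b.cartanMatrix.map (Int.castRingHom K)
  have hM : M.det ≠ 0 := by
    have h : M.det = (Int.castRingHom K) b.cartanMatrix.det := (RingHom.map_det _ _).symm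
    rw [h]
    simpa using hdet
  have hMM : M * M⁻¹ = 1 := Matrix.mul_nonsing_inv _ (isUnit_iff_ne_zero.2 hM)
  refine ⟨fun γ => ∑ ε, M⁻¹ ε γ • ((1 : K) ⊗ₜ B.hCartan ε), fun γ δ => ?_⟩
  rw [← Matrix.one_apply, ← hMM, Matrix.mul_apply, map_sum]
  refine Finset.sum_congr rfl fun ε _ => ?_
  rw [map_smul, rootWeight_hCartan, smul_eq_mul, mul_comm]
  rfl

/-- `h₀` is the sum of the fundamental coweights and `h₁` omits the one dual to `α`. Their
eigenvalues measure the height and the degree away from `α`, and all later separations of weights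
use them. -/
lemma exists_heights [CharZero K] [DecidableEq b.support] (hdet : b.cartanMatrix.det ≠ 0)
    (α : b.support) :
    ∃ h₀ h₁ : K ⊗[A] B.cartan, (∀ β, B.rootWeight K β h₀ = (b.height β : K)) ∧
      ∀ β, B.rootWeight K β h₁ = (leviDegree b α β : K) := by
  obtain ⟨ϖ, hϖ⟩ := B.exists_coweights K hdet
  have hβ : ∀ β (γ : b.support), B.rootWeight K β (ϖ γ) = rootCoeff b β γ := by
    intro β γ
    rw [rootWeight_eq_sum, LinearMap.sum_apply, ← Finset.sum_coe_sort]
    simp only [LinearMap.smul_apply, hϖ, smul_eq_mul, mul_ite, mul_one, mul_zero,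
      Finset.sum_ite_eq', Finset.mem_univ, if_true]
  have h₀ : ∀ β, B.rootWeight K β (∑ γ, ϖ γ) = (b.height β : K) := by
    intro β
    rw [map_sum, height_eq_sum_rootCoeff, Int.cast_sum,
      ← Finset.sum_coe_sort b.support fun j => (rootCoeff b β j : K)]
    exact Finset.sum_congr rfl fun γ _ => hβ β γ
  refine ⟨∑ γ, ϖ γ, ∑ γ, ϖ γ - ϖ α, h₀, fun β => ?_⟩
  rw [map_sub, h₀, hβ, leviDegree]
  push_cast
  rfl

/-- The root vector `e_β` in `U(g_K)`. -/
def E (β : ι) : UK A K g := UniversalEnvelopingAlgebra.ι K ((1 : K) ⊗ₜ[A] B.e β)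

section

attribute [local instance] LieRing.ofAssociativeRing

/-- The embedding of `h_K` into `U(g_K)`. -/
def H : K ⊗[A] B.cartan →ₗ[K] UK A K g :=
  (UniversalEnvelopingAlgebra.ι K : K ⊗[A] g →ₗ⁅K⁆ UK A K g).toLinearMap ∘ₗ
    B.cartan.subtype.baseChange K

variable {K}

lemma ι_mul_ι (x y : K ⊗[A] g) :
    UniversalEnvelopingAlgebra.ι K x * UniversalEnvelopingAlgebra.ι K y =
      UniversalEnvelopingAlgebra.ι K y * UniversalEnvelopingAlgebra.ι K x +
        UniversalEnvelopingAlgebra.ι K ⁅x, y⁆ := by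
  rw [LieHom.map_lie, LieRing.of_associative_ring_bracket]
  abel

lemma lie_incl_e (x : K ⊗[A] B.cartan) (β : ι) :
    ⁅B.cartan.subtype.baseChange K x, (1 : K) ⊗ₜ[A] B.e β⁆ =
      B.rootWeight K β x • ((1 : K) ⊗ₜ[A] B.e β) := by
  refine cartan_induction B (p := fun x => ⁅B.cartan.subtype.baseChange K x,
    (1 : K) ⊗ₜ[A] B.e β⁆ = B.rootWeight K β x • ((1 : K) ⊗ₜ[A] B.e β)) (by simp) ?_ ?_ ?_ x
  · intro x y hx hy
    rw [map_add, add_lie, hx, hy, map_add, add_smul]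
  · intro c x hx
    rw [map_smul, smul_lie, hx, map_smul, smul_assoc]
  · intro δ
    rw [LinearMap.baseChange_tmul, LieAlgebra.ExtendScalars.bracket_tmul, rootWeight_hCartan,
      one_mul]
    change 1 ⊗ₜ ⁅B.h δ, B.e β⁆ = _
    rw [lie_h_e', TensorProduct.tmul_smul, Int.cast_smul_eq_zsmul]

lemma lie_incl_incl (x y : K ⊗[A] B.cartan) :
    ⁅B.cartan.subtype.baseChange K x, B.cartan.subtype.baseChange K y⁆ = 0 := by
  refine cartan_induction B (p := fun x => ⁅B.cartan.subtype.baseChange K x,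
    B.cartan.subtype.baseChange K y⁆ = 0) (by simp) ?_ ?_ ?_ x
  · intro x y hx hy
    rw [map_add, add_lie, hx, hy, add_zero]
  · intro c x hx
    rw [map_smul, smul_lie, hx, smul_zero]
  · intro δ
    refine cartan_induction B (p := fun y => ⁅B.cartan.subtype.baseChange K (1 ⊗ₜ B.hCartan δ),
      B.cartan.subtype.baseChange K y⁆ = 0) (by simp) ?_ ?_ ?_ y
    · intro x y hx hy
      rw [map_add, lie_add, hx, hy, add_zero]
    · intro c x hx
      rw [map_smul, lie_smul, hx, smul_zero]
    · intro ε
      rw [LinearMap.baseChange_tmul, LinearMap.baseChange_tmul,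
        LieAlgebra.ExtendScalars.bracket_tmul]
      change _ ⊗ₜ ⁅B.h δ, B.h ε⁆ = _
      have : ⁅B.h δ, B.h ε⁆ = 0 := B.lie_h_h δ ε
      rw [this, TensorProduct.tmul_zero]

lemma H_mul_E (x : K ⊗[A] B.cartan) (β : ι) :
    B.H K x * B.E K β = B.E K β * B.H K x + B.rootWeight K β x • B.E K β := by
  change UniversalEnvelopingAlgebra.ι K _ * UniversalEnvelopingAlgebra.ι K _ = _
  rw [ι_mul_ι, lie_incl_e, map_smul (UniversalEnvelopingAlgebra.ι K : K ⊗[A] g →ₗ⁅K⁆ UK A K g)]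
  rfl

lemma H_mul_H (x y : K ⊗[A] B.cartan) : B.H K x * B.H K y = B.H K y * B.H K x := by
  change UniversalEnvelopingAlgebra.ι K _ * UniversalEnvelopingAlgebra.ι K _ = _
  rw [ι_mul_ι, lie_incl_incl, map_zero (UniversalEnvelopingAlgebra.ι K : K ⊗[A] g →ₗ⁅K⁆ UK A K g),
    add_zero]
  rfl

lemma E_mul_E {β γ δ : ι} (h : P.root β + P.root γ = P.root δ) :
    B.E K β * B.E K γ = B.E K γ * B.E K β + algebraMap A K (B.C β γ) • B.E K δ := by
  have h1 : ⁅B.e β, B.e γ⁆ = B.C β γ • B.e δ := B.lie_e_e β γ δ h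
  rw [E, E, ι_mul_ι, LieAlgebra.ExtendScalars.bracket_tmul, h1, one_mul,
    TensorProduct.tmul_smul, ← algebraMap_smul K (B.C β γ), map_smul]
  rfl

lemma E_mul_E_of_notMem {β γ : ι} (h0 : P.root β + P.root γ ≠ 0)
    (h : P.root β + P.root γ ∉ Set.range P.root) : B.E K β * B.E K γ = B.E K γ * B.E K β := by
  have h1 : ⁅B.e β, B.e γ⁆ = 0 := B.lie_e_e_eq_zero β γ h0 h
  rw [E, E, ι_mul_ι, LieAlgebra.ExtendScalars.bracket_tmul, h1, TensorProduct.tmul_zero, map_zero,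
    add_zero]

lemma E_mul_F (α : b.support) :
    B.E K α * B.E K (P.reflectionPerm α α) =
      B.E K (P.reflectionPerm α α) * B.E K α + B.H K (1 ⊗ₜ B.hCartan α) := by
  have h1 : ⁅B.e α, B.e (P.reflectionPerm α α)⁆ = B.h α := B.lie_e_f α
  have h2 : B.H K (1 ⊗ₜ B.hCartan α) = UniversalEnvelopingAlgebra.ι K ((1 : K) ⊗ₜ[A] B.h α) := by
    rw [H, LinearMap.comp_apply, LinearMap.baseChange_tmul]
    rfl
  rw [E, E, ι_mul_ι, LieAlgebra.ExtendScalars.bracket_tmul, h1, one_mul, h2]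

end

/-- The reflection in `α` permutes the positive roots other than `α` and reverses the sign of their
pairing with the coroot, so only `α` contributes. -/
lemma pairingCoroot_rho [CharZero K] [Fintype ι] [P.IsReduced] (α : b.support) :
    B.pairingCoroot (B.rho K) α = 1 := by
  classical
  have hsum : ∑ β : ι with b.IsPos β, P.pairingIn ℤ β α = 2 := by
    have hα : (α : ι) ∈ Finset.univ.filter fun β => b.IsPos β := by
      simpa using b.isPos_of_mem_support α.2
    rw [← Finset.add_sum_erase _ _ hα]
    have hs : ∑ β ∈ (Finset.univ.filter fun β => b.IsPos β).erase (α : ι), P.pairingIn ℤ β α =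
        - ∑ β ∈ (Finset.univ.filter fun β => b.IsPos β).erase (α : ι), P.pairingIn ℤ β α := by
      rw [← Finset.sum_neg_distrib]
      have hmem : ∀ β ∈ (Finset.univ.filter fun β => b.IsPos β).erase (α : ι),
          P.reflectionPerm α β ∈ (Finset.univ.filter fun β => b.IsPos β).erase (α : ι) := by
        intro β hβ
        simp only [Finset.mem_erase, Finset.mem_filter, Finset.mem_univ, true_and] at hβ ⊢
        refine ⟨fun h => ?_, hβ.2.reflectionPerm α.2 hβ.1⟩
        have h1 : β = P.reflectionPerm α α := by
          rw [← P.reflectionPerm_self α β, h]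
        have h2 : b.IsPos (P.reflectionPerm α α) := h1 ▸ hβ.2
        exact (RootPairing.Base.IsPos.neg_iff_not b (α : ι)).1 h2 (b.isPos_of_mem_support α.2)
      refine Finset.sum_bij' (fun β _ => P.reflectionPerm α β) (fun β _ => P.reflectionPerm α β)
        hmem hmem (by simp) (by simp) ?_
      intro β _
      apply FaithfulSMul.algebraMap_injective ℤ k
      simp only [map_neg, P.algebraMap_pairingIn]
      rw [← P.pairing_reflectionPerm, P.pairing_reflectionPerm_self_right, neg_neg]
    have h2 : P.pairingIn ℤ (α : ι) α = 2 := P.pairingIn_same ℤ α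
    omega
  have h1 : B.pairingCoroot (B.rho K) α =
      (2 : K)⁻¹ * ((∑ β : ι with b.IsPos β, P.pairingIn ℤ β α : ℤ) : K) := by
    rw [rho, pairingCoroot, LinearMap.smul_apply, LinearMap.sum_apply, smul_eq_mul]
    push_cast
    congr 1
    refine Finset.sum_congr (by congr) fun β _ => B.rootWeight_hCartan K β α
  rw [h1, hsum]
  norm_num

lemma dotReflect_eq [CharZero K] [Fintype ι] [P.IsReduced] (α : b.support) (μ : B.Weight K) :
    B.dotReflect α μ = μ - (B.pairingCoroot μ α + 1) • B.rootWeight K α := by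
  have h : B.pairingCoroot (μ + B.rho K) α = B.pairingCoroot μ α + 1 := by
    rw [← B.pairingCoroot_rho K α]; rfl
  rw [dotReflect, reflect, h]
  abel

end ChevalleyBasis

/-! ### Derivations of fraction fields and of determinants -/

section Derivations

variable {K A : Type*} [Field K] [CommRing A] [IsDomain A] [Algebra K A]

/-- The extension of a derivation to the field of fractions. -/
def fractionRingDerivation (D : Derivation K A A) :
    Derivation K (FractionRing A) (FractionRing A) :=
  -- Localisation is formally étale, so the differentials of the fraction field are the base change
  -- of those of `A`.
  have := Algebra.FormallyEtale.of_isLocalization (Rₘ := FractionRing A) (nonZeroDivisors A)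
  (LinearMap.liftBaseChange (FractionRing A)
    ((Algebra.linearMap A (FractionRing A)).compDer D).liftKaehlerDifferential ∘ₗ
      (KaehlerDifferential.tensorKaehlerEquivOfFormallyEtale K A
        (FractionRing A)).symm.toLinearMap).compDer (KaehlerDifferential.D K (FractionRing A))

lemma fractionRingDerivation_algebraMap (D : Derivation K A A) (a : A) :
    fractionRingDerivation D (algebraMap A (FractionRing A) a) =
      algebraMap A (FractionRing A) (D a) := by
  have := Algebra.FormallyEtale.of_isLocalization (Rₘ := FractionRing A) (nonZeroDivisors A)
  change LinearMap.liftBaseChange (FractionRing A)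
    ((Algebra.linearMap A (FractionRing A)).compDer D).liftKaehlerDifferential
      ((KaehlerDifferential.tensorKaehlerEquivOfFormallyEtale K A (FractionRing A)).symm
        (KaehlerDifferential.D K (FractionRing A) (algebraMap A (FractionRing A) a))) = _
  rw [KaehlerDifferential.tensorKaehlerEquivOfFormallyEtale_symm_D_algebraMap,
    LinearMap.liftBaseChange_tmul, one_smul, Derivation.liftKaehlerDifferential_comp_D]
  rfl

lemma derivation_fractionRing_ext {D₁ D₂ : Derivation K (FractionRing A) (FractionRing A)}
    (h : ∀ a, D₁ (algebraMap A (FractionRing A) a) = D₂ (algebraMap A (FractionRing A) a)) :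
    D₁ = D₂ := by
  ext q
  obtain ⟨a, c, hc, rfl⟩ := IsFractionRing.div_surjective (A := A) q
  rw [Derivation.leibniz_div, Derivation.leibniz_div, h, h]

omit [IsDomain A] in
lemma derivation_prod (D : Derivation K A A) {I : Type*} [DecidableEq I] (s : Finset I) (f : I → A) :
    D (∏ i ∈ s, f i) = ∑ i ∈ s, D (f i) * ∏ j ∈ s.erase i, f j := by
  induction s using Finset.induction_on with
  | empty => simp
  | insert a s ha ih =>
    rw [Finset.prod_insert ha, Derivation.leibniz, ih, Finset.sum_insert ha,
      Finset.erase_insert ha, smul_eq_mul, smul_eq_mul, Finset.mul_sum, add_comm, mul_comm]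
    congr 1
    refine Finset.sum_congr rfl fun i hi => ?_
    rw [Finset.erase_insert_of_ne (by rintro rfl; exact ha hi), Finset.prod_insert
      (by simp [ha])]
    ring

omit [IsDomain A] in
lemma derivation_det (D : Derivation K A A) {I : Type*} [DecidableEq I] [Fintype I]
    (M : Matrix I I A) :
    D M.det = ∑ k, (M.updateCol k fun i => D (M i k)).det := by
  simp only [Matrix.det_apply]
  rw [map_sum, Finset.sum_comm]
  refine Finset.sum_congr rfl fun σ _ => ?_
  rw [Units.smul_def, map_zsmul, derivation_prod, Finset.smul_sum]
  refine Finset.sum_congr rfl fun k _ => ?_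
  rw [Units.smul_def]
  congr 1
  rw [← Finset.mul_prod_erase _ _ (Finset.mem_univ k), Matrix.updateCol_self]
  congr 1
  refine Finset.prod_congr rfl fun j hj => ?_
  rw [Matrix.updateCol_ne (Finset.ne_of_mem_erase hj)]

end Derivations

/-! ### The action of g_K on minors of a generic matrix -/

namespace ChevalleyBasis

variable {ι k X Y : Type*} [Field k] [CharZero k] [AddCommGroup X] [Module k X]
  [AddCommGroup Y] [Module k Y] {P : RootPairing ι k X Y} [P.IsCrystallographic]
  {b : P.Base} {A g : Type*} [CommRing A] [LieRing g] [LieAlgebra A g]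
  (B : ChevalleyBasis b A g) (K : Type*) [Field K] [Algebra A K]

/-- The coordinate ring of the space of matrices with rows indexed by the Chevalley basis and
columns indexed by the roots. -/
abbrev CoordRing (_ : ChevalleyBasis b A g) (K : Type*) [Field K] : Type _ :=
  MvPolynomial ((b.support ⊕ ι) × ι) K

/-- The `j`-th generic vector of `g_K`, as a linear map to the coordinate ring. -/
def genericVector (j : ι) : K ⊗[A] g →ₗ[K] B.CoordRing K :=
  (B.basis.baseChange K).constr K fun i => MvPolynomial.X (i, j)

lemma genericVector_basis (j : ι) (i : b.support ⊕ ι) :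
    B.genericVector K j (1 ⊗ₜ B.basis i) = MvPolynomial.X (i, j) := by
  have := (B.basis.baseChange K).constr_basis K
    (fun i => (MvPolynomial.X (i, j) : B.CoordRing K)) i
  rwa [Module.Basis.baseChange_apply] at this

/-- The action of `g_K` on the coordinate ring by derivations. -/
def coordDerivation (x : K ⊗[A] g) : Derivation K (B.CoordRing K) (B.CoordRing K) :=
  MvPolynomial.mkDerivation K fun q => B.genericVector K q.2 ⁅x, (1 : K) ⊗ₜ[A] B.basis q.1⁆

lemma coordDerivation_genericVector (x y : K ⊗[A] g) (j : ι) :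
    B.coordDerivation K x (B.genericVector K j y) = B.genericVector K j ⁅x, y⁆ := by
  have h : (B.coordDerivation K x).toLinearMap ∘ₗ B.genericVector K j =
      B.genericVector K j ∘ₗ (LieAlgebra.ad K (K ⊗[A] g) x) := by
    refine (B.basis.baseChange K).ext fun i => ?_
    rw [Module.Basis.baseChange_apply, LinearMap.comp_apply, genericVector_basis]
    exact MvPolynomial.mkDerivation_X _ _ _
  exact LinearMap.congr_fun h y

lemma coordDerivation_add (x y : K ⊗[A] g) :
    B.coordDerivation K (x + y) = B.coordDerivation K x + B.coordDerivation K y := by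
  refine MvPolynomial.derivation_ext fun q => ?_
  rw [Derivation.add_apply]
  simp only [coordDerivation, MvPolynomial.mkDerivation_X, add_lie, map_add]

lemma coordDerivation_smul (c : K) (x : K ⊗[A] g) :
    B.coordDerivation K (c • x) = c • B.coordDerivation K x := by
  refine MvPolynomial.derivation_ext fun q => ?_
  rw [Derivation.smul_apply]
  simp only [coordDerivation, MvPolynomial.mkDerivation_X, smul_lie, map_smul]

lemma coordDerivation_lie (x y : K ⊗[A] g) :
    B.coordDerivation K ⁅x, y⁆ = ⁅B.coordDerivation K x, B.coordDerivation K y⁆ := by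
  refine MvPolynomial.derivation_ext fun q => ?_
  rw [Derivation.commutator_apply, ← B.genericVector_basis K, coordDerivation_genericVector,
    coordDerivation_genericVector, coordDerivation_genericVector, coordDerivation_genericVector,
    coordDerivation_genericVector, lie_lie, map_sub]

/-- The field of rational functions. -/
abbrev CoordField (B : ChevalleyBasis b A g) (K : Type*) [Field K] : Type _ :=
  FractionRing (B.CoordRing K)

/-- The action of `g_K` on the field of rational functions by derivations. -/
def fieldDerivation (x : K ⊗[A] g) : Derivation K (B.CoordField K) (B.CoordField K) :=
  fractionRingDerivation (B.coordDerivation K x)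

lemma fieldDerivation_add (x y : K ⊗[A] g) :
    B.fieldDerivation K (x + y) = B.fieldDerivation K x + B.fieldDerivation K y :=
  derivation_fractionRing_ext fun a => by
    simp only [fieldDerivation, Derivation.add_apply, fractionRingDerivation_algebraMap,
      coordDerivation_add, map_add]

lemma fieldDerivation_smul (c : K) (x : K ⊗[A] g) :
    B.fieldDerivation K (c • x) = c • B.fieldDerivation K x :=
  derivation_fractionRing_ext fun a => by
    simp only [fieldDerivation, Derivation.smul_apply, fractionRingDerivation_algebraMap,
      coordDerivation_smul]
    exact algebraMap.smul _ _ _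

lemma fieldDerivation_lie (x y : K ⊗[A] g) :
    B.fieldDerivation K ⁅x, y⁆ = ⁅B.fieldDerivation K x, B.fieldDerivation K y⁆ :=
  derivation_fractionRing_ext fun a => by
    simp only [fieldDerivation, Derivation.commutator_apply, fractionRingDerivation_algebraMap,
      coordDerivation_lie, map_sub]

variable [DecidableEq ι]

/-- The minor of the generic matrix at a set of roots. -/
def minor (S : Finset ι) : B.CoordRing K :=
  (Matrix.of fun j i : S => B.genericVector K j (1 ⊗ₜ B.e i)).det

/-- The generic matrix can be specialised so that the minor becomes the determinant of the identity.
-/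
lemma minor_ne_zero (S : Finset ι) : B.minor K S ≠ 0 := by
  intro h
  have h1 := congrArg (MvPolynomial.aeval (R := K) (S₁ := K)
    fun q : (b.support ⊕ ι) × ι => if q.1 = Sum.inr q.2 then (1 : K) else 0) h
  rw [minor, map_zero, AlgHom.map_det] at h1
  have h2 : (MvPolynomial.aeval (R := K) (S₁ := K)
      fun q : (b.support ⊕ ι) × ι => if q.1 = Sum.inr q.2 then (1 : K) else 0).mapMatrix
        (Matrix.of fun j i : S => B.genericVector K j (1 ⊗ₜ B.e i)) = 1 := by
    ext j i
    rw [AlgHom.mapMatrix_apply, Matrix.map_apply, Matrix.of_apply]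
    change MvPolynomial.aeval _ (B.genericVector K j (1 ⊗ₜ B.basis (.inr i))) = _
    rw [genericVector_basis, MvPolynomial.aeval_X, Matrix.one_apply]
    simp only [Sum.inr.injEq, SetCoe.ext_iff, eq_comm]
  rw [h2, Matrix.det_one] at h1
  exact one_ne_zero h1

lemma coordDerivation_minor (x : K ⊗[A] g) (S : Finset ι) :
    B.coordDerivation K x (B.minor K S) =
      ∑ i : S, ((Matrix.of fun j i : S => B.genericVector K j (1 ⊗ₜ B.e i)).updateCol i
        fun j => B.genericVector K j ⁅x, (1 : K) ⊗ₜ[A] B.e i⁆).det := by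
  rw [minor, derivation_det]
  refine Finset.sum_congr rfl fun i _ => ?_
  congr 2
  ext j
  rw [Matrix.of_apply, coordDerivation_genericVector]

lemma coordDerivation_minor_incl (x : K ⊗[A] B.cartan) (S : Finset ι) :
    B.coordDerivation K (B.cartan.subtype.baseChange K x) (B.minor K S) =
      (∑ i ∈ S, B.rootWeight K i x) • B.minor K S := by
  rw [coordDerivation_minor, ← Finset.sum_coe_sort S fun i => B.rootWeight K i x, Finset.sum_smul]
  refine Finset.sum_congr rfl fun i _ => ?_
  have h : (fun j : S => B.genericVector K j
      ⁅B.cartan.subtype.baseChange K x, (1 : K) ⊗ₜ[A] B.e i⁆) =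
        (MvPolynomial.C (B.rootWeight K i x) : B.CoordRing K) •
          fun j : S => B.genericVector K j ((1 : K) ⊗ₜ[A] B.e i) := by
    funext j
    rw [lie_incl_e, (B.genericVector K j).map_smul, Pi.smul_apply, smul_eq_mul,
      MvPolynomial.smul_eq_C_mul]
  rw [h, Matrix.det_updateCol_smul, MvPolynomial.smul_eq_C_mul, minor]
  congr 2
  exact Matrix.updateCol_eq_self _ i

/-- A set of positive roots closed under the addition of positive roots. -/
def UpperClosed (b : P.Base) (S : Finset ι) : Prop :=
  ∀ i ∈ S, b.IsPos i ∧ ∀ j l, b.IsPos j → P.root j + P.root i = P.root l → l ∈ S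

lemma root_add_root_ne_zero {i j : ι} (hi : b.IsPos i) (hj : b.IsPos j) :
    P.root i + P.root j ≠ 0 := by
  intro h
  have h1 : P.root j = P.root (P.reflectionPerm i i) := by
    rw [P.root_reflectionPerm, P.reflection_apply_self, eq_neg_iff_add_eq_zero, add_comm, h]
  have h2 : b.IsPos (P.reflectionPerm i i) := P.root.injective h1 ▸ hj
  exact (RootPairing.Base.IsPos.neg_iff_not b i).1 h2 hi

/-- `minor S` behaves as the wedge product of the `e_i` with `i ∈ S`. Bracketing one factor with
`e_γ` gives zero or a multiple of another factor, as `S` is closed upwards. -/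
lemma coordDerivation_minor_e {S : Finset ι} (hS : UpperClosed b S) {γ : ι} (hγ : b.IsPos γ) :
    B.coordDerivation K ((1 : K) ⊗ₜ[A] B.e γ) (B.minor K S) = 0 := by
  rw [coordDerivation_minor]
  refine Finset.sum_eq_zero fun i _ => ?_
  rw [LieAlgebra.ExtendScalars.bracket_tmul, one_mul]
  by_cases h : P.root γ + P.root i ∈ Set.range P.root
  · obtain ⟨l, hl⟩ := h
    have h1 : ⁅B.e γ, B.e i⁆ = B.C γ i • B.e l := B.lie_e_e _ _ _ hl.symm
    have hlS : l ∈ S := (hS i i.2).2 γ l hγ hl.symm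
    have hil : (⟨l, hlS⟩ : S) ≠ i := by
      rintro rfl
      exact P.ne_zero γ (by simpa using hl.symm)
    have h2 : (fun j : S => B.genericVector K j ((1 : K) ⊗ₜ[A] ⁅B.e γ, B.e i⁆)) =
        (MvPolynomial.C (algebraMap A K (B.C γ i)) : B.CoordRing K) •
          fun j : S => B.genericVector K j ((1 : K) ⊗ₜ[A] B.e l) := by
      funext j
      rw [h1, TensorProduct.tmul_smul, ← algebraMap_smul K (B.C γ i), map_smul, Pi.smul_apply,
        smul_eq_mul, MvPolynomial.smul_eq_C_mul]
    rw [h2, Matrix.det_updateCol_smul]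
    convert mul_zero _
    refine Matrix.det_zero_of_column_eq hil fun j => ?_
    rw [Matrix.updateCol_self, Matrix.updateCol_ne hil]
    rfl
  · have h1 : ⁅B.e γ, B.e i⁆ = 0 :=
      B.lie_e_e_eq_zero _ _ (root_add_root_ne_zero hγ (hS i i.2).1) h
    refine Matrix.det_eq_zero_of_column_eq_zero i fun j => ?_
    rw [Matrix.updateCol_self, h1, TensorProduct.tmul_zero, map_zero]

end ChevalleyBasis

/-! ### Representations on a field twisted by a cocycle -/

section Twist

variable {K Q L : Type*} [Field K] [Field Q] [Algebra K Q] [LieRing L] [LieAlgebra K L]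

attribute [local instance] LieRing.ofAssociativeRing

/-- The representation of a Lie algebra on a field `Q` given by a Lie algebra of derivations
of `Q` and a 1-cocycle. -/
def twistedAction (D : L →ₗ⁅K⁆ Derivation K Q Q) (θ : L →ₗ[K] Q)
    (hθ : ∀ x y, θ ⁅x, y⁆ = D x (θ y) - D y (θ x)) : L →ₗ⁅K⁆ Module.End K Q where
  toFun x := (D x).toLinearMap + LinearMap.mulLeft K (θ x)
  map_add' x y := by
    ext q
    simp [add_mul]
    ring
  map_smul' c x := by
    ext q
    simp
  map_lie' {x y} := by
    ext q
    simp [Ring.lie_def, hθ]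
    ring

/-- Combinations of logarithmic derivatives with coefficients in `K` will replace products of powers
`r ^ c` with exponents `c ∈ K`, which do not exist in `Q`. -/
lemma logDeriv_cocycle (D₁ D₂ : Derivation K Q Q) {r : Q} (hr : r ≠ 0) :
    ⁅D₁, D₂⁆ r / r = D₁ (D₂ r / r) - D₂ (D₁ r / r) := by
  rw [Derivation.leibniz_div, Derivation.leibniz_div, Derivation.commutator_apply]
  simp only [smul_eq_mul]
  field_simp
  ring

lemma derivation_div_of_eq_smul {D : Derivation K Q Q} {a b : Q} (hb : b ≠ 0) {s t : K}
    (ha' : D a = s • a) (hb' : D b = t • b) : D (a / b) = (s - t) • (a / b) := by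
  rw [Derivation.leibniz_div, ha', hb']
  simp only [smul_eq_mul]
  simp only [Algebra.smul_def, map_sub]
  field_simp

end Twist

/-! ### Verma modules are non-zero -/

namespace ChevalleyBasis

variable {ι k X Y : Type*} [Field k] [CharZero k] [AddCommGroup X] [Module k X]
  [AddCommGroup Y] [Module k Y] {P : RootPairing ι k X Y} [P.IsCrystallographic]
  {b : P.Base} {A g : Type*} [CommRing A] [LieRing g] [LieAlgebra A g]
  (B : ChevalleyBasis b A g) (K : Type*) [Field K] [Algebra A K]

/-- `fieldDerivation` as a homomorphism of Lie algebras. -/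
def fieldDerivationHom : K ⊗[A] g →ₗ⁅K⁆ Derivation K (B.CoordField K) (B.CoordField K) where
  toFun := B.fieldDerivation K
  map_add' := B.fieldDerivation_add K
  map_smul' := B.fieldDerivation_smul K
  map_lie' := B.fieldDerivation_lie K _ _

lemma fieldDerivationHom_algebraMap (x : K ⊗[A] g) (a : B.CoordRing K) :
    B.fieldDerivationHom K x (algebraMap _ _ a) = algebraMap _ _ (B.coordDerivation K x a) :=
  fractionRingDerivation_algebraMap _ _

lemma upperClosed_filter_isPos [DecidableEq ι] [Fintype ι] [DecidablePred b.IsPos] :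
    UpperClosed b (Finset.univ.filter b.IsPos) := by
  intro i hi
  rw [Finset.mem_filter] at hi
  exact ⟨hi.2, fun j l hj h => Finset.mem_filter.2
    ⟨Finset.mem_univ _, RootPairing.Base.IsPos.add hj hi.2 h.symm⟩⟩

lemma upperClosed_filter_isPos_erase [DecidableEq ι] [Fintype ι] [DecidablePred b.IsPos] {γ : ι}
    (hγ : γ ∈ b.support) : UpperClosed b ((Finset.univ.filter b.IsPos).erase γ) := by
  intro i hi
  obtain ⟨h1, h2⟩ := upperClosed_filter_isPos i (Finset.mem_of_mem_erase hi)
  refine ⟨h1, fun j l hj h => Finset.mem_erase.2 ⟨?_, h2 j l hj h⟩⟩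
  rintro rfl
  have h3 := b.height_add h.symm
  have h4 := b.height_one_of_mem_support hγ
  have h5 : 0 < b.height i := h1
  have h6 : 0 < b.height j := hj
  omega

/-- `r` is the quotient of the minors at all positive roots and at those other than `γ`. Both sets
are closed upwards, since the simple root `γ` is not a sum of two positive roots, and their weights
differ by `γ`. -/
lemma exists_semiinvariant [Finite ι] {γ : ι} (hγ : γ ∈ b.support) :
    ∃ r : B.CoordField K, r ≠ 0 ∧
      (∀ β, b.IsPos β → B.fieldDerivationHom K (1 ⊗ₜ B.e β) r = 0) ∧
      ∀ x, B.fieldDerivationHom K (B.cartan.subtype.baseChange K x) r = B.rootWeight K γ x • r := by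
  classical
  have := Fintype.ofFinite ι
  have hne : ∀ S : Finset ι, algebraMap (B.CoordRing K) (B.CoordField K) (B.minor K S) ≠ 0 :=
    fun S => (map_ne_zero_iff _ (FaithfulSMul.algebraMap_injective _ _)).2 (B.minor_ne_zero K S)
  set S := Finset.univ.filter b.IsPos with hS
  have hγS : γ ∈ S := by simpa [hS] using b.isPos_of_mem_support hγ
  refine ⟨algebraMap _ _ (B.minor K S) / algebraMap _ _ (B.minor K (S.erase γ)),
    div_ne_zero (hne _) (hne _), fun β hβ => ?_, fun x => ?_⟩
  · rw [Derivation.leibniz_div, fieldDerivationHom_algebraMap, fieldDerivationHom_algebraMap,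
      B.coordDerivation_minor_e K upperClosed_filter_isPos hβ,
      B.coordDerivation_minor_e K (upperClosed_filter_isPos_erase hγ) hβ]
    simp
  · rw [derivation_div_of_eq_smul (hne (S.erase γ)) (s := ∑ i ∈ S, B.rootWeight K i x)
      (t := ∑ i ∈ S.erase γ, B.rootWeight K i x), ← Finset.add_sum_erase S _ hγS,
      add_sub_cancel_right]
    · rw [fieldDerivationHom_algebraMap, coordDerivation_minor_incl]
      exact algebraMap.smul _ _ _
    · rw [fieldDerivationHom_algebraMap, coordDerivation_minor_incl]
      exact algebraMap.smul _ _ _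

lemma exists_eq_sum_rootWeight [CharZero K] [DecidableEq b.support]
    (hdet : b.cartanMatrix.det ≠ 0) (μ : B.Weight K) :
    ∃ c : b.support → K, μ = ∑ γ, c γ • B.rootWeight K γ := by
  let M : Matrix b.support b.support K := b.cartanMatrix.map (Int.castRingHom K)
  have hM : M.det ≠ 0 := by
    have h : M.det = (Int.castRingHom K) b.cartanMatrix.det := (RingHom.map_det _ _).symm
    rw [h]
    simpa using hdet
  have hMM : M⁻¹ * M = 1 := Matrix.nonsing_inv_mul _ (isUnit_iff_ne_zero.2 hM)
  refine ⟨Matrix.vecMul (B.pairingCoroot μ) M⁻¹, weight_ext B fun δ => ?_⟩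
  have h : Matrix.vecMul (Matrix.vecMul (B.pairingCoroot μ) M⁻¹) M δ = B.pairingCoroot μ δ := by
    rw [Matrix.vecMul_vecMul, hMM, Matrix.vecMul_one]
  rw [← h, pairingCoroot, LinearMap.sum_apply]
  refine Finset.sum_congr rfl fun γ _ => ?_
  rw [LinearMap.smul_apply, rootWeight_hCartan, smul_eq_mul]
  rfl

attribute [local instance] LieRing.ofAssociativeRing in
-- With `μ = ∑ c_γ γ`, twist the action on rational functions by the cocycle `∑ c_γ D(r_γ) / r_γ`.
-- The function `1` then behaves as the formal product of the `r_γ ^ c_γ`, a vector of highest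
-- weight `μ`, and its annihilator contains the Verma ideal but not `1`.
lemma vermaIdeal_ne_top [Finite ι] [CharZero K] [DecidableEq b.support]
    (hdet : b.cartanMatrix.det ≠ 0) (μ : B.Weight K) : B.vermaIdeal μ ≠ ⊤ := by
  obtain ⟨c, hc⟩ := B.exists_eq_sum_rootWeight K hdet μ
  choose r hr0 hre hrh using fun γ : b.support => B.exists_semiinvariant K γ.2
  let θ : K ⊗[A] g →ₗ[K] B.CoordField K :=
    { toFun := fun x => ∑ γ, c γ • (B.fieldDerivationHom K x (r γ) / r γ)
      map_add' := fun x y => by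
        rw [← Finset.sum_add_distrib]
        refine Finset.sum_congr rfl fun γ _ => ?_
        rw [map_add, Derivation.add_apply, add_div, smul_add]
      map_smul' := fun d x => by
        rw [RingHom.id_apply, Finset.smul_sum]
        refine Finset.sum_congr rfl fun γ _ => ?_
        rw [map_smul (B.fieldDerivationHom K), Derivation.smul_apply, smul_div_assoc, smul_comm] }
  have hθ : ∀ x y, θ ⁅x, y⁆ =
      B.fieldDerivationHom K x (θ y) - B.fieldDerivationHom K y (θ x) := by
    intro x y
    change ∑ γ, c γ • (B.fieldDerivationHom K ⁅x, y⁆ (r γ) / r γ) =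
      B.fieldDerivationHom K x (∑ γ, c γ • (B.fieldDerivationHom K y (r γ) / r γ)) -
      B.fieldDerivationHom K y (∑ γ, c γ • (B.fieldDerivationHom K x (r γ) / r γ))
    rw [map_sum, map_sum, ← Finset.sum_sub_distrib]
    refine Finset.sum_congr rfl fun γ _ => ?_
    rw [LieHom.map_lie, logDeriv_cocycle _ _ (hr0 γ), Derivation.map_smul, Derivation.map_smul,
      smul_sub]
  let Φ := UniversalEnvelopingAlgebra.lift K (twistedAction (B.fieldDerivationHom K) θ hθ)
  have hΦ : ∀ x, Φ (UniversalEnvelopingAlgebra.ι K x) 1 = θ x := by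
    intro x
    rw [UniversalEnvelopingAlgebra.lift_ι_apply]
    change B.fieldDerivationHom K x 1 + θ x * 1 = _
    rw [Derivation.map_one_eq_zero, zero_add, mul_one]
  let J : Submodule (UK A K g) (UK A K g) :=
    { carrier := {u | Φ u 1 = 0}
      add_mem' := fun {u v} hu hv => by
        change Φ (u + v) 1 = 0
        rw [map_add, LinearMap.add_apply, show Φ u 1 = 0 from hu, show Φ v 1 = 0 from hv, add_zero]
      zero_mem' := by
        change Φ 0 1 = 0
        rw [map_zero, LinearMap.zero_apply]
      smul_mem' := fun u v hv => by
        change Φ (u * v) 1 = 0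
        rw [map_mul, Module.End.mul_apply, show Φ v 1 = 0 from hv, map_zero] }
  have hJ : B.vermaIdeal μ ≤ J := by
    refine Submodule.span_le.2 ?_
    rintro u (⟨β, hβ, rfl⟩ | ⟨x, rfl⟩)
    · change Φ _ 1 = 0
      rw [hΦ]
      refine Finset.sum_eq_zero fun γ _ => ?_
      rw [hre γ β hβ, zero_div, smul_zero]
    · change Φ _ 1 = 0
      rw [map_sub, LinearMap.sub_apply, hΦ, AlgHom.commutes, Module.algebraMap_end_apply,
        sub_eq_zero, hc, LinearMap.sum_apply, Finset.sum_smul]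
      refine Finset.sum_congr rfl fun γ _ => ?_
      rw [hrh γ x, smul_div_assoc, div_self (hr0 γ), LinearMap.smul_apply, smul_smul, smul_eq_mul]
  intro h
  have h1 : (1 : UK A K g) ∈ J := hJ (h ▸ Submodule.mem_top)
  change Φ 1 1 = 0 at h1
  rw [map_one Φ, Module.End.one_apply] at h1
  exact one_ne_zero h1

end ChevalleyBasis

/-! ### Rewriting words so that chosen generators come first -/

section Descendants

variable {S U V I : Type*} [CommRing S] [Ring U] [Algebra S U] [AddCommGroup V] [Module S V]
  [Module U V] [IsScalarTower S U V] (x : I → U) (J : Set I) (N : Submodule S V)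

/-- The span of the words of length at most `k` in the `x i`, for `i ∈ J`, applied to `N`. -/
def descendantsLE (k : ℕ) : Submodule S V :=
  Submodule.span S {w | ∃ l : List I, l.length ≤ k ∧ (∀ i ∈ l, i ∈ J) ∧
    ∃ v ∈ N, w = (l.map x).prod • v}

/-- The span of the words in the `x i`, for `i ∈ J`, applied to `N`. -/
def descendants : Submodule S V :=
  Submodule.span S {w | ∃ l : List I, (∀ i ∈ l, i ∈ J) ∧ ∃ v ∈ N, w = (l.map x).prod • v}

lemma descendantsLE_mono {k m : ℕ} (h : k ≤ m) : descendantsLE x J N k ≤ descendantsLE x J N m :=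
  Submodule.span_mono fun _ ⟨l, h1, h2⟩ => ⟨l, h1.trans h, h2⟩

lemma descendantsLE_le (k : ℕ) : descendantsLE x J N k ≤ descendants x J N :=
  Submodule.span_mono fun _ ⟨l, _, h2⟩ => ⟨l, h2⟩

lemma exists_mem_descendantsLE {w : V} (hw : w ∈ descendants x J N) :
    ∃ k, w ∈ descendantsLE x J N k := by
  induction hw using Submodule.span_induction with
  | mem w hw =>
    obtain ⟨l, h⟩ := hw
    exact ⟨l.length, Submodule.subset_span ⟨l, le_rfl, h⟩⟩
  | zero => exact ⟨0, zero_mem _⟩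
  | add w w' _ _ h h' =>
    obtain ⟨k, hk⟩ := h
    obtain ⟨m, hm⟩ := h'
    exact ⟨max k m, add_mem (descendantsLE_mono _ _ _ (le_max_left _ _) hk)
      (descendantsLE_mono _ _ _ (le_max_right _ _) hm)⟩
  | smul c w _ h =>
    obtain ⟨k, hk⟩ := h
    exact ⟨k, Submodule.smul_mem _ c hk⟩

lemma le_descendants : N ≤ descendants x J N := fun v hv =>
  Submodule.subset_span ⟨[], by simp, v, hv, by simp⟩

lemma smul_mem_descendantsLE_succ {i : I} (hi : i ∈ J) {k : ℕ} {w : V}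
    (hw : w ∈ descendantsLE x J N k) : x i • w ∈ descendantsLE x J N (k + 1) := by
  induction hw using Submodule.span_induction with
  | mem w hw =>
    obtain ⟨l, h1, h2, v, hv, rfl⟩ := hw
    refine Submodule.subset_span ⟨i :: l, by simpa using h1, ?_, v, hv, ?_⟩
    · intro j hj
      rcases List.mem_cons.1 hj with rfl | hj
      exacts [hi, h2 j hj]
    · rw [List.map_cons, List.prod_cons, mul_smul]
  | zero => rw [smul_zero]; exact zero_mem _
  | add w w' _ _ h h' => rw [smul_add]; exact add_mem h h'
  | smul c w _ h => rw [smul_comm]; exact Submodule.smul_mem _ c h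

lemma smul_mem_of_mem_span_range {T T' : Submodule S V} (h : ∀ i, ∀ w ∈ T, x i • w ∈ T') {u : U}
    (hu : u ∈ Submodule.span S (Set.range x)) {w : V} (hw : w ∈ T) : u • w ∈ T' := by
  induction hu using Submodule.span_induction with
  | mem u hu =>
    obtain ⟨i, rfl⟩ := hu
    exact h i w hw
  | zero => rw [zero_smul]; exact zero_mem _
  | add u u' _ _ h h' => rw [add_smul]; exact add_mem h h'
  | smul c u _ h => rw [smul_assoc]; exact Submodule.smul_mem _ c h

variable {x J N}

/-- Move `x i` past the first letter of the word. The commutator is linear in the generators and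
acts on a shorter word, so induction on the length applies to both terms. -/
lemma smul_mem_descendantsLE (hcomm : ∀ i j, x i * x j - x j * x i ∈ Submodule.span S (Set.range x))
    (hN : ∀ i ∉ J, ∀ v ∈ N, x i • v ∈ N) (k : ℕ) :
    ∀ i ∉ J, ∀ w ∈ descendantsLE x J N k, x i • w ∈ descendantsLE x J N k := by
  induction k with
  | zero =>
    intro i hi w hw
    induction hw using Submodule.span_induction with
    | mem w hw =>
      obtain ⟨l, h1, h2, v, hv, rfl⟩ := hw
      obtain rfl := List.length_eq_zero_iff.1 (Nat.le_zero.1 h1)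
      exact Submodule.subset_span ⟨[], by simp, by simp, x i • v, hN i hi v hv, by simp⟩
    | zero => rw [smul_zero]; exact zero_mem _
    | add w w' _ _ h h' => rw [smul_add]; exact add_mem h h'
    | smul c w _ h => rw [smul_comm]; exact Submodule.smul_mem _ c h
  | succ k ih =>
    have hall : ∀ i, ∀ w ∈ descendantsLE x J N k, x i • w ∈ descendantsLE x J N (k + 1) := by
      intro i w hw
      by_cases hi : i ∈ J
      · exact smul_mem_descendantsLE_succ x J N hi hw
      · exact descendantsLE_mono x J N (Nat.le_succ k) (ih i hi w hw)
    intro i hi w hw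
    induction hw using Submodule.span_induction with
    | mem w hw =>
      obtain ⟨l, h1, h2, v, hv, rfl⟩ := hw
      cases l with
      | nil =>
        exact Submodule.subset_span ⟨[], by simp, by simp, x i • v, hN i hi v hv, by simp⟩
      | cons j l =>
        have hw' : (l.map x).prod • v ∈ descendantsLE x J N k :=
          Submodule.subset_span ⟨l, by simpa using h1, fun i hi => h2 i (List.mem_cons_of_mem _ hi),
            v, hv, rfl⟩
        have h3 : x i • ((j :: l).map x).prod • v = x j • x i • (l.map x).prod • v +
            (x i * x j - x j * x i) • (l.map x).prod • v := by
          rw [List.map_cons, List.prod_cons, sub_smul, mul_smul, mul_smul, mul_smul]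
          abel
        rw [h3]
        exact add_mem (smul_mem_descendantsLE_succ x J N (h2 j List.mem_cons_self) (ih i hi _ hw'))
          (smul_mem_of_mem_span_range x hall (hcomm i j) hw')
    | zero => rw [smul_zero]; exact zero_mem _
    | add w w' _ _ h h' => rw [smul_add]; exact add_mem h h'
    | smul c w _ h => rw [smul_comm]; exact Submodule.smul_mem _ c h

/-- If `N` is stable under the `x i` with `i ∉ J` then the span of the words in the `x i`, with
`i ∈ J`, applied to `N`, is stable under all `x i`. -/
lemma smul_mem_descendants (hcomm : ∀ i j, x i * x j - x j * x i ∈ Submodule.span S (Set.range x))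
    (hN : ∀ i ∉ J, ∀ v ∈ N, x i • v ∈ N) (i : I) {w : V} (hw : w ∈ descendants x J N) :
    x i • w ∈ descendants x J N := by
  obtain ⟨k, hk⟩ := exists_mem_descendantsLE x J N hw
  by_cases hi : i ∈ J
  · exact descendantsLE_le x J N _ (smul_mem_descendantsLE_succ x J N hi hk)
  · exact descendantsLE_le x J N _ (smul_mem_descendantsLE hcomm hN k i hi w hk)

end Descendants

/-! ### Generation of U(g_K) by the scaled Chevalley basis -/

section Enveloping

attribute [local instance] LieRing.ofAssociativeRing

lemma adjoin_range_ι_eq_top {K L : Type*} [Field K] [LieRing L] [LieAlgebra K L] :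
    Algebra.adjoin K (Set.range (UniversalEnvelopingAlgebra.ι K : L → _)) = ⊤ := by
  set S := Algebra.adjoin K (Set.range (UniversalEnvelopingAlgebra.ι K : L → _))
  let f : L →ₗ⁅K⁆ S :=
    { toFun := fun y => ⟨UniversalEnvelopingAlgebra.ι K y,
        Algebra.subset_adjoin (Set.mem_range_self y)⟩
      map_add' := fun a b => Subtype.ext (map_add _ a b)
      map_smul' := fun c a => Subtype.ext (map_smul _ c a)
      map_lie' := fun {a b} => Subtype.ext (LieHom.map_lie _ a b) }
  have h : S.val.comp (UniversalEnvelopingAlgebra.lift K f) = AlgHom.id K _ := by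
    apply UniversalEnvelopingAlgebra.hom_ext
    ext y
    change S.val (UniversalEnvelopingAlgebra.lift K f (UniversalEnvelopingAlgebra.ι K y)) = _
    rw [UniversalEnvelopingAlgebra.lift_ι_apply]
    rfl
  refine eq_top_iff.2 fun x _ => ?_
  have hx := congrArg (fun φ => φ x) h
  change S.val (UniversalEnvelopingAlgebra.lift K f x) = x at hx
  rw [← hx]
  exact (UniversalEnvelopingAlgebra.lift K f x).2

end Enveloping

namespace ChevalleyBasis

variable {ι k X Y : Type*} [Field k] [CharZero k] [AddCommGroup X] [Module k X]
  [AddCommGroup Y] [Module k Y] {P : RootPairing ι k X Y} [P.IsCrystallographic]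
  {b : P.Base} {A g : Type*} [CommRing A] [LieRing g] [LieAlgebra A g]
  (B : ChevalleyBasis b A g) {K : Type*} [Field K] [Algebra A K]

attribute [local instance] LieRing.ofAssociativeRing

/-- The Chevalley basis scaled by `c`, as a family in `U(g_K)`. -/
def gen (c : K) (i : b.support ⊕ ι) : UK A K g :=
  UniversalEnvelopingAlgebra.ι K (c • ((1 : K) ⊗ₜ[A] B.basis i))

lemma gen_inr (c : K) (β : ι) : B.gen c (.inr β) = c • B.E K β :=
  map_smul (UniversalEnvelopingAlgebra.ι K : K ⊗[A] g →ₗ⁅K⁆ UK A K g) _ _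

lemma gen_inl (c : K) (δ : b.support) : B.gen c (.inl δ) = c • B.H K (1 ⊗ₜ B.hCartan δ) :=
  map_smul (UniversalEnvelopingAlgebra.ι K : K ⊗[A] g →ₗ⁅K⁆ UK A K g) _ _

/-- The weight of an element of the Chevalley basis. -/
def genWeight (K : Type*) [Field K] [Algebra A K] : b.support ⊕ ι → B.Weight K :=
  Sum.elim (fun _ => 0) (B.rootWeight K)

lemma H_mul_gen (c : K) (x : K ⊗[A] B.cartan) (i : b.support ⊕ ι) :
    B.H K x * B.gen c i = B.gen c i * B.H K x + B.genWeight K i x • B.gen c i := by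
  cases i with
  | inl δ =>
    rw [gen_inl, mul_smul_comm, H_mul_H, smul_mul_assoc]
    simp [genWeight]
  | inr β =>
    rw [gen_inr, mul_smul_comm, H_mul_E, smul_mul_assoc, smul_add]
    congr 1
    exact smul_comm _ _ _

/-- The bracket of `c x` and `c y` is `c` times `c [x, y]`, and `c ∈ R`. -/
lemma gen_mul_gen_sub_mem {R : ValuationSubring K} (hA : ∀ a, algebraMap A K a ∈ R) {c : K}
    (hc : c ∈ R) (i j : b.support ⊕ ι) :
    B.gen c i * B.gen c j - B.gen c j * B.gen c i ∈ Submodule.span R (Set.range (B.gen c)) := by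
  have h1 : B.gen c i * B.gen c j - B.gen c j * B.gen c i =
      (⟨c, hc⟩ : R) • UniversalEnvelopingAlgebra.ι K (c • ((1 : K) ⊗ₜ[A] ⁅B.basis i, B.basis j⁆)) := by
    rw [gen, gen, ι_mul_ι, add_sub_cancel_left, lie_smul, smul_lie,
      LieAlgebra.ExtendScalars.bracket_tmul, one_mul]
    exact map_smul (UniversalEnvelopingAlgebra.ι K : K ⊗[A] g →ₗ⁅K⁆ UK A K g) _ _
  rw [h1]
  refine Submodule.smul_mem _ _ ?_
  generalize ⁅B.basis i, B.basis j⁆ = y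
  induction B.basis.mem_span y using Submodule.span_induction with
  | mem y hy =>
    obtain ⟨l, rfl⟩ := hy
    exact Submodule.subset_span ⟨l, rfl⟩
  | zero => rw [TensorProduct.tmul_zero, smul_zero, map_zero]; exact zero_mem _
  | add y z _ _ hy hz => rw [TensorProduct.tmul_add, smul_add, map_add]; exact add_mem hy hz
  | smul a y _ hy =>
    rw [TensorProduct.tmul_smul, ← algebraMap_smul K a, smul_comm,
      map_smul (UniversalEnvelopingAlgebra.ι K : K ⊗[A] g →ₗ⁅K⁆ UK A K g)]
    exact Submodule.smul_mem _ (⟨_, hA a⟩ : R) hy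

lemma gen_mul_gen_sub_mem_field (c : K) (i j : b.support ⊕ ι) :
    B.gen c i * B.gen c j - B.gen c j * B.gen c i ∈ Submodule.span K (Set.range (B.gen c)) := by
  -- The field itself is the valuation ring `⊤`.
  have h := B.gen_mul_gen_sub_mem (R := ⊤) (fun _ => Subring.mem_top _) (Subring.mem_top c) i j
  generalize B.gen c i * B.gen c j - B.gen c j * B.gen c i = y at h ⊢
  induction h using Submodule.span_induction with
  | mem y hy => exact Submodule.subset_span hy
  | zero => exact zero_mem _
  | add y z _ _ hy hz => exact add_mem hy hz
  | smul a y _ hy => exact Submodule.smul_mem _ (a : K) hy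

section Stable

variable {V : Type*} [AddCommGroup V] [Module (UK A K g) V]

/-- Applied below to lattices of vectors, to lattices of sequences of vectors, and to lattices in
`U(g_K)` itself. -/
lemma gammaZero_smul_mem {R : ValuationSubring K} [Module R V] [IsScalarTower R (UK A K g) V]
    {p n : ℕ} {T : Submodule R V} (hT : ∀ i, ∀ w ∈ T, B.gen ((p : K) ^ n) i • w ∈ T)
    (hA : ∀ a, algebraMap A K a ∈ R) {u : UK A K g} (hu : u ∈ gammaZero R g p n) {w : V}
    (hw : w ∈ T) : u • w ∈ T := by
  induction hu using Subring.closure_induction generalizing w with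
  | mem u hu =>
    rcases hu with ⟨c, hc, rfl⟩ | ⟨y, hy, rfl⟩
    · have h : algebraMap K (UK A K g) c • w = (⟨c, hc⟩ : R) • w := by
        rw [← algebraMap_smul (UK A K g) (⟨c, hc⟩ : R) w]
        rfl
      rw [h]
      exact Submodule.smul_mem _ _ hw
    · induction hy using AddSubgroup.closure_induction with
      | mem y hy =>
        obtain ⟨c, hc, y, rfl⟩ := hy
        induction B.basis.mem_span y using Submodule.span_induction generalizing c with
        | mem y hy =>
          obtain ⟨l, rfl⟩ := hy
          have h : UniversalEnvelopingAlgebra.ι K ((p : K) ^ n • c ⊗ₜ[A] B.basis l) =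
              (⟨c, hc⟩ : R) • B.gen ((p : K) ^ n) l := by
            have h1 : c ⊗ₜ[A] B.basis l = c • ((1 : K) ⊗ₜ[A] B.basis l) := by
              rw [TensorProduct.smul_tmul', smul_eq_mul, mul_one]
            rw [h1, smul_comm, map_smul (UniversalEnvelopingAlgebra.ι K : K ⊗[A] g →ₗ⁅K⁆ UK A K g)]
            rfl
          rw [h, smul_assoc]
          exact Submodule.smul_mem _ _ (hT l w hw)
        | zero => rw [TensorProduct.tmul_zero, smul_zero, map_zero, zero_smul]; exact zero_mem _
        | add y z _ _ hy hz =>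
          rw [TensorProduct.tmul_add, smul_add, map_add, add_smul]
          exact add_mem (hy c hc) (hz c hc)
        | smul a y _ hy =>
          rw [← TensorProduct.smul_tmul, Algebra.smul_def]
          exact hy _ (mul_mem (hA a) hc)
      | zero => rw [smul_zero, map_zero, zero_smul]; exact zero_mem _
      | add y z _ _ hy hz => rw [smul_add, map_add, add_smul]; exact add_mem hy hz
      | neg y _ hy => rw [smul_neg, map_neg, neg_smul]; exact neg_mem hy
  | zero => rw [zero_smul]; exact zero_mem _
  | one => rwa [one_smul]
  | add u v _ _ hu hv => rw [add_smul]; exact add_mem (hu hw) (hv hw)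
  | neg u _ hu => rw [neg_smul]; exact neg_mem (hu hw)
  | mul u v _ _ hu hv => rw [mul_smul]; exact hu (hv hw)

variable [Module K V] [IsScalarTower K (UK A K g) V]

lemma smul_mem_of_gen {T : Submodule K V} {c : K} (hc : c ≠ 0) (hT : ∀ i, ∀ w ∈ T, B.gen c i • w ∈ T)
    (u : UK A K g) {w : V} (hw : w ∈ T) : u • w ∈ T := by
  have hu : u ∈ Algebra.adjoin K (Set.range (UniversalEnvelopingAlgebra.ι K : K ⊗[A] g → _)) := by
    rw [adjoin_range_ι_eq_top]; trivial
  induction hu using Algebra.adjoin_induction generalizing w with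
  | mem u hu =>
    obtain ⟨y, rfl⟩ := hu
    induction (B.basis.baseChange K).mem_span y using Submodule.span_induction with
    | mem y hy =>
      obtain ⟨l, rfl⟩ := hy
      have h : B.gen c l = c • UniversalEnvelopingAlgebra.ι K (B.basis.baseChange K l) := by
        rw [Module.Basis.baseChange_apply]
        exact map_smul (UniversalEnvelopingAlgebra.ι K : K ⊗[A] g →ₗ⁅K⁆ UK A K g) _ _
      have h1 := hT l w hw
      rw [h, smul_assoc] at h1
      exact (Submodule.smul_mem_iff _ hc).1 h1
    | zero => rw [map_zero, zero_smul]; exact zero_mem _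
    | add y z _ _ hy hz => rw [map_add, add_smul]; exact add_mem hy hz
    | smul a y _ hy =>
      rw [map_smul (UniversalEnvelopingAlgebra.ι K : K ⊗[A] g →ₗ⁅K⁆ UK A K g), smul_assoc]
      exact Submodule.smul_mem _ _ hy
  | algebraMap a => rw [algebraMap_smul]; exact Submodule.smul_mem _ _ hw
  | add u v _ _ hu hv => rw [add_smul]; exact add_mem (hu hw) (hv hw)
  | mul u v _ _ hu hv => rw [mul_smul]; exact hu (hv hw)

lemma H_smul_gen_prod_smul (c : K) (x : K ⊗[A] B.cartan) {s : K} {w : V}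
    (hw : B.H K x • w = s • w) (l : List (b.support ⊕ ι)) :
    B.H K x • (l.map (B.gen c)).prod • w =
      (s + (l.map fun i => B.genWeight K i x).sum) • (l.map (B.gen c)).prod • w := by
  induction l with
  | nil => simpa using hw
  | cons i l ih =>
    rw [List.map_cons, List.prod_cons, mul_smul, ← mul_smul, H_mul_gen, add_smul, mul_smul, ih,
      smul_assoc, smul_comm (B.gen c i), ← add_smul, List.map_cons, List.sum_cons]
    congr 1
    ring

end Stable

end ChevalleyBasis

/-! ### Highest-weight modules -/

namespace ChevalleyBasis

variable {ι k X Y : Type*} [Field k] [CharZero k] [AddCommGroup X] [Module k X]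
  [AddCommGroup Y] [Module k Y] {P : RootPairing ι k X Y} [P.IsCrystallographic]
  {b : P.Base} {A g : Type*} [CommRing A] [LieRing g] [LieAlgebra A g]
  (B : ChevalleyBasis b A g) {K : Type*} [Field K] [Algebra A K]

attribute [local instance] LieRing.ofAssociativeRing

/-- A highest-weight vector of weight `μ` which generates the module. -/
structure IsHighestWeightGenerator {V : Type*} [AddCommGroup V] [Module (UK A K g) V]
    [Module K V] (μ : B.Weight K) (v : V) : Prop where
  H_smul : ∀ x, B.H K x • v = μ x • v
  E_smul : ∀ β, b.IsPos β → B.E K β • v = 0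
  exists_smul_eq : ∀ w : V, ∃ u : UK A K g, u • v = w

lemma isHighestWeightGenerator_verma (μ : B.Weight K) :
    B.IsHighestWeightGenerator μ (Submodule.Quotient.mk 1 : B.Verma μ) where
  H_smul x := by
    rw [← Submodule.Quotient.mk_smul, ← sub_eq_zero, ← algebraMap_smul (UK A K g) (μ x),
      ← Submodule.Quotient.mk_smul, ← Submodule.Quotient.mk_sub, Submodule.Quotient.mk_eq_zero]
    refine Submodule.subset_span (Or.inr ⟨x, ?_⟩)
    rw [smul_eq_mul, smul_eq_mul, mul_one, mul_one]
    rfl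
  E_smul β hβ := by
    rw [← Submodule.Quotient.mk_smul, Submodule.Quotient.mk_eq_zero]
    refine Submodule.subset_span (Or.inl ⟨β, hβ, ?_⟩)
    rw [smul_eq_mul, mul_one]
    rfl
  exists_smul_eq w := by
    obtain ⟨u, rfl⟩ := Submodule.Quotient.mk_surjective _ w
    exact ⟨u, by rw [← Submodule.Quotient.mk_smul, smul_eq_mul, mul_one]⟩

/-- The highest-weight vector of `L(μ)`. -/
def irredVector (μ : B.Weight K) : B.Irred μ :=
  Submodule.Quotient.mk (Submodule.Quotient.mk 1 : B.Verma μ)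

lemma isHighestWeightGenerator_irred (μ : B.Weight K) :
    B.IsHighestWeightGenerator μ (B.irredVector μ) where
  H_smul x := by
    rw [irredVector, ← Submodule.Quotient.mk_smul,
      (B.isHighestWeightGenerator_verma μ).H_smul, ← algebraMap_smul (UK A K g) (μ x),
      ← algebraMap_smul (UK A K g) (μ x), Submodule.Quotient.mk_smul]
  E_smul β hβ := by
    rw [irredVector, ← Submodule.Quotient.mk_smul,
      (B.isHighestWeightGenerator_verma μ).E_smul β hβ, Submodule.Quotient.mk_zero]
  exists_smul_eq w := by
    obtain ⟨w, rfl⟩ := Submodule.Quotient.mk_surjective _ w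
    obtain ⟨u, rfl⟩ := (B.isHighestWeightGenerator_verma μ).exists_smul_eq w
    exact ⟨u, rfl⟩

section Lower

variable {V : Type*} [AddCommGroup V] [Module (UK A K g) V] [Module K V]
  [IsScalarTower K (UK A K g) V]

/-- The span of the eigenvectors of `x ∈ h_K` with eigenvalues `s - 1`, `s - 2`, …. -/
def lowerSpace (V : Type*) [AddCommGroup V] [Module (UK A K g) V] [Module K V]
    (x : K ⊗[A] B.cartan) (s : K) : Submodule K V :=
  Submodule.span K {w | ∃ d : ℕ, 0 < d ∧ B.H K x • w = (s - d) • w}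

lemma aeval_smul_of_smul_eq {U : Type*} [Ring U] [Algebra K U] [Module U V] [IsScalarTower K U V]
    {h : U} {s : K} {v : V} (hv : h • v = s • v) (q : Polynomial K) :
    Polynomial.aeval h q • v = q.eval s • v := by
  induction q using Polynomial.induction_on' with
  | add p q hp hq => rw [map_add, add_smul, hp, hq, Polynomial.eval_add, add_smul]
  | monomial n a =>
    rw [Polynomial.aeval_monomial, Polynomial.eval_monomial, mul_smul, mul_smul, algebraMap_smul]
    congr 1
    induction n with
    | zero => simp
    | succ n ih => rw [pow_succ', mul_smul, ih, smul_comm, hv, pow_succ, mul_smul]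

/-- A product of factors `X - (s - d)` with `d > 0` kills `w`, and in characteristic zero it does
not vanish at `s`. This separates the highest-weight line from `lowerSpace`. -/
lemma exists_aeval_smul_eq_zero [CharZero K] {x : K ⊗[A] B.cartan} {s : K} {w : V}
    (hw : w ∈ B.lowerSpace V x s) :
    ∃ q : Polynomial K, q.eval s ≠ 0 ∧ Polynomial.aeval (B.H K x) q • w = 0 := by
  induction hw using Submodule.span_induction with
  | mem w hw =>
    obtain ⟨d, hd, hw⟩ := hw
    refine ⟨Polynomial.X - Polynomial.C (s - d), ?_, ?_⟩
    · simpa using hd.ne'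
    · rw [aeval_smul_of_smul_eq hw]
      simp
  | zero => exact ⟨1, by simp⟩
  | add w w' _ _ h h' =>
    obtain ⟨q, hq, h⟩ := h
    obtain ⟨q', hq', h'⟩ := h'
    refine ⟨q * q', by simp [hq, hq'], ?_⟩
    rw [smul_add, map_mul, mul_smul, mul_smul, h', smul_zero, add_zero, ← mul_smul, ← map_mul,
      mul_comm, map_mul, mul_smul, h, smul_zero]
  | smul a w _ h =>
    obtain ⟨q, hq, h⟩ := h
    exact ⟨q, hq, by rw [smul_comm, h, smul_zero]⟩

lemma notMem_lowerSpace [CharZero K] {x : K ⊗[A] B.cartan} {s : K} {v : V}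
    (hv : B.H K x • v = s • v) (hv0 : v ≠ 0) : v ∉ B.lowerSpace V x s := by
  intro h
  obtain ⟨q, hq, h⟩ := B.exists_aeval_smul_eq_zero h
  rw [aeval_smul_of_smul_eq hv] at h
  exact hv0 ((smul_eq_zero.1 h).resolve_left hq)

lemma H_smul_mem_lowerSpace (x y : K ⊗[A] B.cartan) {s : K} {w : V}
    (hw : w ∈ B.lowerSpace V x s) : B.H K y • w ∈ B.lowerSpace V x s := by
  induction hw using Submodule.span_induction with
  | mem w hw =>
    obtain ⟨d, hd, hw⟩ := hw
    refine Submodule.subset_span ⟨d, hd, ?_⟩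
    rw [← mul_smul, H_mul_H, mul_smul, hw, smul_comm]
  | zero => rw [smul_zero]; exact zero_mem _
  | add w w' _ _ h h' => rw [smul_add]; exact add_mem h h'
  | smul c w _ h => rw [smul_comm]; exact Submodule.smul_mem _ c h

lemma sum_genWeight_eq_neg {x : K ⊗[A] B.cartan} {deg : ι → ℤ}
    (hx : ∀ β, B.rootWeight K β x = deg β) (l : List (b.support ⊕ ι))
    (hl : ∀ i ∈ l, i ∈ Sum.inr '' {β | deg β < 0}) :
    ∃ d : ℕ, l.length ≤ d ∧ (l.map fun i => B.genWeight K i x).sum = -(d : K) := by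
  induction l with
  | nil => exact ⟨0, by simp⟩
  | cons i l ih =>
    obtain ⟨d, hd, h⟩ := ih fun i hi => hl i (List.mem_cons_of_mem _ hi)
    obtain ⟨β, hβ, rfl⟩ := hl i List.mem_cons_self
    have hβ : deg β < 0 := hβ
    refine ⟨d + (-deg β).toNat, ?_, ?_⟩
    · rw [List.length_cons]
      omega
    · rw [List.map_cons, List.sum_cons, h, Nat.cast_add, ← Int.cast_natCast (-deg β).toNat,
        Int.toNat_of_nonneg (by omega)]
      change B.rootWeight K β x + _ = _
      rw [hx]
      push_cast
      ring

variable {B} in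
-- Words in negative root vectors applied to `v` span the module, and each non-empty one lowers the
-- eigenvalue of `x` by a positive integer.
lemma IsHighestWeightGenerator.sup_lowerSpace_eq_top {μ : B.Weight K} {v : V}
    (hv : B.IsHighestWeightGenerator μ v) {x : K ⊗[A] B.cartan}
    (hx : ∀ β, B.rootWeight K β x = b.height β) :
    Submodule.span K {v} ⊔ B.lowerSpace V x (μ x) = ⊤ := by
  set J : Set (b.support ⊕ ι) := Sum.inr '' {β | b.height β < 0} with hJ
  have h1 : descendants (B.gen (1 : K)) J (Submodule.span K {v}) = ⊤ := by
    refine eq_top_iff.2 fun w _ => ?_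
    obtain ⟨u, rfl⟩ := hv.exists_smul_eq w
    refine B.smul_mem_of_gen one_ne_zero (fun i w hw => smul_mem_descendants
      (B.gen_mul_gen_sub_mem_field 1) ?_ i hw) u (le_descendants _ _ _
        (Submodule.mem_span_singleton_self v))
    intro i hi w hw
    obtain ⟨a, rfl⟩ := Submodule.mem_span_singleton.1 hw
    rw [smul_comm]
    refine Submodule.smul_mem _ _ ?_
    cases i with
    | inl δ =>
      rw [gen_inl, one_smul, hv.H_smul]
      exact Submodule.smul_mem _ _ (Submodule.mem_span_singleton_self v)
    | inr β =>
      have hβ : b.IsPos β := by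
        refine b.isPos_iff'.2 (not_lt.1 fun h => hi ⟨β, h, rfl⟩)
      rw [gen_inr, one_smul, hv.E_smul β hβ]
      exact zero_mem _
  rw [← h1]
  refine le_antisymm (h1 ▸ le_top) (Submodule.span_le.2 ?_)
  rintro w ⟨l, hl, w, hw, rfl⟩
  obtain ⟨a, rfl⟩ := Submodule.mem_span_singleton.1 hw
  rw [smul_comm]
  refine Submodule.smul_mem _ _ ?_
  cases l with
  | nil =>
    rw [List.map_nil, List.prod_nil, one_smul]
    exact Submodule.mem_sup_left (Submodule.mem_span_singleton_self v)
  | cons i l =>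
    obtain ⟨d, hd, h⟩ := B.sum_genWeight_eq_neg hx (i :: l) hl
    refine Submodule.mem_sup_right (Submodule.subset_span ⟨d, ?_, ?_⟩)
    · rw [List.length_cons] at hd
      omega
    · rw [B.H_smul_gen_prod_smul 1 x (hv.H_smul x), h, sub_eq_add_neg]

variable {B} in
-- If `w` had a component along `v`, a polynomial in `H x` killing its lower part would leave a
-- non-zero multiple of the generator `v` in `N`.
lemma IsHighestWeightGenerator.mem_lowerSpace [CharZero K] {μ : B.Weight K} {v : V}
    (hv : B.IsHighestWeightGenerator μ v) {x : K ⊗[A] B.cartan}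
    (hx : ∀ β, B.rootWeight K β x = b.height β) {N : Submodule (UK A K g) V} (hN : N ≠ ⊤) {w : V}
    (hw : w ∈ N) : w ∈ B.lowerSpace V x (μ x) := by
  have h1 : w ∈ Submodule.span K {v} ⊔ B.lowerSpace V x (μ x) := by
    rw [hv.sup_lowerSpace_eq_top hx]; trivial
  obtain ⟨y, hy, z, hz, rfl⟩ := Submodule.mem_sup.1 h1
  obtain ⟨a, rfl⟩ := Submodule.mem_span_singleton.1 hy
  by_cases ha : a = 0
  · rwa [ha, zero_smul, zero_add]
  exfalso
  obtain ⟨q, hq, h⟩ := B.exists_aeval_smul_eq_zero hz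
  have h2 := N.smul_mem (Polynomial.aeval (B.H K x) q) hw
  rw [smul_add, h, add_zero, smul_comm, aeval_smul_of_smul_eq (hv.H_smul x), smul_smul,
    ← algebraMap_smul (UK A K g)] at h2
  have h3 := N.smul_mem (algebraMap K (UK A K g) (a * q.eval (μ x))⁻¹) h2
  rw [← mul_smul, ← map_mul, inv_mul_cancel₀ (mul_ne_zero ha hq), map_one, one_smul] at h3
  refine hN (eq_top_iff.2 fun w _ => ?_)
  obtain ⟨u, rfl⟩ := hv.exists_smul_eq w
  exact N.smul_mem u h3

variable {B} in
-- Any functional that vanishes on `lowerSpace` and is normalised at `v` will do, because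
-- `lowerSpace` is stable under `h_K`.
lemma IsHighestWeightGenerator.exists_functional [CharZero K] {μ : B.Weight K} {v : V}
    (hv : B.IsHighestWeightGenerator μ v) (hv0 : v ≠ 0) {x : K ⊗[A] B.cartan}
    (hx : ∀ β, B.rootWeight K β x = b.height β) :
    ∃ χ : V →ₗ[K] K, χ v = 1 ∧ ∀ y w, χ (B.H K y • w) = μ y * χ w := by
  obtain ⟨f, hf, hfl⟩ := Submodule.exists_le_ker_of_notMem
    (B.notMem_lowerSpace (hv.H_smul x) hv0)
  refine ⟨(f v)⁻¹ • f, inv_mul_cancel₀ hf, fun y w => ?_⟩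
  have h1 : w ∈ Submodule.span K {v} ⊔ B.lowerSpace V x (μ x) := by
    rw [hv.sup_lowerSpace_eq_top hx]; trivial
  obtain ⟨y', hy, z, hz, rfl⟩ := Submodule.mem_sup.1 h1
  obtain ⟨a, rfl⟩ := Submodule.mem_span_singleton.1 hy
  have h2 : f z = 0 := hfl hz
  have h3 : f (B.H K y • z) = 0 := hfl (B.H_smul_mem_lowerSpace x y hz)
  rw [smul_add, smul_comm, hv.H_smul, LinearMap.smul_apply, LinearMap.smul_apply, map_add, map_add,
    h2, h3, add_zero, add_zero, map_smul, map_smul, map_smul]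
  simp only [smul_eq_mul]
  ring

end Lower

/-- All proper submodules of the Verma module lie in `lowerSpace`, hence so does their sum, while
the highest-weight vector does not. -/
lemma irredVector_ne_zero [Finite ι] [CharZero K] [DecidableEq b.support]
    (hdet : b.cartanMatrix.det ≠ 0) {x : K ⊗[A] B.cartan}
    (hx : ∀ β, B.rootWeight K β x = b.height β) (μ : B.Weight K) : B.irredVector μ ≠ 0 := by
  intro h
  have h1 : (Submodule.Quotient.mk 1 : B.Verma μ) ≠ 0 := by
    rw [Ne, Submodule.Quotient.mk_eq_zero, ← Ideal.eq_top_iff_one]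
    exact B.vermaIdeal_ne_top K hdet μ
  have hv := B.isHighestWeightGenerator_verma μ
  refine B.notMem_lowerSpace (hv.H_smul x) h1 ?_
  rw [irredVector, Submodule.Quotient.mk_eq_zero, vermaRadical, sSup_eq_iSup'] at h
  refine Submodule.iSup_induction _ (motive := fun w => w ∈ B.lowerSpace (B.Verma μ) x (μ x)) h
    (fun N w hw => hv.mem_lowerSpace hx N.2 hw) (zero_mem _) fun _ _ h h' => add_mem h h'

end ChevalleyBasis

section RootData

variable {ι k X Y : Type*} [Field k] [CharZero k] [AddCommGroup X] [Module k X]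
  [AddCommGroup Y] [Module k Y] {P : RootPairing ι k X Y} (b : P.Base)

lemma rootCoeff_self {i : ι} (hi : i ∈ b.support) : rootCoeff b i i = 1 := by
  classical
  have h1 : P.root i = ∑ j ∈ b.support, (Pi.single i 1 : ι → ℤ) j • P.root j := by
    rw [Finset.sum_eq_single_of_mem i hi (by simp_all)]; simp
  have h2 : ∑ j ∈ b.support, rootCoeff b i j • P.root j =
      ∑ j ∈ b.support, (Pi.single i 1 : ι → ℤ) j • P.root j := by
    rw [← root_eq_sum_rootCoeff, ← h1]
  rw [b.support.sum_subtype (p := (· ∈ b.support)) (by simp) (F := inferInstance),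
    b.support.sum_subtype (p := (· ∈ b.support)) (by simp) (F := inferInstance)] at h2
  have h3 := Fintype.linearIndependent_iffₛ.mp (b.linearIndepOn_root.restrict_scalars' ℤ)
    (rootCoeff b i ∘ (↑)) ((Pi.single i 1 : ι → ℤ) ∘ (↑)) (by simpa using h2) ⟨i, hi⟩
  simpa using h3

lemma leviDegree_self {i : ι} (hi : i ∈ b.support) : leviDegree b i i = 0 := by
  rw [leviDegree, b.height_one_of_mem_support hi, rootCoeff_self b hi, sub_self]

end RootData

/-! ### The α-string through the highest-weight vector -/

namespace ChevalleyBasis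

variable {ι k X Y : Type*} [Field k] [CharZero k] [AddCommGroup X] [Module k X]
  [AddCommGroup Y] [Module k Y] {P : RootPairing ι k X Y} [P.IsCrystallographic]
  {b : P.Base} {A g : Type*} [CommRing A] [LieRing g] [LieAlgebra A g]
  (B : ChevalleyBasis b A g) {K : Type*} [Field K] [Algebra A K]

attribute [local instance] LieRing.ofAssociativeRing

/-- A module generated by a highest-weight vector of weight `μ`, whose pairing with the coroot of
the simple root `α` is not a natural number, with its projection to the highest-weight line. -/
structure StringDatum (μ : B.Weight K) (α : b.support) (V : Type*) [AddCommGroup V]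
    [Module (UK A K g) V] [Module K V] where
  v : V
  isGen : B.IsHighestWeightGenerator μ v
  χ : V →ₗ[K] K
  χ_v : χ v = 1
  χ_H : ∀ y w, χ (B.H K y • w) = μ y * χ w
  h₀ : K ⊗[A] B.cartan
  h₁ : K ⊗[A] B.cartan
  rootWeight_h₀ : ∀ β, B.rootWeight K β h₀ = b.height β
  rootWeight_h₁ : ∀ β, B.rootWeight K β h₁ = leviDegree b α β
  pairing_ne : ∀ m : ℕ, B.pairingCoroot μ α ≠ m

namespace StringDatum

variable {B} {μ : B.Weight K} {α : b.support} {V : Type*} [AddCommGroup V] [Module (UK A K g) V]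
  [Module K V] [IsScalarTower K (UK A K g) V] (D : B.StringDatum μ α V)

/-- The root vector of the root `-α`. -/
def f (_ : B.StringDatum μ α V) : UK A K g := B.E K (P.reflectionPerm α α)

lemma H_smul_f_pow (y : K ⊗[A] B.cartan) (m : ℕ) :
    B.H K y • D.f ^ m • D.v = (μ y - m * B.rootWeight K α y) • D.f ^ m • D.v := by
  induction m with
  | zero => simpa using D.isGen.H_smul y
  | succ m ih =>
    rw [pow_succ', mul_smul, ← mul_smul, f, H_mul_E, rootWeight_neg, add_smul, mul_smul]
    change D.f • B.H K y • D.f ^ m • D.v + ((-B.rootWeight K α) y • D.f) • D.f ^ m • D.v =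
      _ • D.f • D.f ^ m • D.v
    rw [ih, smul_comm, smul_assoc, ← add_smul]
    congr 1
    rw [LinearMap.neg_apply]
    push_cast
    ring

/-- The usual sl₂ computation. The factor `⟨μ, α^∨⟩ - m` is never zero for natural `m`, but as a
polynomial in `m` it has the root from which the weight `s_α · μ` arises. -/
lemma E_smul_f_pow_succ (m : ℕ) :
    B.E K α • D.f ^ (m + 1) • D.v =
      ((m + 1) * (B.pairingCoroot μ α - m)) • D.f ^ m • D.v := by
  have h1 : ∀ w : V, B.E K α • D.f • w =
      D.f • B.E K α • w + B.H K (1 ⊗ₜ B.hCartan α) • w := by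
    intro w
    rw [← mul_smul, f, E_mul_F, add_smul, mul_smul]
  have h2 : B.rootWeight K α (1 ⊗ₜ B.hCartan α) = 2 := by
    rw [rootWeight_hCartan, P.pairingIn_same]
    norm_num
  induction m with
  | zero =>
    rw [zero_add, pow_one, h1, D.isGen.E_smul _ (b.isPos_of_mem_support α.2), smul_zero, zero_add,
      D.isGen.H_smul]
    simp [pairingCoroot]
  | succ m ih =>
    rw [pow_succ', mul_smul, h1, ih, smul_comm, ← mul_smul, ← pow_succ', H_smul_f_pow, ← add_smul,
      h2]
    congr 1
    rw [pairingCoroot]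
    push_cast
    ring

/-- Bracketing with `e_{-α}` preserves the Levi degree, so moving `e_β` past `f` only produces root
vectors of the same positive degree. -/
lemma E_smul_f_pow [CharZero K] (m : ℕ) : ∀ β, 0 < leviDegree b α β →
    B.E K β • D.f ^ m • D.v = 0 := by
  induction m with
  | zero =>
    intro β hβ
    rw [pow_zero, one_smul]
    exact D.isGen.E_smul β (by
      by_contra h
      exact absurd (leviDegree_nonpos b α.2 h) (not_le.2 hβ))
  | succ m ih =>
    intro β hβ
    rw [pow_succ', mul_smul, ← mul_smul]
    have h0 : P.root β + P.root (P.reflectionPerm α α) ≠ 0 := by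
      rw [P.root_reflectionPerm, P.reflection_apply_self, ← sub_eq_add_neg, sub_ne_zero]
      intro h
      rw [P.root.injective h, leviDegree_self b α.2] at hβ
      exact lt_irrefl _ hβ
    by_cases h : P.root β + P.root (P.reflectionPerm α α) ∈ Set.range P.root
    · obtain ⟨γ, hγ⟩ := h
      have h1 : leviDegree b α γ = leviDegree b α β := by
        have h2 := congrArg (fun w : B.Weight K => w D.h₁) (B.rootWeight_add K hγ.symm)
        simp only [LinearMap.add_apply, rootWeight_neg, LinearMap.neg_apply, D.rootWeight_h₁,
          leviDegree_self b α.2] at h2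
        simpa using h2
      rw [f, E_mul_E B hγ.symm, add_smul, mul_smul, smul_assoc]
      change D.f • B.E K β • D.f ^ m • D.v + _ • B.E K γ • D.f ^ m • D.v = 0
      rw [ih β hβ, ih γ (h1 ▸ hβ), smul_zero, smul_zero, add_zero]
    · rw [f, E_mul_E_of_notMem B h0 h, mul_smul]
      change D.f • B.E K β • D.f ^ m • D.v = 0
      rw [ih β hβ, smul_zero]

/-- The scalar by which `e_α^m e_{-α}^m` acts on the highest-weight vector. -/
def norm (_ : B.StringDatum μ α V) (m : ℕ) : K :=
  ∏ i ∈ Finset.range m, ((i + 1 : K) * (B.pairingCoroot μ α - i))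

lemma norm_ne_zero [CharZero K] (m : ℕ) : D.norm m ≠ 0 := by
  refine Finset.prod_ne_zero_iff.2 fun i _ => mul_ne_zero ?_ (sub_ne_zero.2 (D.pairing_ne i))
  exact_mod_cast Nat.succ_ne_zero i

lemma E_pow_smul_f_pow (m : ℕ) : B.E K α ^ m • D.f ^ m • D.v = D.norm m • D.v := by
  induction m with
  | zero => simp [norm]
  | succ m ih =>
    rw [pow_succ (B.E K α), mul_smul, E_smul_f_pow_succ, smul_comm, ih, smul_smul, norm, norm,
      Finset.prod_range_succ, mul_comm]

lemma E_pow_mul_H (y : K ⊗[A] B.cartan) (m : ℕ) :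
    B.E K α ^ m * B.H K y = B.H K y * B.E K α ^ m - (m * B.rootWeight K α y) • B.E K α ^ m := by
  induction m with
  | zero => simp
  | succ m ih =>
    rw [pow_succ', mul_assoc, ih, mul_sub, ← mul_assoc, mul_smul_comm, ← mul_assoc (B.H K y),
      H_mul_E, add_mul, smul_mul_assoc]
    push_cast
    module

variable (c : K)

/-- The coefficient of `(c e_{-α})^m v`, as a functional. -/
def ξ (m : ℕ) : V →ₗ[K] K :=
  (c ^ m * D.norm m)⁻¹ • D.χ ∘ₗ Algebra.lsmul K K V (B.E K α ^ m)

lemma ξ_apply (m : ℕ) (w : V) : D.ξ c m w = (c ^ m * D.norm m)⁻¹ * D.χ (B.E K α ^ m • w) := rfl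

lemma ξ_H_smul (m : ℕ) (y : K ⊗[A] B.cartan) (w : V) :
    D.ξ c m (B.H K y • w) = (μ y - m * B.rootWeight K α y) * D.ξ c m w := by
  rw [ξ_apply, ξ_apply, ← mul_smul, E_pow_mul_H, sub_smul, mul_smul, map_sub, D.χ_H, smul_assoc,
    LinearMap.map_smul, smul_eq_mul]
  ring

/-- `ξ m` has weight `μ - m α`, so it kills eigenvectors with any other eigenvalue. -/
lemma ξ_eq_zero {m : ℕ} {y : K ⊗[A] B.cartan} {s : K} {w : V} (hw : B.H K y • w = s • w)
    (hs : s ≠ μ y - m * B.rootWeight K α y) : D.ξ c m w = 0 := by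
  have h := D.ξ_H_smul c m y w
  rw [hw, map_smul, smul_eq_mul, ← sub_eq_zero, ← sub_mul] at h
  exact (mul_eq_zero.1 h).resolve_left (sub_ne_zero.2 hs)

/-- The vector `(c e_{-α})^m v`. -/
def Fv (m : ℕ) : V := c ^ m • D.f ^ m • D.v

lemma H_smul_Fv (y : K ⊗[A] B.cartan) (m : ℕ) :
    B.H K y • D.Fv c m = (μ y - m * B.rootWeight K α y) • D.Fv c m := by
  rw [Fv, smul_comm, H_smul_f_pow, smul_comm]

lemma ξ_Fv [CharZero K] (hc : c ≠ 0) (m l : ℕ) :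
    D.ξ c m (D.Fv c l) = if l = m then 1 else 0 := by
  split_ifs with h
  · subst h
    rw [ξ_apply, Fv, smul_comm, E_pow_smul_f_pow, map_smul, map_smul, D.χ_v, smul_eq_mul,
      smul_eq_mul, mul_one]
    exact inv_mul_cancel₀ (mul_ne_zero (pow_ne_zero _ hc) (D.norm_ne_zero l))
  · refine D.ξ_eq_zero c (D.H_smul_Fv c D.h₀ l) ?_
    rw [D.rootWeight_h₀, b.height_one_of_mem_support α.2]
    simpa using h

lemma gen_smul_Fv_zero [CharZero K] {β : ι} (hβ : 0 < leviDegree b α β) (m : ℕ) :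
    B.E K β • D.Fv c m = 0 := by
  rw [Fv, smul_comm, E_smul_f_pow D m β hβ, smul_zero]

/-- For `m = 0` the truncated `m - 1` is harmless because the coefficient is zero. -/
lemma E_smul_Fv (m : ℕ) :
    B.E K α • D.Fv c m = (m * c * (B.pairingCoroot μ α - m + 1)) • D.Fv c (m - 1) := by
  cases m with
  | zero => simp [Fv, D.isGen.E_smul _ (b.isPos_of_mem_support α.2)]
  | succ m =>
    rw [Fv, Fv, smul_comm, E_smul_f_pow_succ, smul_smul, smul_smul, Nat.add_sub_cancel]
    congr 1
    push_cast
    ring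

lemma f_smul_Fv (m : ℕ) : (c • D.f) • D.Fv c m = D.Fv c (m + 1) := by
  rw [Fv, Fv, smul_assoc, smul_comm D.f, ← mul_smul D.f, ← pow_succ', smul_smul, ← pow_succ']

end StringDatum

end ChevalleyBasis

/-! ### Integrality and polynomiality along the string -/

namespace ChevalleyBasis

variable {ι k X Y : Type*} [Field k] [CharZero k] [AddCommGroup X] [Module k X]
  [AddCommGroup Y] [Module k Y] {P : RootPairing ι k X Y} [P.IsCrystallographic]
  {b : P.Base} {A g : Type*} [CommRing A] [LieRing g] [LieAlgebra A g]
  {B : ChevalleyBasis b A g} {K : Type*} [Field K] [Algebra A K]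

attribute [local instance] LieRing.ofAssociativeRing

namespace StringDatum

variable {μ : B.Weight K} {α : b.support} {V : Type*} [AddCommGroup V] [Module (UK A K g) V]
  [Module K V] [IsScalarTower K (UK A K g) V] (D : B.StringDatum μ α V)

open Filter

/-- All `F^m v` have the same eigenvalue under `h₁`, as `α` has Levi degree zero, whereas a
non-empty word of negative Levi degree lowers it. -/
lemma ξ_gen_prod_smul_eq_zero [CharZero K] (c : K) {l : List (b.support ⊕ ι)} (hl0 : l ≠ [])
    (hl : ∀ i ∈ l, i ∈ Sum.inr '' {β | leviDegree b α β < 0}) {w : V}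
    (hw : B.H K D.h₁ • w = μ D.h₁ • w) (m : ℕ) : D.ξ c m ((l.map (B.gen c)).prod • w) = 0 := by
  obtain ⟨d, hd, h⟩ := B.sum_genWeight_eq_neg D.rootWeight_h₁ l hl
  refine D.ξ_eq_zero c (B.H_smul_gen_prod_smul c D.h₁ hw l) ?_
  have hd0 : d ≠ 0 := by
    have := List.length_pos_iff.2 hl0
    omega
  rw [h, D.rootWeight_h₁, leviDegree_self b α.2]
  simpa using hd0

lemma H_h₁_smul_Fv (c : K) (m : ℕ) : B.H K D.h₁ • D.Fv c m = μ D.h₁ • D.Fv c m := by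
  rw [D.H_smul_Fv, D.rootWeight_h₁, leviDegree_self b α.2]
  simp

variable {R : ValuationSubring K} [Module R V] [IsScalarTower R K V] [IsScalarTower R (UK A K g) V]

omit [Module (UK A K g) V] [IsScalarTower K (UK A K g) V] [IsScalarTower R (UK A K g) V] in
lemma valuationSubring_smul_eq (a : R) (w : V) : a • w = (a : K) • w :=
  (algebraMap_smul K a w).symm

/-- Scaling the generators by `c` makes the coefficients polynomials in `c l` over `R`: for `h_δ`
one gets `c ⟨μ, δ^∨⟩ - ⟨α, δ^∨⟩ (c l)`, for `e_α` one gets `(c l) (c ⟨μ, α^∨⟩ + c - c l)`.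
Truncation by `toNat` occurs only for `e_α` at `l = 0`, where the coefficient vanishes. -/
lemma exists_gen_smul_Fv [CharZero K] [Finite ι] {c : R}
    (hμ : ∀ δ, (c : K) * B.pairingCoroot μ δ ∈ R) {i : b.support ⊕ ι}
    (hi : i ∉ Sum.inr '' {β | leviDegree b α β < 0}) :
    ∃ (d : ℤ) (Q : Polynomial R), ∀ l : ℕ, B.gen (c : K) i • D.Fv c l =
      Q.eval (c * l) • D.Fv c (l + d).toNat := by
  cases i with
  | inl δ =>
    refine ⟨0, .C ⟨_, hμ δ⟩ - .C ((P.pairingIn ℤ α δ : ℤ) : R) * .X, fun l => ?_⟩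
    rw [gen_inl, smul_assoc, D.H_smul_Fv, smul_smul, rootWeight_hCartan,
      valuationSubring_smul_eq]
    congr 1
    · simp only [Polynomial.eval_sub, Polynomial.eval_mul, Polynomial.eval_C, Polynomial.eval_X]
      push_cast
      rw [pairingCoroot]
      ring
  | inr β =>
    have hβ : 0 ≤ leviDegree b α β := not_lt.1 fun h => hi ⟨β, h, rfl⟩
    rcases hβ.lt_or_eq with hβ | hβ
    · refine ⟨0, 0, fun l => ?_⟩
      rw [gen_inr, smul_assoc, D.gen_smul_Fv_zero _ hβ, smul_zero, Polynomial.eval_zero,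
        valuationSubring_smul_eq]
      exact (zero_smul K _).symm
    rcases eq_or_eq_neg_of_leviDegree_eq_zero b α.2 hβ.symm with rfl | rfl
    · refine ⟨-1, .X * (.C (⟨_, hμ α⟩ + c) - .X), fun l => ?_⟩
      rw [gen_inr, smul_assoc, D.E_smul_Fv, smul_smul, valuationSubring_smul_eq]
      congr 1
      · simp only [Polynomial.eval_sub, Polynomial.eval_mul, Polynomial.eval_C, Polynomial.eval_X]
        push_cast
        ring
      · congr 1
        omega
    · refine ⟨1, 1, fun l => ?_⟩
      rw [gen_inr]
      refine (D.f_smul_Fv _ l).trans ?_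
      rw [Polynomial.eval_one, one_smul]
      congr 1

/-- The lattice `N` spanned by the `F^l v` is stable under the generators of non-negative Levi
degree, so `Γ₀ v` is contained in the span of words of negative Levi degree applied to `N`. On `N`
the functional is integral, and it kills the non-empty words. -/
lemma ξ_smul_v_mem [CharZero K] [Finite ι] {p n : ℕ} [NeZero p] {c : R} (hc : (c : K) = (p : K) ^ n)
    (hA : ∀ a, algebraMap A K a ∈ R) (hμ : ∀ δ, (c : K) * B.pairingCoroot μ δ ∈ R)
    {u : UK A K g} (hu : u ∈ gammaZero R g p n) (m : ℕ) : D.ξ c m (u • D.v) ∈ R := by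
  have hc0 : (c : K) ≠ 0 := by
    rw [hc]
    exact pow_ne_zero _ (Nat.cast_ne_zero.2 (NeZero.ne p))
  set N : Submodule R V := Submodule.span R (Set.range (D.Fv (c : K))) with hN
  have h1 : ∀ i ∉ Sum.inr '' {β | leviDegree b α β < 0}, ∀ w ∈ N, B.gen (c : K) i • w ∈ N := by
    intro i hi w hw
    obtain ⟨d, Q, h⟩ := D.exists_gen_smul_Fv hμ hi
    induction hw using Submodule.span_induction with
    | mem w hw =>
      obtain ⟨l, rfl⟩ := hw
      rw [h]
      exact Submodule.smul_mem _ _ (Submodule.subset_span ⟨_, rfl⟩)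
    | zero => rw [smul_zero]; exact zero_mem _
    | add w w' _ _ h h' => rw [smul_add]; exact add_mem h h'
    | smul c w _ h => rw [smul_comm]; exact Submodule.smul_mem _ c h
  have h2 : ∀ w ∈ N, D.ξ c m w ∈ R ∧ B.H K D.h₁ • w = μ D.h₁ • w := by
    intro w hw
    induction hw using Submodule.span_induction with
    | mem w hw =>
      obtain ⟨l, rfl⟩ := hw
      refine ⟨?_, D.H_h₁_smul_Fv _ l⟩
      rw [D.ξ_Fv c hc0]
      split_ifs
      exacts [R.one_mem, R.zero_mem]
    | zero => simp [R.zero_mem]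
    | add w w' _ _ h h' =>
      refine ⟨?_, by rw [smul_add, smul_add, h.2, h'.2]⟩
      rw [map_add]
      exact R.add_mem _ _ h.1 h'.1
    | smul a w _ h =>
      refine ⟨?_, ?_⟩
      · rw [← algebraMap_smul K, map_smul]
        exact R.mul_mem _ _ a.2 h.1
      · rw [smul_comm, h.2, ← algebraMap_smul K a, ← algebraMap_smul K a, smul_comm]
  have h3 : u • D.v ∈ descendants (B.gen (c : K)) (Sum.inr '' {β | leviDegree b α β < 0}) N := by
    refine gammaZero_smul_mem B (fun i w hw => ?_) hA hu (le_descendants _ _ _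
      (Submodule.subset_span ⟨0, by simp [Fv]⟩))
    rw [← hc]
    exact smul_mem_descendants (B.gen_mul_gen_sub_mem hA c.2) h1 i hw
  generalize u • D.v = w at h3
  induction h3 using Submodule.span_induction with
  | mem w hw =>
    obtain ⟨l, hl, w, hw, rfl⟩ := hw
    by_cases hl0 : l = []
    · subst hl0
      simpa using (h2 w hw).1
    · rw [D.ξ_gen_prod_smul_eq_zero _ hl0 hl (h2 w hw).2]
      exact R.zero_mem
  | zero => simp [R.zero_mem]
  | add w w' _ _ h h' =>
    rw [map_add]
    exact R.add_mem _ _ h h'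
  | smul a w _ h =>
    rw [← algebraMap_smul K, map_smul]
    exact R.mul_mem _ _ a.2 h

/-- The argument of `ξ_smul_v_mem`, run on sequences with `U(g_K)` acting termwise. Now `N` is
spanned by the sequences `Q(c m) F^(m + d) v`, and `ξ (m + j)` retains the terms with `d = j`.
Restricting to large `m` avoids truncation of `m + d`. -/
lemma exists_polynomial_ξ [CharZero K] [Finite ι] {p n : ℕ} [NeZero p] {c : R}
    (hc : (c : K) = (p : K) ^ n) (hA : ∀ a, algebraMap A K a ∈ R)
    (hμ : ∀ δ, (c : K) * B.pairingCoroot μ δ ∈ R) {u : UK A K g} (hu : u ∈ gammaZero R g p n)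
    (j : ℕ) : ∃ Q : Polynomial R, ∀ᶠ m : ℕ in atTop,
      D.ξ c (m + j) (u • D.Fv c m) = (Q.eval (c * m) : R) := by
  have hc0 : (c : K) ≠ 0 := by
    rw [hc]
    exact pow_ne_zero _ (Nat.cast_ne_zero.2 (NeZero.ne p))
  set N : Submodule R (ℕ → V) := Submodule.span R {w | ∃ (d : ℤ) (Q : Polynomial R),
    ∀ᶠ m : ℕ in atTop, w m = Q.eval (c * m) • D.Fv (c : K) (m + d).toNat} with hN
  have h1 : ∀ i ∉ Sum.inr '' {β | leviDegree b α β < 0}, ∀ w ∈ N, B.gen (c : K) i • w ∈ N := by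
    intro i hi w hw
    obtain ⟨d, Q, h⟩ := D.exists_gen_smul_Fv hμ hi
    induction hw using Submodule.span_induction with
    | mem w hw =>
      obtain ⟨d', Q', hw⟩ := hw
      -- The generator acts on `F^(m + d') v`, so `Q` is evaluated at `c (m + d')`; hence the
      -- substitution.
      refine Submodule.subset_span ⟨d' + d, Q' * Q.comp (.X + .C (c * d')), ?_⟩
      filter_upwards [hw, eventually_ge_atTop (-d').toNat] with m hm hm'
      rw [Pi.smul_apply, hm, smul_comm, h, smul_smul]
      congr 2
      · simp only [Polynomial.eval_mul, Polynomial.eval_comp, Polynomial.eval_add,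
          Polynomial.eval_C, Polynomial.eval_X]
        congr 2
        rw [← Int.cast_natCast (m + d').toNat, Int.toNat_of_nonneg (by omega)]
        push_cast
        ring
      · omega
    | zero => rw [smul_zero]; exact zero_mem _
    | add w w' _ _ h h' => rw [smul_add]; exact add_mem h h'
    | smul c w _ h => rw [smul_comm]; exact Submodule.smul_mem _ c h
  have h2 : ∀ w ∈ N, (∃ Q : Polynomial R, ∀ᶠ m : ℕ in atTop,
      D.ξ c (m + j) (w m) = (Q.eval (c * m) : R)) ∧
      ∀ᶠ m : ℕ in atTop, B.H K D.h₁ • w m = μ D.h₁ • w m := by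
    intro w hw
    induction hw using Submodule.span_induction with
    | mem w hw =>
      obtain ⟨d, Q, hw⟩ := hw
      refine ⟨⟨if d = j then Q else 0, ?_⟩, ?_⟩
      · filter_upwards [hw, eventually_ge_atTop (-d).toNat] with m hm hm'
        rw [hm, ← algebraMap_smul K, map_smul, D.ξ_Fv c hc0]
        split_ifs with h h' h'
        · rw [smul_eq_mul, mul_one]
          rfl
        · omega
        · omega
        · simp
      · filter_upwards [hw] with m hm
        rw [hm, smul_comm, D.H_h₁_smul_Fv, ← algebraMap_smul K, ← algebraMap_smul K (_ : R) (D.Fv _ _),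
          smul_comm]
    | zero => exact ⟨⟨0, by simp⟩, by simp⟩
    | add w w' _ _ h h' =>
      obtain ⟨⟨Q, hQ⟩, h⟩ := h
      obtain ⟨⟨Q', hQ'⟩, h'⟩ := h'
      refine ⟨⟨Q + Q', ?_⟩, ?_⟩
      · filter_upwards [hQ, hQ'] with m hm hm'
        rw [Pi.add_apply, map_add, hm, hm', Polynomial.eval_add]
        rfl
      · filter_upwards [h, h'] with m hm hm'
        rw [Pi.add_apply, smul_add, smul_add, hm, hm']
    | smul a w _ h =>
      obtain ⟨⟨Q, hQ⟩, h⟩ := h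
      refine ⟨⟨.C a * Q, ?_⟩, ?_⟩
      · filter_upwards [hQ] with m hm
        rw [Pi.smul_apply, ← algebraMap_smul K, map_smul, hm, Polynomial.eval_mul,
          Polynomial.eval_C]
        rfl
      · filter_upwards [h] with m hm
        rw [Pi.smul_apply, smul_comm, hm, ← algebraMap_smul K a, ← algebraMap_smul K a, smul_comm]
  have h3 : u • (fun m => D.Fv (c : K) m) ∈
      descendants (B.gen (c : K)) (Sum.inr '' {β | leviDegree b α β < 0}) N := by
    refine gammaZero_smul_mem B (fun i w hw => ?_) hA hu (le_descendants _ _ _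
      (Submodule.subset_span ⟨0, 1, by simp⟩))
    rw [← hc]
    exact smul_mem_descendants (B.gen_mul_gen_sub_mem hA c.2) h1 i hw
  suffices h : ∀ w ∈ descendants (B.gen (c : K)) (Sum.inr '' {β | leviDegree b α β < 0}) N,
      ∃ Q : Polynomial R, ∀ᶠ m : ℕ in atTop, D.ξ c (m + j) (w m) = (Q.eval (c * m) : R) from
    h _ h3
  intro w hw
  induction hw using Submodule.span_induction with
  | mem w hw =>
    obtain ⟨l, hl, w, hw, rfl⟩ := hw
    by_cases hl0 : l = []
    · subst hl0
      simpa using (h2 w hw).1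
    · refine ⟨0, ?_⟩
      filter_upwards [(h2 w hw).2] with m hm
      rw [Pi.smul_apply, D.ξ_gen_prod_smul_eq_zero _ hl0 hl hm]
      simp
  | zero => exact ⟨0, by simp⟩
  | add w w' _ _ h h' =>
    obtain ⟨Q, hQ⟩ := h
    obtain ⟨Q', hQ'⟩ := h'
    refine ⟨Q + Q', ?_⟩
    filter_upwards [hQ, hQ'] with m hm hm'
    rw [Pi.add_apply, map_add, hm, hm', Polynomial.eval_add]
    rfl
  | smul a w _ h =>
    obtain ⟨Q, hQ⟩ := h
    refine ⟨.C a * Q, ?_⟩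
    filter_upwards [hQ] with m hm
    rw [Pi.smul_apply, ← algebraMap_smul K, map_smul, hm, Polynomial.eval_mul, Polynomial.eval_C]
    rfl

end StringDatum

end ChevalleyBasis

/-! ### The polynomials attached to elements of U(g_K) -/

namespace ChevalleyBasis

variable {ι k X Y : Type*} [Field k] [CharZero k] [AddCommGroup X] [Module k X]
  [AddCommGroup Y] [Module k Y] {P : RootPairing ι k X Y} [P.IsCrystallographic]
  {b : P.Base} {A g : Type*} [CommRing A] [LieRing g] [LieAlgebra A g]
  {B : ChevalleyBasis b A g} {K : Type*} [Field K] [Algebra A K]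

attribute [local instance] LieRing.ofAssociativeRing

namespace StringDatum

variable {μ : B.Weight K} {α : b.support} {V : Type*} [AddCommGroup V] [Module (UK A K g) V]
  [Module K V] [IsScalarTower K (UK A K g) V]

open Filter Polynomial

/-- The weight of a string datum is integral on `p^n h_R`, and `c = p^n`. -/
structure IsIntegral (_ : B.StringDatum μ α V) {R : ValuationSubring K} (p n : ℕ) (c : R) :
    Prop where
  coe_eq : (c : K) = (p : K) ^ n
  algebraMap_mem : ∀ a, algebraMap A K a ∈ R
  mul_pairing_mem : ∀ δ, (c : K) * B.pairingCoroot μ δ ∈ R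

lemma eq_of_eventually_eval_eq [CharZero K] {c : K} (hc : c ≠ 0) {Q Q' : K[X]}
    (h : ∀ᶠ m : ℕ in atTop, Q.eval (c * m) = Q'.eval (c * m)) : Q = Q' := by
  obtain ⟨M, hM⟩ := eventually_atTop.1 h
  refine Polynomial.eq_of_infinite_eval_eq _ _ (Set.infinite_of_injective_forall_mem
    (f := fun m : ℕ => c * ((m + M : ℕ) : K)) (fun m m' h => ?_) fun m => hM _ (by omega))
  have h1 := mul_left_cancel₀ hc h
  exact Nat.add_right_cancel (Nat.cast_injective h1)

variable (D : B.StringDatum μ α V) {R : ValuationSubring K} [Module R V] [IsScalarTower R K V]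
  [IsScalarTower R (UK A K g) V] {p n : ℕ} [NeZero p] {c : R} [CharZero K] [Finite ι]

namespace IsIntegral

variable {D} (hD : D.IsIntegral p n c)
include hD

lemma coe_ne_zero : (c : K) ≠ 0 := by
  rw [hD.coe_eq]
  exact pow_ne_zero _ (Nat.cast_ne_zero.2 (NeZero.ne p))

variable {π : R} (hπ : Irreducible π)
include hπ

lemma exists_poly_mem {i : ℤ} {u : UK A K g} (hu : u ∈ gamma R g p n π i) (j : ℕ) :
    ∃ Q : K[X], (∀ᶠ m : ℕ in atTop, D.ξ c (m + j) (u • D.Fv c m) = Q.eval ((c : K) * m)) ∧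
      Q ∈ polyLattice R π i := by
  obtain ⟨u, hu', rfl⟩ := mem_gamma.1 hu
  obtain ⟨Q, hQ⟩ := D.exists_polynomial_ξ hD.coe_eq hD.algebraMap_mem hD.mul_pairing_mem hu' j
  refine ⟨Polynomial.C ((π : K) ^ i) * Q.map (algebraMap R K), ?_, ?_⟩
  · filter_upwards [hQ] with m hm
    have h1 : (Q.map (algebraMap R K)).eval ((c : K) * m) = (Q.eval (c * m) : R) := by
      have h2 : (c : K) * m = algebraMap R K (c * m) := by
        rw [map_mul, map_natCast]
        rfl
      rw [Polynomial.eval_map, h2, Polynomial.eval₂_at_apply]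
      rfl
    rw [mul_smul, algebraMap_smul, map_smul, hm, eval_mul, eval_C, smul_eq_mul, h1]
  · have h1 : (π : K) ^ i ∈ powLattice R π i := ⟨1, R.one_mem, mul_one _⟩
    simpa using C_mul_mem_polyLattice hπ h1 (map_mem_polyLattice_zero (π := π) Q)

variable [IsDiscreteValuationRing R]

lemma exists_poly (u : UK A K g) (j : ℕ) :
    ∃ Q : K[X], ∀ᶠ m : ℕ in atTop, D.ξ c (m + j) (u • D.Fv c m) = Q.eval ((c : K) * m) := by
  obtain ⟨i, hi⟩ := exists_mem_gamma_neg (p := p) (n := n) hπ u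
  obtain ⟨Q, hQ, -⟩ := hD.exists_poly_mem hπ hi j
  exact ⟨Q, hQ⟩

/-- The polynomial `Q` with `ξ_{m + j}(u F^m v) = Q(c m)` for large `m`. -/
def poly (j : ℕ) : UK A K g →ₗ[K] K[X] where
  toFun u := (hD.exists_poly hπ u j).choose
  map_add' u u' := eq_of_eventually_eval_eq hD.coe_ne_zero <| by
    filter_upwards [(hD.exists_poly hπ u j).choose_spec, (hD.exists_poly hπ u' j).choose_spec,
      (hD.exists_poly hπ (u + u') j).choose_spec] with m h1 h2 h3
    rw [eval_add, ← h1, ← h2, ← h3, add_smul, map_add]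
  map_smul' a u := eq_of_eventually_eval_eq hD.coe_ne_zero <| by
    filter_upwards [(hD.exists_poly hπ u j).choose_spec,
      (hD.exists_poly hπ (a • u) j).choose_spec] with m h1 h2
    rw [RingHom.id_apply, eval_smul, ← h1, ← h2, smul_assoc, map_smul]

lemma eventually_poly (u : UK A K g) (j : ℕ) :
    ∀ᶠ m : ℕ in atTop, D.ξ c (m + j) (u • D.Fv c m) = (hD.poly hπ j u).eval ((c : K) * m) :=
  (hD.exists_poly hπ u j).choose_spec

lemma poly_eq {u : UK A K g} {j : ℕ} {Q : K[X]}
    (h : ∀ᶠ m : ℕ in atTop, D.ξ c (m + j) (u • D.Fv c m) = Q.eval ((c : K) * m)) :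
    hD.poly hπ j u = Q :=
  eq_of_eventually_eval_eq hD.coe_ne_zero <| by
    filter_upwards [h, hD.eventually_poly hπ u j] with m h1 h2
    rw [← h1, ← h2]

lemma poly_mem {i : ℤ} {u : UK A K g} (hu : u ∈ gamma R g p n π i) (j : ℕ) :
    hD.poly hπ j u ∈ polyLattice R π i := by
  obtain ⟨Q, hQ, hQi⟩ := hD.exists_poly_mem hπ hu j
  rwa [hD.poly_eq hπ hQ]

lemma poly_one : hD.poly hπ 0 1 = 1 :=
  hD.poly_eq hπ <| Eventually.of_forall fun m => by
    rw [add_zero, one_smul, D.ξ_Fv c hD.coe_ne_zero, if_pos rfl, eval_one]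

lemma poly_H_mul (y : K ⊗[A] B.cartan) (u : UK A K g) :
    hD.poly hπ 0 (B.H K y * u) =
      (Polynomial.C (μ y) - Polynomial.C ((c : K)⁻¹ * B.rootWeight K α y) * Polynomial.X) * hD.poly hπ 0 u := by
  have hc := hD.coe_ne_zero
  refine hD.poly_eq hπ ?_
  filter_upwards [hD.eventually_poly hπ u 0] with m hm
  rw [mul_smul, D.ξ_H_smul, hm, eval_mul, eval_sub, eval_mul, eval_C, eval_C, eval_X, add_zero]
  field_simp

lemma poly_mul_H (y : K ⊗[A] B.cartan) (u : UK A K g) :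
    hD.poly hπ 0 (u * B.H K y) =
      (Polynomial.C (μ y) - Polynomial.C ((c : K)⁻¹ * B.rootWeight K α y) * Polynomial.X) * hD.poly hπ 0 u := by
  have hc := hD.coe_ne_zero
  refine hD.poly_eq hπ ?_
  filter_upwards [hD.eventually_poly hπ u 0] with m hm
  rw [mul_smul, D.H_smul_Fv, smul_comm, map_smul, hm, eval_mul, eval_sub, eval_mul, eval_C, eval_C,
    eval_X, smul_eq_mul]
  field_simp

lemma poly_mul_E_of_leviDegree_pos {β : ι} (hβ : 0 < leviDegree b α β) (u : UK A K g) :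
    hD.poly hπ 0 (u * B.E K β) = 0 :=
  hD.poly_eq hπ <| Eventually.of_forall fun m => by
    rw [mul_smul, D.gen_smul_Fv_zero _ hβ, smul_zero, map_zero, eval_zero]

/-- `e_α` sends `F^m v` to a multiple of `F^(m - 1) v`, which explains the index `1` and the shift
by `c`. The multiple, written in `X = c m`, has the root `c (⟨μ, α^∨⟩ + 1)`. -/
lemma poly_mul_E_self (u : UK A K g) :
    hD.poly hπ 0 (u * B.E K α) = Polynomial.X * (Polynomial.C (B.pairingCoroot μ α + 1) - Polynomial.C (c : K)⁻¹ * Polynomial.X) *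
      (hD.poly hπ 1 u).comp (Polynomial.X - Polynomial.C (c : K)) := by
  have hc := hD.coe_ne_zero
  refine hD.poly_eq hπ ?_
  have h := (tendsto_sub_atTop_nat 1).eventually (hD.eventually_poly hπ u 1)
  filter_upwards [h, eventually_ge_atTop 1] with m hm hm1
  rw [Nat.sub_add_cancel hm1, Nat.cast_sub hm1, Nat.cast_one] at hm
  rw [mul_smul, D.E_smul_Fv, smul_comm, map_smul, add_zero, hm]
  simp only [eval_mul, eval_comp, eval_sub, eval_X, eval_C, smul_eq_mul]
  rw [mul_sub, mul_one]
  field_simp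
  ring

end IsIntegral

end StringDatum

end ChevalleyBasis

/-! ### The functional of weight s_α · μ obtained by interpolation -/

namespace ChevalleyBasis

variable {ι k X Y : Type*} [Field k] [CharZero k] [AddCommGroup X] [Module k X]
  [AddCommGroup Y] [Module k Y] {P : RootPairing ι k X Y} [P.IsCrystallographic]
  {b : P.Base} {A g : Type*} [CommRing A] [LieRing g] [LieAlgebra A g]
  {B : ChevalleyBasis b A g} {K : Type*} [Field K] [Algebra A K]

attribute [local instance] LieRing.ofAssociativeRing

namespace StringDatum.IsIntegral

variable {μ : B.Weight K} {α : b.support} {V : Type*} [AddCommGroup V] [Module (UK A K g) V]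
  [Module K V] [IsScalarTower K (UK A K g) V] {D : B.StringDatum μ α V} {R : ValuationSubring K}
  [Module R V] [IsScalarTower R K V] [IsScalarTower R (UK A K g) V] {p n : ℕ} [NeZero p] {c : R}
  [CharZero K] [Finite ι] (hD : D.IsIntegral p n c) {π : R} (hπ : Irreducible π)
  [IsDiscreteValuationRing R]

open Polynomial

/-- The value of `hD.poly hπ 0 u` at `c (⟨μ, α^∨⟩ + 1)`. -/
def Ψ : UK A K g →ₗ[K] K :=
  Polynomial.leval ((c : K) * (B.pairingCoroot μ α + 1)) ∘ₗ hD.poly hπ 0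

lemma Ψ_apply (u : UK A K g) :
    hD.Ψ hπ u = (hD.poly hπ 0 u).eval ((c : K) * (B.pairingCoroot μ α + 1)) := rfl

lemma Ψ_one : hD.Ψ hπ 1 = 1 := by
  rw [Ψ_apply, poly_one, eval_one]

lemma Ψ_mul_H [Fintype ι] [P.IsReduced] (u : UK A K g) (y : K ⊗[A] B.cartan) :
    hD.Ψ hπ (u * B.H K y) = B.dotReflect α μ y * hD.Ψ hπ u := by
  have hc := hD.coe_ne_zero
  rw [Ψ_apply, Ψ_apply, poly_mul_H, eval_mul, eval_sub, eval_mul, Polynomial.eval_C,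
    Polynomial.eval_C, Polynomial.eval_X, dotReflect_eq, LinearMap.sub_apply, LinearMap.smul_apply,
    smul_eq_mul]
  field_simp

lemma Ψ_H_mul [Fintype ι] [P.IsReduced] (u : UK A K g) (y : K ⊗[A] B.cartan) :
    hD.Ψ hπ (B.H K y * u) = B.dotReflect α μ y * hD.Ψ hπ u := by
  rw [← Ψ_mul_H, Ψ_apply, Ψ_apply, poly_mul_H, poly_H_mul]

/-- Positive root vectors other than `e_α` already kill every `F^m v`. For `e_α` the evaluation
point corresponds to `m = ⟨μ, α^∨⟩ + 1`, where `F^m v` is formally singular. -/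
lemma Ψ_mul_E {β : ι} (hβ : b.IsPos β) (u : UK A K g) : hD.Ψ hπ (u * B.E K β) = 0 := by
  have hc := hD.coe_ne_zero
  rw [Ψ_apply]
  rcases (leviDegree_nonneg b α.2 hβ).lt_or_eq with h | h
  · rw [poly_mul_E_of_leviDegree_pos hD hπ h, eval_zero]
  rcases eq_or_eq_neg_of_leviDegree_eq_zero b α.2 h.symm with rfl | rfl
  · rw [poly_mul_E_self, eval_mul, eval_mul, eval_sub, eval_mul, Polynomial.eval_C,
      Polynomial.eval_C, Polynomial.eval_X, inv_mul_cancel_left₀ hc]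
    ring
  · exact absurd (b.isPos_of_mem_support α.2) ((RootPairing.Base.IsPos.neg_iff_not b _).1 hβ)

/-- The evaluation point `c ⟨μ, α^∨⟩ + c` lies in `R`. -/
lemma Ψ_mem {i : ℤ} {u : UK A K g} (hu : hD.poly hπ 0 u ∈ polyLattice R π i) :
    hD.Ψ hπ u ∈ powLattice R π i := by
  refine eval_mem_powLattice hπ hu ?_
  rw [mul_add, mul_one]
  exact R.add_mem _ _ (hD.mul_pairing_mem α) c.2

include hD in
lemma gen_pow_smul (m : ℕ) : (((c : K) • D.f) ^ m) • D.v = D.Fv c m := by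
  induction m with
  | zero => simp [Fv]
  | succ m ih => rw [pow_succ', mul_smul, ih, f_smul_Fv]

include hD in
lemma smul_f_pow_mem (m : ℕ) : ((c : K) • D.f) ^ m ∈ gammaZero R g p n := by
  have h : (c : K) • D.f ∈ gammaZero (A := A) R g p n := by
    refine Subring.subset_closure (Or.inr ⟨1 ⊗ₜ B.e (P.reflectionPerm α α),
      AddSubgroup.subset_closure ⟨1, R.one_mem, _, rfl⟩, ?_⟩)
    rw [hD.coe_eq]
    exact (map_smul (UniversalEnvelopingAlgebra.ι K : K ⊗[A] g →ₗ⁅K⁆ UK A K g) _ _).symm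
  exact pow_mem h m

/-- Approximations of an element `x` such that all `x s` lie in the closure of the annihilator of
the highest-weight vector have polynomials with coefficients in `π ^ i R`. -/
lemma poly_mem_of_memClosure (hp : (p : K) ∈ powLattice R π 1)
    {x : CompletedUK (A := A) R g p n hπ}
    (hx : ∀ s : UK A K g, MemClosure hπ (LinearMap.ker (LinearMap.toSpanSingleton (UK A K g) V D.v))
      (x * toCompletedUK R g p n hπ s)) {i : ℤ} {u : UK A K g}
    (hu : x - toCompletedUK R g p n hπ u ∈ gammaHat R g p n hπ i) :
    hD.poly hπ 0 u ∈ polyLattice R π i := by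
  have hc := hD.coe_ne_zero
  -- The points `c m` are sampled. The degree bound is that of the fixed polynomial of `u`; it does
  -- not concern the better approximations `u'`.
  refine mem_polyLattice_of_small_values hπ i _ (fun m : ℕ => (c : K) * m)
    (fun m m' h => Nat.cast_injective (mul_left_cancel₀ hc h))
    (fun m => R.mul_mem _ _ c.2 (natCast_mem R m)) _ (Nat.lt_succ_self _) fun M i' => ?_
  obtain ⟨u', hu'⟩ := exists_sub_coe_mem_gammaHat hπ x (max i i')
  refine ⟨hD.poly hπ 0 u', ?_, ?_⟩
  · rw [← map_sub]
    refine hD.poly_mem hπ (mem_gamma_of_coe_mem hπ ?_) 0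
    rw [map_sub]
    have := sub_mem (gammaHat_anti hπ (le_max_left i i') hu') hu
    rwa [sub_sub_sub_cancel_left] at this
  -- `x F^m` lies in the closure of the annihilator of `v`, so `u' F^m v` lies in `π^i' Γ₀ v`, and
  -- `ξ_smul_v_mem` bounds its coefficient.
  · have hξ : ∀ m : ℕ, D.ξ c m (u' • D.Fv c m) ∈ powLattice R π i' := by
      intro m
      obtain ⟨q, hq, hxq⟩ := (hx (((c : K) • D.f) ^ m)).exists hπ i'
      have h1 := mul_mem_gammaHat hπ (gammaHat_anti hπ (le_max_right i i') hu')
        (coe_mem_gammaHat hπ (mem_gamma.2 ⟨_, hD.smul_f_pow_mem m, by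
          rw [zpow_zero, map_one, one_mul]⟩ : ((c : K) • D.f) ^ m ∈ gamma R g p n π 0))
      rw [add_zero, sub_mul] at h1
      have h2 := sub_mem hxq h1
      rw [sub_sub_sub_cancel_left, ← map_mul, ← map_sub] at h2
      obtain ⟨u₀, hu₀, h3⟩ := mem_gamma.1 (mem_gamma_of_coe_mem hπ h2)
      have hq0 : q • D.v = 0 := hq
      have h4 : u' • D.Fv c m = algebraMap K (UK A K g) ((π : K) ^ i') • u₀ • D.v := by
        rw [← mul_smul, h3, sub_smul, hq0, sub_zero, mul_smul, hD.gen_pow_smul]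
      rw [h4, algebraMap_smul, map_smul, smul_eq_mul]
      exact ⟨_, D.ξ_smul_v_mem hD.coe_eq hD.algebraMap_mem hD.mul_pairing_mem hu₀ m, rfl⟩
    obtain ⟨M', hM'⟩ := Filter.eventually_atTop.1 (hD.eventually_poly hπ u' 0)
    intro m _
    -- The polynomial is known to compute `ξ` only beyond a threshold `M'` depending on `u'`; p-adic
    -- continuity removes it.
    refine eval_mem_of_eventually hπ hp c.2 (M := M') (fun m hm => ?_) m
    rw [← hM' m hm]
    exact hξ m

end StringDatum.IsIntegral

end ChevalleyBasis

/-! ### The grading of U(g_K) by height -/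

lemma exists_projections_of_isInternal {K M I : Type*} [Field K] [AddCommGroup M] [Module K M]
    [DecidableEq I] {W : I → Submodule K M} (h : DirectSum.IsInternal W) :
    ∃ pr : I → M →ₗ[K] M, (∀ d u, pr d u ∈ W d) ∧ (∀ d, ∀ u ∈ W d, pr d u = u) ∧
      (∀ d e, d ≠ e → ∀ u ∈ W d, pr e u = 0) ∧ ∀ u, ∃ s : Finset I, u = ∑ d ∈ s, pr d u := by
  classical
  let := h.chooseDecomposition
  refine ⟨fun d => (W d).subtype ∘ₗ DirectSum.component K I (fun d => W d) d ∘ₗ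
      (DirectSum.decomposeLinearEquiv W).toLinearMap, fun d u => Subtype.property _,
    fun d u hu => DirectSum.decompose_of_mem_same W hu,
    fun d e hde u hu => DirectSum.decompose_of_mem_ne W hu hde,
    fun u => ⟨_, (DirectSum.sum_support_decompose W u).symm⟩⟩

namespace ChevalleyBasis

variable {ι k X Y : Type*} [Field k] [CharZero k] [AddCommGroup X] [Module k X]
  [AddCommGroup Y] [Module k Y] {P : RootPairing ι k X Y} [P.IsCrystallographic]
  {b : P.Base} {A g : Type*} [CommRing A] [LieRing g] [LieAlgebra A g]
  (B : ChevalleyBasis b A g) {K : Type*} [Field K] [Algebra A K]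

attribute [local instance] LieRing.ofAssociativeRing

/-- The elements of `U(g_K)` of degree `d` for the adjoint action of `x ∈ h_K`. -/
def degreeSpace (x : K ⊗[A] B.cartan) (d : ℤ) : Submodule K (UK A K g) :=
  Module.End.eigenspace (LinearMap.mulLeft K (B.H K x) - LinearMap.mulRight K (B.H K x)) (d : K)

variable {B}

lemma mem_degreeSpace {x : K ⊗[A] B.cartan} {d : ℤ} {u : UK A K g} :
    u ∈ B.degreeSpace x d ↔ B.H K x * u = u * B.H K x + (d : K) • u := by
  rw [degreeSpace, Module.End.mem_eigenspace_iff, LinearMap.sub_apply, LinearMap.mulLeft_apply,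
    LinearMap.mulRight_apply, sub_eq_iff_eq_add']

lemma mul_mem_degreeSpace {x : K ⊗[A] B.cartan} {d e : ℤ} {u v : UK A K g}
    (hu : u ∈ B.degreeSpace x d) (hv : v ∈ B.degreeSpace x e) :
    u * v ∈ B.degreeSpace x (d + e) := by
  rw [mem_degreeSpace] at hu hv ⊢
  rw [← mul_assoc, hu, add_mul, mul_assoc, hv, mul_add, mul_assoc, mul_smul_comm, smul_mul_assoc]
  push_cast
  module

lemma one_mem_degreeSpace (x : K ⊗[A] B.cartan) : (1 : UK A K g) ∈ B.degreeSpace x 0 := by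
  rw [mem_degreeSpace]
  simp

variable (B) in
/-- The degree of an element of the Chevalley basis. -/
def genDegree (_ : ChevalleyBasis b A g) : b.support ⊕ ι → ℤ := Sum.elim 0 b.height

variable {x : K ⊗[A] B.cartan} (hx : ∀ β, B.rootWeight K β x = b.height β)
include hx

lemma gen_mem_degreeSpace (c : K) (i : b.support ⊕ ι) :
    B.gen c i ∈ B.degreeSpace x (B.genDegree i) := by
  rw [mem_degreeSpace, H_mul_gen]
  congr 2
  cases i with
  | inl δ => simp [genWeight, genDegree]
  | inr β => exact hx β

/-- Eigenspaces are independent, and their sum contains `1` and is stable under the generators,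
which are homogeneous. -/
lemma isInternal_degreeSpace [CharZero K] : DirectSum.IsInternal (B.degreeSpace x) := by
  refine DirectSum.isInternal_submodule_of_iSupIndep_of_iSup_eq_top
    ((Module.End.eigenspaces_iSupIndep _).comp Int.cast_injective) (eq_top_iff.2 fun u _ => ?_)
  rw [← mul_one u]
  refine B.smul_mem_of_gen (V := UK A K g) one_ne_zero (fun i w hw => ?_) u
    (Submodule.mem_iSup_of_mem 0 (one_mem_degreeSpace x))
  induction hw using Submodule.iSup_induction' with
  | mem d w hw =>
    exact Submodule.mem_iSup_of_mem _ (mul_mem_degreeSpace (gen_mem_degreeSpace hx 1 i) hw)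
  | zero => rw [smul_zero]; exact zero_mem _
  | add w w' _ _ h h' => rw [smul_add]; exact add_mem h h'

omit hx in
lemma gen_mem_gammaZero {R : ValuationSubring K} (p n : ℕ) (i : b.support ⊕ ι) :
    B.gen ((p : K) ^ n) i ∈ gammaZero (A := A) R g p n :=
  Subring.subset_closure (Or.inr ⟨_, AddSubgroup.subset_closure ⟨1, R.one_mem, _, rfl⟩, rfl⟩)

lemma mem_span_degreeSpace {R : ValuationSubring K} (hA : ∀ a, algebraMap A K a ∈ R) {p n : ℕ}
    {u : UK A K g} (hu : u ∈ gammaZero R g p n) :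
    u ∈ Submodule.span R {z | z ∈ gammaZero (A := A) R g p n ∧ ∃ d, z ∈ B.degreeSpace x d} := by
  rw [← mul_one u]
  refine B.gammaZero_smul_mem (V := UK A K g) (fun i w hw => ?_) hA hu
    (Submodule.subset_span ⟨one_mem _, 0, one_mem_degreeSpace x⟩)
  induction hw using Submodule.span_induction with
  | mem w hw =>
    obtain ⟨hw, d, hd⟩ := hw
    exact Submodule.subset_span ⟨mul_mem (gen_mem_gammaZero p n i) hw, _,
      mul_mem_degreeSpace (gen_mem_degreeSpace hx _ i) hd⟩
  | zero => rw [smul_zero]; exact zero_mem _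
  | add w w' _ _ h h' => rw [smul_add]; exact add_mem h h'
  | smul c w _ h => rw [smul_comm]; exact Submodule.smul_mem _ c h

omit hx in
variable (B) in
/-- A family of projections to the spaces of elements of given degree. -/
structure DegreeProjections (x : K ⊗[A] B.cartan) (pr : ℤ → UK A K g →ₗ[K] UK A K g) : Prop where
  mem : ∀ d u, pr d u ∈ B.degreeSpace x d
  eq_self : ∀ d, ∀ u ∈ B.degreeSpace x d, pr d u = u
  eq_zero : ∀ d e, d ≠ e → ∀ u ∈ B.degreeSpace x d, pr e u = 0
  exists_sum : ∀ u, ∃ s : Finset ℤ, u = ∑ d ∈ s, pr d u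
  mem_gamma : ∀ (R : ValuationSubring K) (p n : ℕ) (π : R) (i : ℤ), (∀ a, algebraMap A K a ∈ R) →
    ∀ u ∈ gamma (A := A) R g p n π i, ∀ d, pr d u ∈ gamma R g p n π i

/-- The projections preserve each `Γ_i` because `Γ₀` is spanned over `R` by its homogeneous
elements. -/
lemma exists_degreeProjections [CharZero K] :
    ∃ pr : ℤ → UK A K g →ₗ[K] UK A K g, B.DegreeProjections x pr := by
  obtain ⟨pr, h1, h2, h3, h4⟩ := exists_projections_of_isInternal (isInternal_degreeSpace hx)
  refine ⟨pr, h1, h2, h3, h4, fun R p n π i hA u hu d => ?_⟩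
  obtain ⟨u, hu', rfl⟩ := mem_gamma.1 hu
  refine mem_gamma.2 ⟨pr d u, ?_, ?_⟩
  · have h5 := mem_span_degreeSpace hx hA hu'
    clear hu hu'
    induction h5 using Submodule.span_induction with
    | mem z hz =>
      obtain ⟨hz, e, he⟩ := hz
      by_cases hed : e = d
      · subst hed
        rwa [h2 e z he]
      · rw [h3 e d hed z he]
        exact zero_mem _
    | zero => rw [map_zero]; exact zero_mem _
    | add w w' _ _ h h' => rw [map_add]; exact add_mem h h'
    | smul c w _ h =>
      have h5 : c • w = algebraMap K (UK A K g) c * w := Algebra.smul_def (c : K) w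
      have h6 : pr d (c • w) = algebraMap K (UK A K g) c * pr d w := by
        rw [← Algebra.smul_def]
        exact (pr d).map_smul (c : K) w
      rw [h6]
      exact mul_mem (algebraMap_mem_gammaZero c.2) h
  · rw [← Algebra.smul_def, ← Algebra.smul_def, map_smul]

omit hx in
lemma prod_mem_degreeSpace {x : K ⊗[A] B.cartan} (hx : ∀ β, B.rootWeight K β x = b.height β) (c : K)
    (l : List (b.support ⊕ ι)) (hl : ∀ i ∈ l, i ∈ Sum.inr '' {β | b.height β < 0}) :
    ∃ d : ℤ, l.length ≤ -d ∧ (l.map (B.gen c)).prod ∈ B.degreeSpace x d := by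
  induction l with
  | nil => exact ⟨0, by simp, one_mem_degreeSpace x⟩
  | cons i l ih =>
    obtain ⟨d, hd, h⟩ := ih fun i hi => hl i (List.mem_cons_of_mem _ hi)
    obtain ⟨β, hβ, rfl⟩ := hl i List.mem_cons_self
    refine ⟨B.genDegree (.inr β) + d, ?_, ?_⟩
    · have : B.genDegree (.inr β) < 0 := hβ
      rw [List.length_cons]
      push_cast
      omega
    · rw [List.map_cons, List.prod_cons]
      exact mul_mem_degreeSpace (gen_mem_degreeSpace hx c _) h

end ChevalleyBasis

/-- Every functional on the finite-dimensional space `T(S)` is evaluation at some element of `N`,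
since `ev` is injective. The `y j` represent the coordinates of a basis, and the `z j` lift that
basis. -/
lemma exists_dual_of_finiteDimensional {K M D N : Type*} [Field K] [AddCommGroup M] [Module K M]
    [AddCommGroup D] [Module K D] [AddCommGroup N] [Module K N] (T : M →ₗ[K] D)
    (ev : D →ₗ[K] N →ₗ[K] K) (hev : Function.Injective ev) (S : Submodule K M)
    [FiniteDimensional K (S.map T)] :
    ∃ (r : ℕ) (y : Fin r → N) (z : Fin r → M), (∀ j, z j ∈ S) ∧
      ∀ u ∈ S, T (u - ∑ j, ev (T u) (y j) • z j) = 0 := by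
  let c := Module.finBasis K (S.map T)
  have hsurj : Function.Surjective (ev ∘ₗ (S.map T).subtype).flip :=
    LinearMap.flip_surjective_iff₁.2 (hev.comp (S.map T).injective_subtype)
  choose z hz hzc using fun j => (c j).2
  choose y hy using fun j => hsurj (c.coord j)
  refine ⟨_, y, z, hz, fun u hu => ?_⟩
  rw [map_sub, map_sum, sub_eq_zero]
  have h := congrArg (S.map T).subtype (c.sum_repr ⟨T u, Submodule.mem_map_of_mem hu⟩)
  rw [map_sum] at h
  refine h.symm.trans (Finset.sum_congr rfl fun j _ => ?_)
  rw [map_smul, map_smul, hzc, ← c.coord_apply, ← hy j]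
  rfl

/-! ### Functionals on Verma modules and the closure of their radical -/

namespace ChevalleyBasis

variable {ι k X Y : Type*} [Field k] [CharZero k] [AddCommGroup X] [Module k X]
  [AddCommGroup Y] [Module k Y] {P : RootPairing ι k X Y} [P.IsCrystallographic]
  {b : P.Base} {A g : Type*} [CommRing A] [LieRing g] [LieAlgebra A g]
  {B : ChevalleyBasis b A g} {K : Type*} [Field K] [Algebra A K]

attribute [local instance] LieRing.ofAssociativeRing

/-- A functional on `U(g_K)` which factors through the projection of the Verma module of highest
weight `ν` to its highest-weight line. -/
structure IsVermaFunctional (ν : B.Weight K) (Ψ : UK A K g →ₗ[K] K) : Prop where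
  map_one : Ψ 1 = 1
  map_mul_E : ∀ u β, b.IsPos β → Ψ (u * B.E K β) = 0
  map_mul_H : ∀ u y, Ψ (u * B.H K y) = ν y * Ψ u
  map_H_mul : ∀ u y, Ψ (B.H K y * u) = ν y * Ψ u

/-- The largest left ideal contained in the kernel of `Ψ`. -/
def leftRadical (Ψ : UK A K g →ₗ[K] K) : Submodule (UK A K g) (UK A K g) where
  carrier := {u | ∀ y, Ψ (y * u) = 0}
  add_mem' hu hv y := by rw [mul_add, map_add, hu y, hv y, add_zero]
  zero_mem' y := by rw [mul_zero, map_zero]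
  smul_mem' u v hv y := by rw [smul_eq_mul, ← mul_assoc, hv]

namespace IsVermaFunctional

variable {ν : B.Weight K} {Ψ : UK A K g →ₗ[K] K} (hΨ : IsVermaFunctional ν Ψ)
include hΨ

lemma E_mem {β : ι} (hβ : b.IsPos β) : B.E K β ∈ leftRadical Ψ := fun u => hΨ.map_mul_E u β hβ

lemma H_sub_mem (y : K ⊗[A] B.cartan) :
    B.H K y - algebraMap K (UK A K g) (ν y) ∈ leftRadical Ψ := fun u => by
  rw [mul_sub, map_sub, hΨ.map_mul_H, ← Algebra.commutes, ← Algebra.smul_def, map_smul,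
    smul_eq_mul, sub_self]

lemma vermaIdeal_le : B.vermaIdeal ν ≤ leftRadical Ψ := by
  refine Submodule.span_le.2 ?_
  rintro u (⟨β, hβ, rfl⟩ | ⟨y, rfl⟩)
  exacts [hΨ.E_mem hβ, hΨ.H_sub_mem y]

/-- The image of `leftRadical Ψ` in the Verma module is a proper submodule, as `Ψ 1 = 1`, so it lies
in the radical. -/
lemma leftRadical_le :
    leftRadical Ψ ≤ LinearMap.ker (LinearMap.toSpanSingleton (UK A K g) (B.Irred ν)
      (B.irredVector ν)) := by
  intro u hu
  have h1 : (leftRadical Ψ).map (B.vermaIdeal ν).mkQ ≠ ⊤ := by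
    intro h
    have h2 : (B.vermaIdeal ν).mkQ 1 ∈ (leftRadical Ψ).map (B.vermaIdeal ν).mkQ := h ▸ trivial
    obtain ⟨r, hr, h2⟩ := h2
    rw [← sub_eq_zero, ← map_sub, Submodule.mkQ_apply, Submodule.Quotient.mk_eq_zero] at h2
    have h3 : (1 : UK A K g) ∈ leftRadical Ψ := by
      have := sub_mem hr (hΨ.vermaIdeal_le h2)
      rwa [sub_sub_cancel] at this
    have h4 := h3 1
    rw [mul_one, hΨ.map_one] at h4
    exact one_ne_zero h4
  have h2 : (B.vermaIdeal ν).mkQ u ∈ B.vermaRadical ν :=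
    (le_sSup h1 : _ ≤ B.vermaRadical ν) ⟨u, hu, rfl⟩
  rw [LinearMap.mem_ker, LinearMap.toSpanSingleton_apply, irredVector,
    ← Submodule.Quotient.mk_smul, ← Submodule.Quotient.mk_smul, smul_eq_mul, mul_one,
    Submodule.Quotient.mk_eq_zero]
  exact h2

lemma apply_eq_zero [CharZero K] {x : K ⊗[A] B.cartan} {d : ℤ} (hd : d ≠ 0) {u : UK A K g}
    (hu : u ∈ B.degreeSpace x d) : Ψ u = 0 := by
  have h := congrArg Ψ (mem_degreeSpace.1 hu)
  rw [hΨ.map_H_mul, map_add, hΨ.map_mul_H, left_eq_add, map_smul, smul_eq_mul] at h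
  exact (mul_eq_zero.1 h).resolve_left (Int.cast_ne_zero.2 hd)

variable [CharZero K] {x : K ⊗[A] B.cartan} {pr : ℤ → UK A K g →ₗ[K] UK A K g}
  (hpr : B.DegreeProjections x pr)
include hpr

/-- `Ψ` vanishes in non-zero degrees, so against `y` of degree `-d` only the component of `u` in
degree `d` counts. -/
lemma apply_mul_pr {d e : ℤ} (hde : e + d = 0) {y : UK A K g} (hy : y ∈ B.degreeSpace x e)
    (u : UK A K g) : Ψ (y * pr d u) = Ψ (y * u) := by
  have h : ∀ d', Ψ (y * pr d (pr d' u)) = Ψ (y * pr d' u) := by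
    intro d'
    by_cases hd : d' = d
    · subst hd
      rw [hpr.eq_self _ _ (hpr.mem _ u)]
    · rw [hpr.eq_zero _ _ hd _ (hpr.mem _ u), mul_zero, map_zero,
        hΨ.apply_eq_zero (by omega) (mul_mem_degreeSpace hy (hpr.mem d' u))]
  obtain ⟨s, hs⟩ := hpr.exists_sum u
  rw [hs]
  simp only [map_sum, Finset.mul_sum, h]

lemma apply_pr_mul {d e : ℤ} (hde : e + d = 0) {u : UK A K g} (hu : u ∈ B.degreeSpace x d)
    (y : UK A K g) : Ψ (pr e y * u) = Ψ (y * u) := by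
  have h : ∀ d', Ψ (pr e (pr d' y) * u) = Ψ (pr d' y * u) := by
    intro d'
    by_cases hd : d' = e
    · subst hd
      rw [hpr.eq_self _ _ (hpr.mem _ y)]
    · rw [hpr.eq_zero _ _ hd _ (hpr.mem _ y), zero_mul, map_zero,
        hΨ.apply_eq_zero (by omega) (mul_mem_degreeSpace (hpr.mem d' y) hu)]
  obtain ⟨s, hs⟩ := hpr.exists_sum y
  rw [hs]
  simp only [map_sum, Finset.sum_mul, h]

lemma pr_mem_leftRadical (d : ℤ) {u : UK A K g} (hu : u ∈ leftRadical Ψ) :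
    pr d u ∈ leftRadical Ψ := fun y => by
  rw [← hΨ.apply_pr_mul hpr (neg_add_cancel d) (hpr.mem d u),
    hΨ.apply_mul_pr hpr (neg_add_cancel d) (hpr.mem _ y), hu]

omit hΨ hpr in
/-- The map sending `u` to the functional `y ↦ Ψ (y u)`. -/
def _root_.AffinoidEnveloping.ChevalleyBasis.leftPairing (Ψ : UK A K g →ₗ[K] K) :
    UK A K g →ₗ[K] UK A K g →ₗ[K] K :=
  (LinearMap.mul K (UK A K g)).flip.compr₂ Ψ

omit hΨ hpr [CharZero K] in
lemma leftPairing_eq_zero_iff {u : UK A K g} : leftPairing Ψ u = 0 ↔ u ∈ leftRadical Ψ :=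
  LinearMap.ext_iff

/-- Modulo the left radical, `U(g_K)` is spanned by words in negative root vectors. Each letter
lowers the height by at least one, so in degree `d` these have length at most `-d`. -/
lemma finiteDimensional_map_leftPairing [Finite ι]
    (hx : ∀ β, B.rootWeight K β x = b.height β) (d : ℤ) :
    FiniteDimensional K ((B.degreeSpace x d).map (leftPairing Ψ)) := by
  set J : Set (b.support ⊕ ι) := Sum.inr '' {β | b.height β < 0} with hJ
  set S := Submodule.span K ((fun l : List (b.support ⊕ ι) =>
    leftPairing Ψ (l.map (B.gen (1 : K))).prod) '' {l | l.length ≤ (-d).toNat}) with hS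
  have hfin : FiniteDimensional K S :=
    FiniteDimensional.span_of_finite K ((List.finite_length_le _ _).image _)
  suffices h : ∀ u, leftPairing Ψ (pr d u) ∈ S by
    refine Submodule.finiteDimensional_of_le (S₂ := S) ?_
    rintro _ ⟨u, hu, rfl⟩
    have := h u
    rwa [hpr.eq_self d u hu] at this
  set N : Submodule K (UK A K g) :=
    Submodule.span K {1} ⊔ (leftRadical Ψ).restrictScalars K with hN
  have hrad : ∀ w ∈ leftRadical Ψ, w ∈ N := fun w hw => Submodule.mem_sup_right hw
  have h1 : (1 : UK A K g) ∈ N :=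
    Submodule.mem_sup_left (Submodule.mem_span_singleton_self _)
  have hstab : ∀ i ∉ J, ∀ w ∈ N, B.gen (1 : K) i • w ∈ N := by
    intro i hi w hw
    obtain ⟨w₁, hw₁, w₂, hw₂, rfl⟩ := Submodule.mem_sup.1 hw
    obtain ⟨a, rfl⟩ := Submodule.mem_span_singleton.1 hw₁
    rw [smul_add, smul_comm]
    refine add_mem (Submodule.smul_mem _ _ ?_) (hrad _ ((leftRadical Ψ).smul_mem _ hw₂))
    rw [smul_eq_mul, mul_one]
    cases i with
    | inl δ =>
      rw [gen_inl, one_smul, ← sub_add_cancel (B.H K _) (algebraMap K (UK A K g) (ν _))]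
      refine add_mem (hrad _ (hΨ.H_sub_mem _)) ?_
      rw [Algebra.algebraMap_eq_smul_one]
      exact Submodule.smul_mem _ _ h1
    | inr β =>
      rw [gen_inr, one_smul]
      exact hrad _ (hΨ.E_mem (b.isPos_iff'.2 (not_lt.1 fun h => hi ⟨β, h, rfl⟩)))
  intro u
  have hu : u ∈ descendants (B.gen (1 : K)) J N := by
    rw [← mul_one u]
    exact B.smul_mem_of_gen (V := UK A K g) one_ne_zero (fun i w hw => smul_mem_descendants
      (B.gen_mul_gen_sub_mem_field 1) hstab i hw) u (le_descendants _ _ _ h1)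
  induction hu using Submodule.span_induction with
  | mem w hw =>
    obtain ⟨l, hl, w, hw, rfl⟩ := hw
    obtain ⟨w₁, hw₁, w₂, hw₂, rfl⟩ := Submodule.mem_sup.1 hw
    obtain ⟨a, rfl⟩ := Submodule.mem_span_singleton.1 hw₁
    have h2 : leftPairing Ψ (pr d ((l.map (B.gen (1 : K))).prod • w₂)) = 0 :=
      leftPairing_eq_zero_iff.2
        (hΨ.pr_mem_leftRadical hpr d ((leftRadical Ψ).smul_mem _ hw₂))
    rw [smul_add, map_add, map_add, h2, add_zero, smul_comm, map_smul, map_smul, smul_eq_mul,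
      mul_one]
    refine Submodule.smul_mem _ _ ?_
    obtain ⟨e, he, hle⟩ := prod_mem_degreeSpace hx 1 l hl
    by_cases hed : e = d
    · subst hed
      rw [hpr.eq_self _ _ hle]
      exact Submodule.subset_span ⟨l, by rw [Set.mem_ofPred_eq]; omega, rfl⟩
    · rw [hpr.eq_zero _ _ hed _ hle, map_zero]
      exact zero_mem _
  | zero => rw [map_zero, map_zero]; exact zero_mem _
  | add w w' _ _ h h' => rw [map_add, map_add]; exact add_mem h h'
  | smul a w _ h => rw [map_smul, map_smul]; exact Submodule.smul_mem _ _ h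

lemma exists_dual [Finite ι] (hx : ∀ β, B.rootWeight K β x = b.height β) (d : ℤ) :
    ∃ (r : ℕ) (y z : Fin r → UK A K g), (∀ j, z j ∈ B.degreeSpace x d) ∧
      ∀ u ∈ B.degreeSpace x d, u - ∑ j, Ψ (y j * u) • z j ∈ leftRadical Ψ := by
  have := hΨ.finiteDimensional_map_leftPairing hpr hx d
  obtain ⟨r, y, z, hz, h⟩ := exists_dual_of_finiteDimensional (leftPairing Ψ)
    LinearMap.id Function.injective_id (B.degreeSpace x d)
  exact ⟨r, y, z, hz, fun u hu => leftPairing_eq_zero_iff.1 (h u hu)⟩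

variable {R : ValuationSubring K} {p n : ℕ} [NeZero p] {π : R} (hπ : Irreducible π)
  [IsDiscreteValuationRing R]

omit hΨ hpr [CharZero K] [NeZero p] [IsDiscreteValuationRing R] in
lemma _root_.AffinoidEnveloping.smul_mem_gamma (hπ : Irreducible π) {i j : ℤ} {c : K}
    (hc : c ∈ powLattice R π i) {u : UK A K g} (hu : u ∈ gamma R g p n π j) :
    c • u ∈ gamma R g p n π (i + j) := by
  obtain ⟨r, hr, rfl⟩ := hc
  rw [Algebra.smul_def]
  refine mul_mem_gamma hπ (mem_gamma.2 ⟨_, algebraMap_mem_gammaZero hr, ?_⟩) hu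
  rw [map_mul]

/-- An element of the completion lies in the closure of `leftRadical Ψ` if `Ψ (y u)` is small
for good approximations `u` of the element. -/
lemma memClosure_leftRadical [Finite ι] (hx : ∀ β, B.rootWeight K β x = b.height β)
    (hA : ∀ a, algebraMap A K a ∈ R) {q : CompletedUK (A := A) R g p n hπ}
    (hq : ∀ (y : UK A K g) (i : ℤ), ∃ i₀ : ℤ, ∀ u, q - toCompletedUK R g p n hπ u ∈
      gammaHat R g p n hπ i₀ → Ψ (y * u) ∈ powLattice R π i) :
    MemClosure hπ (leftRadical Ψ) q := by
  intro N
  obtain ⟨u, hu⟩ := exists_sub_coe_mem_gammaHat hπ q N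
  -- Only finitely many degrees occur in the fixed `u`. In each degree `d` a better approximation
  -- `u'`, which may depend on `d`, is moved into the radical by subtracting the terms `Ψ(y_j u')
  -- z_j`, and these are small.
  have h : ∀ d, ∃ r ∈ leftRadical Ψ, pr d u - r ∈ gamma R g p n π N := by
    intro d
    obtain ⟨r, y, z, hz, hyz⟩ := hΨ.exists_dual hpr hx d
    choose M hM using fun j => exists_mem_gamma_neg (p := p) (n := n) hπ (z j)
    -- `M j` offsets the denominators of `z j`. With the component of `y j` in degree `-d`, the
    -- projection of `u'` can be dropped inside `Ψ`.
    choose i₀ hi₀ using fun j => hq (pr (-d) (y j)) (N + M j)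
    obtain ⟨i, hi⟩ := Finite.exists_le i₀
    obtain ⟨u', hu'⟩ := exists_sub_coe_mem_gammaHat hπ q (max N i)
    refine ⟨_, hyz _ (hpr.mem d u'), ?_⟩
    rw [← sub_add, ← map_sub]
    refine add_mem (hpr.mem_gamma _ _ _ _ _ hA _ (mem_gamma_of_coe_mem hπ ?_) d)
      (sum_mem fun j _ => ?_)
    · have := sub_mem (gammaHat_anti hπ (le_max_left _ _) hu') hu
      rwa [sub_sub_sub_cancel_left, ← map_sub] at this
    · rw [← hΨ.apply_pr_mul hpr (neg_add_cancel d) (hpr.mem d u'),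
        hΨ.apply_mul_pr hpr (neg_add_cancel d) (hpr.mem _ _)]
      have := smul_mem_gamma hπ (hi₀ j u' (gammaHat_anti hπ ((hi j).trans (le_max_right _ _)) hu'))
        (hM j)
      rwa [add_neg_cancel_right] at this
  choose r hr hru using h
  obtain ⟨s, hs⟩ := hpr.exists_sum u
  refine ⟨∑ d ∈ s, r d, sum_mem fun d _ => hr d, ?_⟩
  have h2 : u - ∑ d ∈ s, r d ∈ gamma R g p n π N := by
    have h0 : u - ∑ d ∈ s, r d = ∑ d ∈ s, (pr d u - r d) := by
      rw [Finset.sum_sub_distrib, ← hs]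
    rw [h0]
    exact sum_mem fun d _ => hru d
  have h3 := add_mem hu (coe_mem_gammaHat hπ h2)
  rwa [map_sub, sub_add_sub_cancel] at h3

end IsVermaFunctional

end ChevalleyBasis

/-! ### Conclusion: the inclusion of annihilators -/

namespace ChevalleyBasis

variable {ι k X Y : Type*} [Field k] [CharZero k] [AddCommGroup X] [Module k X]
  [AddCommGroup Y] [Module k Y] {P : RootPairing ι k X Y} [P.IsCrystallographic]
  {b : P.Base} {A g : Type*} [CommRing A] [LieRing g] [LieAlgebra A g]
  (B : ChevalleyBasis b A g) {K : Type*} [Field K] [Algebra A K]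

attribute [local instance] LieRing.ofAssociativeRing

include B in
-- `Γ₀` is generated over `R` by the Chevalley basis scaled by `p^n`, whose commutators are
-- `R`-linear combinations of it.
lemma isNoetherianRing_gammaZero [Finite ι] {R : ValuationSubring K} [IsNoetherianRing R]
    (hA : ∀ a, algebraMap A K a ∈ R) (p n : ℕ) :
    IsNoetherianRing (gammaZero (A := A) R g p n) := by
  let f : R →+* gammaZero (A := A) R g p n :=
    ((algebraMap K (UK A K g)).comp R.subtype).codRestrict _
      fun c => algebraMap_mem_gammaZero c.2
  let : Algebra R (gammaZero (A := A) R g p n) := f.toAlgebra' fun c x =>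
    Subtype.ext (Algebra.commutes (c : K) (x : UK A K g))
  let φ : gammaZero (A := A) R g p n →ₗ[R] UK A K g :=
    { toFun := Subtype.val
      map_add' := fun _ _ => rfl
      map_smul' := fun c x => by
        rw [RingHom.id_apply, Algebra.smul_def]
        exact (Algebra.smul_def (c : K) (x : UK A K g)).symm }
  have hφ : Function.Injective φ := Subtype.val_injective
  let x : b.support ⊕ ι → gammaZero (A := A) R g p n := fun i =>
    ⟨B.gen ((p : K) ^ n) i, gen_mem_gammaZero p n i⟩
  have hx : Set.range (B.gen ((p : K) ^ n)) = φ '' Set.range x := by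
    rw [← Set.range_comp]
    rfl
  refine isNoetherianRing_of_adjoin_eq_top (R := R) (x := x) (fun i j => ?_)
    (eq_top_iff.2 fun u _ => ?_)
  · have h := B.gen_mul_gen_sub_mem hA (c := (p : K) ^ n) (pow_mem (natCast_mem R p) n) i j
    rw [hx, Submodule.span_image] at h
    obtain ⟨z, hz, h⟩ := h
    have h' : z = x i * x j - x j * x i := hφ h
    rwa [← h']
  · have h : (u : UK A K g) • (1 : UK A K g) ∈
        (Subalgebra.toSubmodule (Algebra.adjoin R (Set.range x))).map φ := by
      refine B.gammaZero_smul_mem (V := UK A K g) (fun i w hw => ?_) hA u.2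
        ⟨1, one_mem (Algebra.adjoin R (Set.range x)), rfl⟩
      obtain ⟨z, hz, rfl⟩ := hw
      exact ⟨x i * z, (Algebra.adjoin R (Set.range x)).mul_mem (Algebra.subset_adjoin ⟨i, rfl⟩) hz,
        rfl⟩
    rw [smul_eq_mul, mul_one] at h
    obtain ⟨z, hz, h⟩ := h
    have h' : z = u := hφ h
    rwa [← h']

variable {B} in
lemma StringDatum.IsIntegral.isVermaFunctional [CharZero K] [Fintype ι] [P.IsReduced]
    {μ : B.Weight K} {α : b.support} {V : Type*} [AddCommGroup V] [Module (UK A K g) V]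
    [Module K V] [IsScalarTower K (UK A K g) V] {D : B.StringDatum μ α V} {R : ValuationSubring K}
    [Module R V] [IsScalarTower R K V] [IsScalarTower R (UK A K g) V] {p n : ℕ} [NeZero p] {c : R}
    (hD : D.IsIntegral p n c) {π : R} (hπ : Irreducible π) [IsDiscreteValuationRing R] :
    IsVermaFunctional (B.dotReflect α μ) (hD.Ψ hπ) where
  map_one := hD.Ψ_one hπ
  map_mul_E u _ hβ := hD.Ψ_mul_E hπ hβ u
  map_mul_H := hD.Ψ_mul_H hπ
  map_H_mul := hD.Ψ_H_mul hπ

lemma mem_annCompletedIrred_iff {R : ValuationSubring K} [IsDiscreteValuationRing R] [CharZero K]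
    {p : ℕ} [NeZero p] {n : ℕ} {π : R} (hπ : Irreducible π) {μ : B.Weight K}
    {x : CompletedUK (A := A) R g p n hπ} :
    x ∈ B.annCompletedIrred R p n hπ μ ↔ ∀ t, x * t ∈
      Submodule.span (CompletedUK (A := A) R g p n hπ) (toCompletedUK R g p n hπ ''
        LinearMap.ker (LinearMap.toSpanSingleton (UK A K g) (B.Irred μ) (B.irredVector μ))) :=
  mem_annihilator_extensionOfScalars_iff (toCompletedUK (A := A) R g p n hπ) (B.irredVector μ)
    (B.isHighestWeightGenerator_irred μ).exists_smul_eq _ (fun _ => Iff.rfl) x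

theorem annCompletedIrred_le_dotReflect [CharZero K] [Fintype ι] [P.IsReduced]
    [DecidableEq b.support] (hdet : b.cartanMatrix.det ≠ 0) {R : ValuationSubring K}
    [IsDiscreteValuationRing R] (hA : ∀ a, algebraMap A K a ∈ R) {p : ℕ} [NeZero p] {π : R}
    (hπ : Irreducible π) (hp : (p : K) ∈ powLattice R π 1) (n : ℕ) {μ : B.Weight K}
    (hμ : ∀ δ, (p : K) ^ n * B.pairingCoroot μ δ ∈ R) {α : b.support}
    (hα : ∀ m : ℕ, B.pairingCoroot μ α ≠ m) :
    B.annCompletedIrred R p n hπ μ ≤ B.annCompletedIrred R p n hπ (B.dotReflect α μ) := by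
  obtain ⟨h₀, h₁, hh₀, hh₁⟩ := B.exists_heights K hdet α
  have hv := B.isHighestWeightGenerator_irred μ
  obtain ⟨χ, hχ, hχH⟩ := hv.exists_functional (B.irredVector_ne_zero hdet hh₀ μ) hh₀
  let D : B.StringDatum μ α (B.Irred μ) := ⟨_, hv, χ, hχ, hχH, h₀, h₁, hh₀, hh₁, hα⟩
  have hD : D.IsIntegral p n ((p : R) ^ n) := ⟨by push_cast; rfl, hA, fun δ => by
    push_cast
    exact hμ δ⟩
  have hΨ := hD.isVermaFunctional hπ
  obtain ⟨pr, hpr⟩ := exists_degreeProjections hh₀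
  have hnoeth := B.isNoetherianRing_gammaZero hA p n
  intro x hx
  rw [mem_annCompletedIrred_iff] at hx ⊢
  intro t
  -- All products `y x t s` stay in the closure of the annihilator of the highest-weight vector, so
  -- the bound on polynomials applies to `y x t` and its approximation `y u`.
  have h : MemClosure hπ (leftRadical (hD.Ψ hπ)) (x * t) := by
    refine hΨ.memClosure_leftRadical hpr hπ hh₀ hA fun y i => ?_
    obtain ⟨m, hm⟩ := exists_mem_gamma_neg (p := p) (n := n) hπ y
    -- As `y ∈ Γ_(-m)`, precision `i + m` for `u` gives precision `i` for `y u`.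
    refine ⟨i + m, fun u hu => hD.Ψ_mem hπ (hD.poly_mem_of_memClosure hπ hp
      (x := toCompletedUK R g p n hπ y * (x * t)) (fun s => ?_) ?_)⟩
    · rw [mul_assoc, mul_assoc]
      exact memClosure_of_mem_span hπ (Submodule.smul_mem _ _ (hx _))
    · have := mul_mem_gammaHat hπ (coe_mem_gammaHat hπ hm) hu
      rwa [mul_sub, ← map_mul, neg_add_cancel_comm_assoc] at this
  refine mem_span_of_memClosure hπ fun i => ?_
  obtain ⟨q, hq, hqi⟩ := h i
  exact ⟨q, hΨ.leftRadical_le hq, hqi⟩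

end ChevalleyBasis

/-- If `p` were a unit of `R`, its inverse would be integral over `ℤ_[p]`, which is integrally
closed in `ℚ_[p]`. -/
lemma natCast_mem_powLattice_one {p : ℕ} [Fact p.Prime] {F K : Type*} [Field F]
    [Algebra ℚ_[p] F] [Algebra ℤ_[p] F] [IsScalarTower ℤ_[p] ℚ_[p] F] [Field K] [CharZero K]
    [Algebra F K] {R : ValuationSubring K} [IsDiscreteValuationRing R]
    (hR : ∀ x : F, algebraMap F K x ∈ R ↔ x ∈ integralClosure ℤ_[p] F) {π : R}
    (hπ : Irreducible π) : (p : K) ∈ powLattice R π 1 := by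
  have hp0 : (p : K) ≠ 0 := Nat.cast_ne_zero.2 (Fact.out : p.Prime).ne_zero
  have hnu : ¬ IsUnit (p : R) := by
    rintro ⟨u, hu⟩
    have h1 : (p : K)⁻¹ ∈ R := by
      have h2 : ((↑u⁻¹ : R) : K) * (p : K) = 1 := by
        have h3 : (↑u⁻¹ : R) * (p : R) = 1 := by rw [← hu, Units.inv_mul]
        exact_mod_cast congrArg Subtype.val h3
      rw [← eq_inv_of_mul_eq_one_left h2]
      exact Subtype.property _
    have h2 : algebraMap ℚ_[p] F (p : ℚ_[p])⁻¹ ∈ integralClosure ℤ_[p] F := by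
      rw [← hR]
      simpa using h1
    have h3 : IsIntegral ℤ_[p] (p : ℚ_[p])⁻¹ :=
      (isIntegral_algebraMap_iff (FaithfulSMul.algebraMap_injective ℚ_[p] F)).1 h2
    obtain ⟨z, hz⟩ := IsIntegrallyClosed.isIntegral_iff.1 h3
    have h4 : ‖(p : ℚ_[p])⁻¹‖ ≤ 1 := by
      rw [← hz]
      exact z.2
    rw [norm_inv, Padic.norm_p, inv_inv] at h4
    exact absurd (Fact.out : p.Prime).one_lt (not_lt.2 (by exact_mod_cast h4))
  have hmem : (p : R) ∈ IsLocalRing.maximalIdeal R := (IsLocalRing.mem_maximalIdeal _).2 hnu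
  rw [hπ.maximalIdeal_eq, Ideal.mem_span_singleton] at hmem
  obtain ⟨r, hr⟩ := hmem
  refine ⟨r, r.2, ?_⟩
  have := congrArg Subtype.val hr
  push_cast at this
  rw [zpow_one, this]

end AffinoidEnveloping

end

open AffinoidEnveloping in
theorem mainTheorem6
    (p : ℕ) [Fact p.Prime] (hp : p ≠ 2) (n : ℕ)
    (F : Type*) [Field F] [CharZero F] [Algebra ℚ_[p] F] [FiniteDimensional ℚ_[p] F]
    [Algebra ℤ_[p] F] [IsScalarTower ℤ_[p] ℚ_[p] F]
    (K : Type*) [Field K] [CharZero K] [Algebra F K]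
    (R : ValuationSubring K) [IsDiscreteValuationRing R]
    [IsAdicComplete (IsLocalRing.maximalIdeal R) R]
    (hR : ∀ x : F, algebraMap F K x ∈ R ↔ x ∈ integralClosure ℤ_[p] F)
    (π : R) (hπ : Irreducible π)
    (g : Type*) [LieRing g] [LieAlgebra (integralClosure ℤ_[p] F) g]
    [Module.Free (integralClosure ℤ_[p] F) g] [Module.Finite (integralClosure ℤ_[p] F) g]
    [LieAlgebra.IsSemisimple F (F ⊗[integralClosure ℤ_[p] F] g)]
    (H : LieSubalgebra F (F ⊗[integralClosure ℤ_[p] F] g)) [H.IsCartanSubalgebra]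
    [LieModule.IsTriangularizable F H (F ⊗[integralClosure ℤ_[p] F] g)]
    (b : (LieAlgebra.IsKilling.rootSystem H).Base)
    [DecidableEq b.support] (hdet : ¬ (p : ℤ) ∣ b.cartanMatrix.det)
    (B : ChevalleyBasis b (integralClosure ℤ_[p] F) g)
    (hB : ∀ β : H.root, (1 : F) ⊗ₜ[integralClosure ℤ_[p] F] B.e β ∈
      LieAlgebra.rootSpace H (β : LieModule.Weight F H (F ⊗[integralClosure ℤ_[p] F] g)))
    (lam : B.Weight K)
    (hlam : ∀ x ∈ integralLattice (A := integralClosure ℤ_[p] F) R B.cartan,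
      lam ((p : K) ^ n • x) ∈ R)
    (α : b.support)
    (hα : ¬ ∃ m : ℕ, B.pairingCoroot (lam + B.rho K) α = m) :
    B.annCompletedIrred R p n hπ lam ≤ B.annCompletedIrred R p n hπ (B.dotReflect α lam) := by
  refine B.annCompletedIrred_le_dotReflect (fun h => hdet (h ▸ dvd_zero _))
    (fun a => (hR a).2 a.2) hπ (natCast_mem_powLattice_one hR hπ) n (fun δ => ?_) fun m hm => ?_
  · have h := hlam _ (AddSubgroup.subset_closure ⟨1, R.one_mem, B.hCartan δ, rfl⟩)
    rwa [map_smul, smul_eq_mul] at h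
  -- `ρ` pairs to `1` with the coroot of `α`, which shifts the excluded values by one.
  · refine hα ⟨m + 1, ?_⟩
    have h : B.pairingCoroot (lam + B.rho K) α =
        B.pairingCoroot lam α + B.pairingCoroot (B.rho K) α := rfl
    rw [h, hm, B.pairingCoroot_rho K α]
    push_cast
    rfl
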